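/- Let $S\ge 0$, let $p_0,\dots,p_{S+1}\in\mathbb{C}$ be distinct, let $A_0,\dots,A_{S+1}$ be complex $d\times d$ matrices, and put $A(x)=\sum_{j=0}^{S+1}\frac{1}{x-p_j}A_j$, $Q(x)=\prod_{j=0}^{S+1}(x-p_j)$, $A_\infty=\sum_{j=0}^{S+1}A_j$. Let $D\subseteq\mathbb{C}$ be a simply connected domain containing $p_0,\dots,p_{S+1}$, and let $\mathbf f(x,\mathbf u)\in\mathbb{C}^d$ be analytic for $x\in D$ and small $|\mathbf u|$, $\mathbf u\in\mathbb{C}^d$, with $\mathbf f(x,\cdot)$ vanishing to order at least two at $\mathbf u=0$ for each $x\in D$. Assume that each of the matrices $A_0,\dots,A_{S+1},A_\infty$ is nonlinearly nonresonant, where a matrix with eigenvalues $\lambda_1,\dots,\lambda_d$ (counted with multiplicity) is called nonlinearly nonresonant if $k+\mathbf m\cdot\boldsymbol\lambda-\lambda_i\neq 0$ for all $k\in\mathbb{N}=\{0,1,2,\dots\}$, all $\mathbf m\in\mathbb{N}^d$ with $|\mathbf m|=m_1+\dots+m_d\ge 2$, and all $i=1,\dots,d$. Then there exists a unique formal series $$\boldsymbol\psi(x,\mathbf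 u)=\sum_{\mathbf m\in\mathbb{N}^d,\ |\mathbf m|\ge 2}\boldsymbol\psi_{\mathbf m}(x)\,\mathbf u^{\mathbf m},$$ with each $\boldsymbol\psi_{\mathbf m}$ a $\mathbb{C}^d$-valued polynomial in $x$ of degree at most $S$, such that the system $$\frac{d\mathbf u}{dx}=A(x)\mathbf u+\frac{1}{Q(x)}\mathbf f(x,\mathbf u)$$ is formally equivalent to $$\frac{d\mathbf w}{dx}=A(x)\mathbf w+\frac{1}{Q(x)}\boldsymbol\psi(x,\mathbf w)$$ through a change of variables given by a formal series $\mathbf u=\mathbf w+\mathbf h(x,\mathbf w)$, $\mathbf h(x,\mathbf w)=\sum_{|\mathbf m|\ge 2}\mathbf h_{\mathbf m}(x)\mathbf w^{\mathbf m}$, with each $\mathbf h_{\mathbf m}$ analytic on $D$. Here formal equivalence means that, for every $x\in D\setminus\{p_0,\dots,p_{S+1}\}$, the identity $$\partial_x\mathbf h+(I+d_{\mathbf w}\mathbf h)\Bigl(A\mathbf w+\tfrac1Q\boldsymbol\psi(x,\mathbf w)\Bigr)=A\,(\mathbf w+\mathbf h)+\tfrac1Q\,\mathbf f(x,\mathbf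 w+\mathbf h)$$ holds between formal power series in $\mathbf w$, $\mathbf f(x,\cdot)$ being replaced by its Taylor series at $\mathbf u=0$. -/

import Mathlib

open MvPowerSeries

noncomputable section

namespace FuchsianNormalForm

/-- A `d × d` complex matrix is nonlinearly nonresonant if its eigenvalues `ev 1, …, ev d`
(listed with multiplicity, in any order) satisfy `k + m · ev - ev i ≠ 0` for all `k ∈ ℕ`,
all multi-indices `m` with `|m| ≥ 2`, and all `i`. -/
def NonlinearlyNonresonant {d : ℕ} (M : Matrix (Fin d) (Fin d) ℂ) : Prop :=
  ∀ ev : Fin d → ℂ, M.charpoly.roots = Finset.univ.val.map ev →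
    ∀ (k : ℕ) (m : Fin d → ℕ) (i : Fin d), 2 ≤ ∑ l, m l →
      (k : ℂ) + ∑ l, (m l : ℂ) * ev l - ev i ≠ 0

/-- The Fuchsian matrix `A(x) = ∑ j, (x - p j)⁻¹ A j`. -/
def fuchsianMatrix {n d : ℕ} (p : Fin n → ℂ) (A : Fin n → Matrix (Fin d) (Fin d) ℂ) (x : ℂ) :
    Matrix (Fin d) (Fin d) ℂ :=
  ∑ j, (x - p j)⁻¹ • A j

/-- The product `Q(x) = ∏ j, (x - p j)`. -/
def Q {n : ℕ} (p : Fin n → ℂ) (x : ℂ) : ℂ := ∏ j, (x - p j)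

/-- The partial derivative `∂g/∂u_i` of a `ℂ^d`-valued function on `ℂ^d`. -/
def partialDeriv {d : ℕ} (i : Fin d) (g : (Fin d → ℂ) → Fin d → ℂ) : (Fin d → ℂ) → Fin d → ℂ :=
  fun u => fderiv ℂ g u (Pi.single i 1)

/-- The iterated partial derivative `∂_1^{m_1} ⋯ ∂_d^{m_d} g`. -/
def multiDeriv {d : ℕ} (m : Fin d →₀ ℕ) (g : (Fin d → ℂ) → Fin d → ℂ) : (Fin d → ℂ) → Fin d → ℂ :=
  (List.finRange d).foldr (fun i G => (partialDeriv i)^[m i] G) g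

/-- A `d`-tuple of formal power series in `d` variables over `ℂ`. -/
abbrev FormalMap (d : ℕ) : Type := Fin d → MvPowerSeries (Fin d) ℂ

/-- The Taylor series at `u = 0` of a `ℂ^d`-valued function `g`: its coefficient at `u^m` is
`(1 / m!) ∂^m g (0)`. -/
def taylorSeries {d : ℕ} (g : (Fin d → ℂ) → Fin d → ℂ) : FormalMap d :=
  fun i m => (∏ l, ((m l).factorial : ℂ))⁻¹ * multiDeriv m g 0 i

/-- The linear map `u ↦ M u` as a tuple of formal power series. -/
def linearSeries {d : ℕ} (M : Matrix (Fin d) (Fin d) ℂ) : FormalMap d :=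
  fun i => ∑ k, M i k • (X k : MvPowerSeries (Fin d) ℂ)

/-- The right-hand side `A(x) u + f(x, u) / Q(x)` expanded as a formal series in `u`. -/
def nonlinearSystem {n d : ℕ} (p : Fin n → ℂ) (A : Fin n → Matrix (Fin d) (Fin d) ℂ)
    (f : ℂ → (Fin d → ℂ) → Fin d → ℂ) (x : ℂ) : FormalMap d :=
  linearSeries (fuchsianMatrix p A x) + (Q p x)⁻¹ • taylorSeries (f x)

/-- The value at `x` of a formal series whose coefficients are polynomials in `x`. -/
def evalSeries {d : ℕ} (psi : Fin d → MvPowerSeries (Fin d) (Polynomial ℂ)) (x : ℂ) :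
    FormalMap d :=
  fun i => MvPowerSeries.map (Polynomial.evalRingHom x) (psi i)

/-- The right-hand side `A(x) w + ψ(x, w) / Q(x)` as a formal series in `w`. -/
def normalForm {n d : ℕ} (p : Fin n → ℂ) (A : Fin n → Matrix (Fin d) (Fin d) ℂ)
    (psi : Fin d → MvPowerSeries (Fin d) (Polynomial ℂ)) (x : ℂ) : FormalMap d :=
  linearSeries (fuchsianMatrix p A x) + (Q p x)⁻¹ • evalSeries psi x

/-- The formal series `∑_{|m| ≥ 2} h_m(x) w^m`. -/
def higherSeries {d : ℕ} (h : (Fin d →₀ ℕ) → ℂ → Fin d → ℂ) (x : ℂ) : FormalMap d :=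
  fun i m => if 2 ≤ m.degree then h m x i else 0

/-- The formal change of variables `w ↦ w + ∑_{|m| ≥ 2} h_m(x) w^m`. -/
def changeOfVariables {d : ℕ} (h : (Fin d →₀ ℕ) → ℂ → Fin d → ℂ) (x : ℂ) : FormalMap d :=
  fun i => X i + higherSeries h x i

/-- The derivative with respect to `x`, coefficient by coefficient, of a formal series whose
coefficients are functions of `x`. -/
def xDeriv {d : ℕ} (Phi : ℂ → FormalMap d) (x : ℂ) : FormalMap d :=
  fun i m => deriv (fun t => coeff m (Phi t i)) x

/-- The formal change of variables `u = Phi(x, w)` takes `u' = F(x, u)` into `w' = G(x, w)` for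
`x ∈ U`: differentiating `u = Phi(x, w)` along `w' = G(x, w)` one obtains `F(x, Phi(x, w))`, that
is, `∂_x Phi + (d_w Phi) G = F(x, Phi)` as formal power series in `w`, for every `x ∈ U`. -/
def TransformsOn {d : ℕ} (U : Set ℂ) (Phi F G : ℂ → FormalMap d) : Prop :=
  ∀ x ∈ U, ∀ i,
    xDeriv Phi x i + ∑ k, pderiv ℂ k (Phi x i) * G x k = MvPowerSeries.subst (Phi x) (F x i)

end FuchsianNormalForm

end

/-!
# Polynomial normal forms of nonlinear perturbations of Fuchsian systems

Compared degree by degree in `w`, the conjugacy equation becomes a sequence of linear problems. If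
`h` and `ψ` are known in degrees below `N ≥ 2`, then in degree `N` it reads

  `h' + ∑ j, (x - p j)⁻¹ ad (A j) h + ψ / Q = R / Q`,

where `R` is holomorphic on `D` and known (`transformsOn_iff`, `vanishesBelow_nonlinearTerms_sub`),
and `ad M` is the operator `H ↦ dH · (M w) - M H` on tuples of forms of degree `N` (`adjoint`).
If `ev` lists the eigenvalues of `M`, those of `ad M` are of the form `m · ev - ev i` with
`|m| = N`. So nonlinear nonresonance of `∑ j, A j` makes `k + ∑ j, ad (A j)` invertible for
`k = 0, 1, 2, …` (`eq_zero_of_smul_add_adjoint`). It remains to prove a linear theorem: for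
matrices `B j` with all `k + ∑ j, B j` invertible, and for every `R` holomorphic on `D`, there is
exactly one pair of a `y` holomorphic on `D` and a vector `ψ` of polynomials of degree at most `S`
with `Q (y' + ∑ j, (x - p j)⁻¹ B j y) + ψ = R` (`exists_solution`, `eq_zero_of_homogeneous`).

For polynomial `R` this is elimination of leading terms: on `x ^ k v` the operator has the leading
term `x ^ (k + S + 1) (k + ∑ j, B j) v` (`exists_polyOp_add_eq`). The general case follows by
approximation, which needs two ingredients.

* An estimate of `y` and `ψ` by `R`, in the maximum norm over suitable compact sets `K ⊆ D`
  (`exists_estimate`). The part of the operator that involves only a primitive of `y'` is compact in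
  this norm, and the polynomial case says that the whole operator is onto. So the estimate is the
  Fredholm alternative, in a form for incomplete spaces (`exists_bound_of_totallyBounded`).
* Runge's theorem on the simply connected domain `D` (`exists_polynomial_near`). If `P(K)` denotes
  the uniform closure of the polynomials in `C(K)`, the spectrum of the coordinate in `P(K)` is `K`
  with some holes filled in, and it stays inside `D` because the complement of `D` has no compact
  open piece (`eq_empty_of_compl_eq_union`). Then the Cauchy–Pompeiu formula, with the Cauchy
  kernel replaced by the resolvent of the coordinate, exhibits holomorphic functions on `D` as
  elements of `P(K)`.

A solution for `R` is the limit of those for approximating polynomials. Conversely, a homogeneous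
solution `(y, ψ)` is approximated by `(q, ψ)` with `q` polynomial, and the estimate shows that both
components vanish.
-/

noncomputable section

namespace FuchsianNormalForm

/-! ### Compact perturbations of the identity -/

section CompactPerturbation

open Filter Topology Module End

/-- A compact perturbation of the identity is bounded below on every closed complement of its
kernel. -/
lemma exists_bound_on_complement {X : Type*} [NormedAddCommGroup X] [NormedSpace ℂ X]
    {T : X →L[ℂ] X} (hT : IsCompactOperator T) {M : Submodule ℂ X} (hM : IsClosed (M : Set X))
    (hker : ∀ x ∈ M, T x = x → x = 0) :
    ∃ C : ℝ, ∀ x ∈ M, ‖x‖ ≤ C * ‖x - T x‖ := by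
  by_contra! hcon
  have hseq : ∀ n : ℕ, ∃ x ∈ M, ‖x‖ = 1 ∧ ‖x - T x‖ ≤ 1 / ((n : ℝ) + 1) := by
    intro n
    obtain ⟨x, hxM, hx⟩ := hcon ((n : ℝ) + 1)
    have hx0 : 0 < ‖x‖ := lt_of_le_of_lt (by positivity) hx
    refine ⟨((‖x‖⁻¹ : ℝ) : ℂ) • x, M.smul_mem _ hxM, ?_, ?_⟩
    · rw [norm_smul, Complex.norm_real, norm_inv, norm_norm, inv_mul_cancel₀ hx0.ne']
    · rw [map_smul, ← smul_sub, norm_smul, Complex.norm_real, norm_inv, norm_norm,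
        le_div_iff₀ (by positivity), inv_mul_eq_div, div_mul_eq_mul_div, div_le_one hx0]
      linarith
  choose x hxM hx1 hx using hseq
  obtain ⟨K, hK, hK'⟩ := hT.image_closedBall_subset_compact 1
  obtain ⟨y, -, φ, hφ, hy⟩ := hK.tendsto_subseq (x := fun n => T (x n))
    (fun n => hK' ⟨x n, by simp [hx1 n], rfl⟩)
  have hsub : Tendsto (fun n => x n - T (x n)) atTop (𝓝 0) :=
    squeeze_zero_norm hx tendsto_one_div_add_atTop_nhds_zero_nat
  have hxy : Tendsto (fun n => x (φ n)) atTop (𝓝 y) := by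
    have := (hsub.comp hφ.tendsto_atTop).add hy
    simpa using this
  have hyM : y ∈ M := hM.mem_of_tendsto hxy (Eventually.of_forall fun n => hxM _)
  have hTy : T y = y := tendsto_nhds_unique ((T.continuous.tendsto y).comp hxy) hy
  have hy1 : ‖y‖ = 1 := tendsto_nhds_unique hxy.norm (by simp [hx1])
  rw [hker y hyM hTy, norm_zero] at hy1
  exact zero_ne_one hy1

/-- If `1 - T` has dense range and `T` is compact then `1 - T` is injective. Indeed the inverse `S`
of `1 - T` on a complement of its kernel satisfies `S = 1 + T S`; it is injective, hence surjective
by the Fredholm alternative, so that the complement is the whole space. -/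
lemma eq_zero_of_denseRange_one_sub {X : Type*} [NormedAddCommGroup X] [NormedSpace ℂ X]
    [CompleteSpace X] {T : X →L[ℂ] X} (hT : IsCompactOperator T)
    (hdense : DenseRange fun x => x - T x) {x : X} (hx : T x = x) : x = 0 := by
  set U : X →L[ℂ] X := 1 - T with hU
  have hUx : ∀ x, U x = x - T x := fun x => rfl
  set N : Submodule ℂ X := U.ker with hN
  have hNmem : ∀ x, x ∈ N ↔ T x = x := by
    intro x
    rw [hN, LinearMap.mem_ker]
    change U x = 0 ↔ _
    rw [hUx, sub_eq_zero, eq_comm]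
  have hNfin : FiniteDimensional ℂ N := by
    have hNc : IsClosed (N : Set X) := U.isClosed_ker
    have : IsCompactOperator (id : N → N) := by
      have h1 : IsCompactOperator (T.restrict (p := N) (q := N) (fun x hx => by
          have hx' := (hNmem x).1 hx
          change T x ∈ N
          rwa [hx'])) := by
        exact IsCompactOperator.restrict (f := (T : X →ₗ[ℂ] X)) hT
          (V := N) (fun x hx => by
            have hx' := (hNmem x).1 hx
            change T x ∈ N
            rwa [hx']) hNc
      convert h1 using 1
      ext z
      exact ((hNmem z).1 z.2).symm
    exact FiniteDimensional.of_isCompactOperator_id (𝕜 := ℂ) this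
  obtain ⟨M, hMc, hMN⟩ :=
    (Submodule.ClosedComplemented.of_finiteDimensional N).exists_isClosed_isCompl
  obtain ⟨C, hC⟩ := exists_bound_on_complement hT hMc (fun x hxM hxT =>
    (Submodule.disjoint_def.1 hMN.disjoint) x ((hNmem x).2 hxT) hxM)
  set UM : M →L[ℂ] X := U.comp M.subtypeL with hUM
  have : CompleteSpace M := hMc.completeSpace_coe
  have hanti : AntilipschitzWith (Real.toNNReal C) UM := by
    refine AddMonoidHomClass.antilipschitz_of_bound UM fun x => ?_
    refine (hC x x.2).trans ?_
    exact mul_le_mul_of_nonneg_right (Real.le_coe_toNNReal C) (norm_nonneg _)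
  have hrange : Set.range UM = Set.range (fun x => x - T x) := by
    ext z
    constructor
    · rintro ⟨y, rfl⟩
      exact ⟨y, rfl⟩
    · rintro ⟨y, rfl⟩
      obtain ⟨a, ha, b, hb, rfl⟩ :=
        Submodule.mem_sup.1 (hMN.sup_eq_top ▸ Submodule.mem_top (x := y))
      refine ⟨⟨b, hb⟩, ?_⟩
      have := (hNmem a).1 ha
      change b - T b = a + b - T (a + b)
      rw [map_add, this]
      abel
  have hsurj : Function.Surjective UM := by
    have hcl : IsClosed (Set.range UM) := hanti.isClosed_range UM.uniformContinuous
    rw [← Set.range_eq_univ, ← hcl.closure_eq, hrange]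
    exact hdense.closure_range
  let e : M ≃L[ℂ] X := ContinuousLinearEquiv.ofBijective UM
    (LinearMap.ker_eq_bot.2 hanti.injective) (LinearMap.range_eq_top.2 hsurj)
  have he : ∀ m : M, e m = (m : X) - T m := fun m => rfl
  let S : X →L[ℂ] X := M.subtypeL.comp (e.symm : X →L[ℂ] M)
  have hS : ∀ z, S z - T (S z) = z := fun z => by
    have := he (e.symm z)
    rw [e.apply_symm_apply] at this
    exact this.symm
  have hSM : ∀ z, S z ∈ M := fun z => (e.symm z).2
  have hTS : IsCompactOperator (-(T.comp S)) := (hT.comp_clm S).neg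
  have hnot : ¬ HasEigenvalue (((-(T.comp S) : X →L[ℂ] X)) : End ℂ X) 1 := by
    intro h
    obtain ⟨z, hz⟩ := h.exists_hasEigenvector
    have h1 : -(T (S z)) = z := by simpa using hz.apply_eq_smul
    have h2 := hS z
    have h3 : S z = 0 := by
      rw [eq_add_of_sub_eq h2]
      nth_rewrite 1 [← h1]
      exact neg_add_cancel _
    apply hz.2
    rw [← h1, h3]; simp
  have hres := (hTS.hasEigenvalue_or_mem_resolventSet one_ne_zero).resolve_left hnot
  rw [spectrum.mem_resolventSet_iff, ContinuousLinearMap.isUnit_iff_bijective] at hres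
  obtain ⟨z, hz⟩ := hres.2 x
  have hzx : S z = x := by
    rw [← hz]
    have := hS z
    rw [sub_eq_iff_eq_add] at this
    simp [← this]
  exact (Submodule.disjoint_def.1 hMN.disjoint) x ((hNmem x).2 hx) (hzx ▸ hSM z)

/-- The completion of `E` reduces this to a statement about Banach spaces. -/
lemma exists_bound_of_surjective_one_sub {E : Type*} [SeminormedAddCommGroup E] [NormedSpace ℂ E]
    (T : E →L[ℂ] E) (hT : TotallyBounded (T '' Metric.closedBall 0 1))
    (hs : Function.Surjective fun z => z - T z) :
    ∃ C : ℝ, ∀ z, ‖z‖ ≤ C * ‖z - T z‖ := by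
  let X := UniformSpace.Completion E
  let c : E →L[ℂ] X := UniformSpace.Completion.toComplL
  have hcd : DenseRange c := UniformSpace.Completion.denseRange_coe
  have hcu : IsUniformInducing c := UniformSpace.Completion.isUniformInducing_coe E
  have hcn : ∀ z, ‖c z‖ = ‖z‖ := fun z => UniformSpace.Completion.norm_coe z
  let T' : X →L[ℂ] X := (c.comp T).extend c
  have hT' : ∀ z, T' (c z) = c (T z) := fun z =>
    ContinuousLinearMap.extend_eq (c.comp T) hcd hcu z
  have hcomp : IsCompactOperator T' := by
    refine (isCompactOperator_iff_image_ball_subset_compact (T' : X →ₗ[ℂ] X) (r := 1)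
      one_pos).2 ⟨closure (c '' (T '' Metric.closedBall 0 1)), ?_, ?_⟩
    · exact ((hT.image c.uniformContinuous).closure).isCompact_of_isClosed isClosed_closure
    · have h1 : Metric.ball (0 : X) 1 ⊆ closure (c '' Metric.closedBall 0 1) := by
        have h2 := hcd.open_subset_closure_inter (Metric.isOpen_ball (x := (0 : X)) (ε := 1))
        refine h2.trans (closure_mono ?_)
        rintro _ ⟨hz, ⟨z, rfl⟩⟩
        refine ⟨z, ?_, rfl⟩
        rw [mem_ball_zero_iff, hcn] at hz
        rw [mem_closedBall_zero_iff]
        exact hz.le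
      refine (Set.image_mono h1).trans ((image_closure_subset_closure_image T'.continuous).trans
        (closure_mono ?_))
      rintro _ ⟨_, ⟨z, hz, rfl⟩, rfl⟩
      exact ⟨T z, ⟨z, hz, rfl⟩, (hT' z).symm⟩
  have hdense : DenseRange fun x => x - T' x := by
    refine hcd.mono ?_
    rintro _ ⟨z, rfl⟩
    obtain ⟨w, rfl⟩ := hs z
    exact ⟨c w, by simp only [map_sub, hT']⟩
  obtain ⟨C, hC⟩ := exists_bound_on_complement hcomp (M := ⊤) isClosed_univ
    (fun x _ hx => eq_zero_of_denseRange_one_sub hcomp hdense hx)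
  refine ⟨C, fun z => ?_⟩
  have := hC (c z) trivial
  rwa [hT', ← map_sub, hcn, hcn] at this

/-- A form of the Fredholm alternative on a space that need not be complete: for the seminorm
induced by `j`, a map `1 - T` that is onto and in which `T` takes the unit ball to a totally bounded
set is bounded below. -/
theorem exists_bound_of_totallyBounded {E Y : Type*} [AddCommGroup E] [Module ℂ E]
    [NormedAddCommGroup Y] [NormedSpace ℂ Y] (j : E →ₗ[ℂ] Y) (T : E →ₗ[ℂ] E)
    (hT : TotallyBounded ((fun z => j (T z)) '' {z | ‖j z‖ ≤ 1}))
    (hs : Function.Surjective fun z => z - T z) :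
    ∃ C : ℝ, ∀ z, ‖j z‖ ≤ C * ‖j (z - T z)‖ := by
  let : SeminormedAddCommGroup E := SeminormedAddCommGroup.induced E Y j
  let : NormedSpace ℂ E := NormedSpace.induced ℂ E Y j
  have hju : IsUniformInducing j := ⟨rfl⟩
  obtain ⟨R, hR⟩ := isBounded_iff_forall_norm_le.1 hT.isBounded
  have hb : ∀ z : E, ‖T z‖ ≤ R * ‖z‖ := by
    intro z
    change ‖j (T z)‖ ≤ R * ‖j z‖
    by_cases h0 : ‖j z‖ = 0
    · -- every multiple of `z` lies in the unit ball
      have h1 : ∀ n : ℕ, n * ‖j (T z)‖ ≤ R := fun n => by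
        have := hR (j (T ((n : ℂ) • z))) ⟨(n : ℂ) • z, by simp [norm_smul, h0], rfl⟩
        simpa [norm_smul] using this
      have h2 : ‖j (T z)‖ = 0 := by
        by_contra hne
        have hpos : 0 < ‖j (T z)‖ := lt_of_le_of_ne (norm_nonneg _) (Ne.symm hne)
        obtain ⟨n, hn⟩ := exists_nat_gt (R / ‖j (T z)‖)
        rw [div_lt_iff₀ hpos] at hn
        exact absurd (h1 n) (not_le.2 hn)
      rw [h0, h2, mul_zero]
    · have hpos : 0 < ‖j z‖ := lt_of_le_of_ne (norm_nonneg _) (Ne.symm h0)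
      have := hR (j (T (((‖j z‖⁻¹ : ℝ) : ℂ) • z))) ⟨((‖j z‖⁻¹ : ℝ) : ℂ) • z, by
        simp [norm_smul, h0], rfl⟩
      rw [map_smul, map_smul, norm_smul, Complex.norm_real, norm_inv, norm_norm,
        inv_mul_le_iff₀ hpos] at this
      linarith
  let T' : E →L[ℂ] E := T.mkContinuous R hb
  have hball : {z : E | ‖j z‖ ≤ 1} = Metric.closedBall (0 : E) 1 := by
    ext z
    rw [mem_closedBall_zero_iff]
    rfl
  have := exists_bound_of_surjective_one_sub T' (by
    rw [← totallyBounded_image_iff hju, Set.image_image, ← hball]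
    exact hT) hs
  exact this

end CompactPerturbation

/-! ### The Fuchsian operator on polynomials -/

section PolynomialOperator

open Polynomial (derivative degree natDegree)
open Lagrange (nodal)

variable {ι : Type*} [Fintype ι] {n S : ℕ}

/-- Multiplication by the polynomial matrix `Q(x) ∑ j, (x - p j)⁻¹ B j`, where
`Q = ∏ j, (x - p j)`. -/
def polyMatrix (p : Fin n → ℂ) (B : Fin n → Matrix ι ι ℂ) :
    (ι → Polynomial ℂ) →ₗ[ℂ] (ι → Polynomial ℂ) where
  toFun y := fun i => ∑ j, nodal (Finset.univ.erase j) p * ∑ k, Polynomial.C (B j i k) * y k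
  map_add' y z := by
    ext1 i
    simp only [Pi.add_apply, mul_add, Finset.sum_add_distrib]
  map_smul' c y := by
    ext1 i
    simp only [Pi.smul_apply, mul_smul_comm, ← Finset.smul_sum, RingHom.id_apply]

lemma polyMatrix_apply (p : Fin n → ℂ) (B : Fin n → Matrix ι ι ℂ) (y : ι → Polynomial ℂ) (i : ι) :
    polyMatrix p B y i =
      ∑ j, nodal (Finset.univ.erase j) p * ∑ k, Polynomial.C (B j i k) * y k := rfl

/-- The operator `y ↦ Q (y' + ∑ j, (x - p j)⁻¹ B j y)` on vectors of polynomials. -/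
def polyOp (p : Fin n → ℂ) (B : Fin n → Matrix ι ι ℂ) :
    (ι → Polynomial ℂ) →ₗ[ℂ] (ι → Polynomial ℂ) where
  toFun y := fun i => nodal Finset.univ p * derivative (y i) + polyMatrix p B y i
  map_add' y z := by
    ext1 i
    simp only [Pi.add_apply, map_add, mul_add]
    ring
  map_smul' c y := by
    ext1 i
    simp only [Pi.smul_apply, map_smul, mul_smul_comm, smul_add, RingHom.id_apply]

lemma polyOp_apply (p : Fin n → ℂ) (B : Fin n → Matrix ι ι ℂ) (y : ι → Polynomial ℂ) (i : ι) :
    polyOp p B y i = nodal Finset.univ p * derivative (y i) + polyMatrix p B y i := rfl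

/-- The leading coefficient of the Fuchsian operator on `x ^ k v` is `(k + ∑ j, B j) v`. -/
lemma coeff_polyOp_monomial (p : Fin (S + 2) → ℂ) (B : Fin (S + 2) → Matrix ι ι ℂ) (v : ι → ℂ)
    (k t : ℕ) (i : ι) :
    (polyOp p B (fun i => Polynomial.C (v i) * Polynomial.X ^ k) i).coeff (S + 1 + k + t) =
      if t = 0 then (k : ℂ) * v i + ((∑ j, B j).mulVec v) i else 0 := by
  classical
  have h1 : ∀ j : Fin (S + 2), (nodal (Finset.univ.erase j) p).coeff (S + 1 + t) =
      if t = 0 then 1 else 0 := by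
    intro j
    have hd : (nodal (Finset.univ.erase j) p).natDegree = S + 1 := by
      rw [Lagrange.natDegree_nodal, Finset.card_erase_of_mem (Finset.mem_univ j)]; simp
    split_ifs with ht
    · subst ht
      have := (Lagrange.nodal_monic (s := Finset.univ.erase j) (v := p)).coeff_natDegree
      rwa [hd] at this
    · exact Polynomial.coeff_eq_zero_of_natDegree_lt (by omega)
  have h2 : (nodal Finset.univ p).coeff (S + 2 + t) = if t = 0 then 1 else 0 := by
    have hd : (nodal Finset.univ p).natDegree = S + 2 := by
      rw [Lagrange.natDegree_nodal]; simp
    split_ifs with ht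
    · subst ht
      have := (Lagrange.nodal_monic (s := Finset.univ) (v := p)).coeff_natDegree
      rwa [hd] at this
    · exact Polynomial.coeff_eq_zero_of_natDegree_lt (by omega)
  have h3 : (nodal Finset.univ p * derivative (Polynomial.C (v i) * Polynomial.X ^ k)).coeff
      (S + 1 + k + t) = if t = 0 then (k : ℂ) * v i else 0 := by
    rcases k with _ | k
    · simp
    · rw [Polynomial.derivative_C_mul_X_pow, ← mul_assoc,
        show S + 1 + (k + 1) + t = (S + 2 + t) + (k + 1 - 1) by simp; ring,
        Polynomial.coeff_mul_X_pow, Polynomial.coeff_mul_C, h2]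
      split_ifs <;> push_cast <;> ring
  have h4 : ∀ j, (nodal (Finset.univ.erase j) p *
      ∑ l, Polynomial.C (B j i l) * (Polynomial.C (v l) * Polynomial.X ^ k)).coeff
      (S + 1 + k + t) = if t = 0 then (B j).mulVec v i else 0 := by
    intro j
    have : ∑ l, Polynomial.C (B j i l) * (Polynomial.C (v l) * Polynomial.X ^ k) =
        Polynomial.C ((B j).mulVec v i) * Polynomial.X ^ k := by
      simp only [Matrix.mulVec, dotProduct, map_sum, map_mul, Finset.sum_mul, mul_assoc]
    rw [this, ← mul_assoc, show S + 1 + k + t = (S + 1 + t) + k by ring,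
      Polynomial.coeff_mul_X_pow, Polynomial.coeff_mul_C, h1]
    split_ifs <;> ring
  rw [polyOp_apply, polyMatrix_apply, Polynomial.coeff_add, h3, Polynomial.finsetSum_coeff,
    Finset.sum_congr rfl fun j _ => h4 j]
  split_ifs
  · rw [Matrix.sum_mulVec, Finset.sum_apply]
  · simp

/-- If no `k + ∑ j, B j` is singular then every vector of polynomials is a value of the Fuchsian
operator plus polynomials of degree at most `S`: the leading terms are removed one by one. -/
theorem exists_polyOp_add_eq (p : Fin (S + 2) → ℂ) (B : Fin (S + 2) → Matrix ι ι ℂ)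
    (hB : ∀ (k : ℕ) (v : ι → ℂ), (k : ℂ) • v + (∑ j, B j).mulVec v = 0 → v = 0)
    (R : ι → Polynomial ℂ) :
    ∃ y ψ : ι → Polynomial ℂ, (∀ i, (ψ i).natDegree ≤ S) ∧ polyOp p B y + ψ = R := by
  classical
  have key : ∀ N : ℕ, ∀ R : ι → Polynomial ℂ, (∀ i, (R i).degree < N) →
      ∃ y ψ : ι → Polynomial ℂ, (∀ i, (ψ i).natDegree ≤ S) ∧ polyOp p B y + ψ = R := by
    intro N
    induction N with
    | zero =>
      intro R hR
      refine ⟨0, 0, fun i => by simp, ?_⟩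
      ext1 i
      have : R i = 0 := by
        have := hR i
        rw [← Polynomial.degree_eq_bot]
        simpa [Nat.WithBot.lt_zero_iff] using this
      simp [this]
    | succ N ih =>
      intro R hR
      by_cases hN : N ≤ S
      · refine ⟨0, R, fun i => ?_, by simp⟩
        rw [Polynomial.natDegree_le_iff_coeff_eq_zero]
        exact fun m hm => (Polynomial.degree_lt_iff_coeff_zero _ _).1 (hR i) m (by omega)
      · obtain ⟨k, rfl⟩ : ∃ k, N = S + 1 + k := ⟨N - (S + 1), by omega⟩
        let L : (ι → ℂ) →ₗ[ℂ] (ι → ℂ) := (k : ℂ) • LinearMap.id + (∑ j, B j).mulVecLin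
        have hL : Function.Surjective L := by
          rw [← LinearMap.injective_iff_surjective, ← LinearMap.ker_eq_bot, LinearMap.ker_eq_bot']
          exact fun v hv => hB k v hv
        obtain ⟨v, hv⟩ := hL (fun i => (R i).coeff (S + 1 + k))
        have hvi : ∀ i, (k : ℂ) * v i + ((∑ j, B j).mulVec v) i = (R i).coeff (S + 1 + k) :=
          fun i => congrFun hv i
        obtain ⟨y, ψ, hψ, hy⟩ := ih
          (R - polyOp p B (fun i => Polynomial.C (v i) * Polynomial.X ^ k)) (fun i => by
            rw [Polynomial.degree_lt_iff_coeff_zero]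
            intro m hm
            obtain ⟨t, rfl⟩ := Nat.exists_eq_add_of_le hm
            rw [Pi.sub_apply, Polynomial.coeff_sub, coeff_polyOp_monomial, hvi]
            split_ifs with ht
            · subst ht; simp
            · rw [(Polynomial.degree_lt_iff_coeff_zero _ _).1 (hR i) _ (by omega), sub_zero])
        refine ⟨y + (fun i => Polynomial.C (v i) * Polynomial.X ^ k), ψ, hψ, ?_⟩
        rw [map_add, add_right_comm, hy, sub_add_cancel]
  obtain ⟨N, hN⟩ : ∃ N : ℕ, ∀ i, (R i).degree < N := by
    refine ⟨∑ i, ((R i).natDegree + 1), fun i => ?_⟩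
    refine lt_of_le_of_lt Polynomial.degree_le_natDegree ?_
    have : (R i).natDegree + 1 ≤ ∑ i, ((R i).natDegree + 1) :=
      Finset.single_le_sum (f := fun i => (R i).natDegree + 1) (fun _ _ => Nat.zero_le _)
        (Finset.mem_univ i)
    exact_mod_cast this
  exact key N R hN

lemma derivative_surjective : Function.Surjective (derivative : Polynomial ℂ →ₗ[ℂ] _) := by
  intro q
  induction q using Polynomial.induction_on' with
  | add q₁ q₂ h₁ h₂ =>
    obtain ⟨a, ha⟩ := h₁
    obtain ⟨b, hb⟩ := h₂
    exact ⟨a + b, by rw [map_add, ha, hb]⟩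
  | monomial k c =>
    refine ⟨Polynomial.monomial (k + 1) (c / (k + 1)), ?_⟩
    rw [Polynomial.derivative_monomial, Nat.add_sub_cancel]
    congr 1
    push_cast
    exact div_mul_cancel₀ _ (Nat.cast_add_one_ne_zero k)

/-- A linear choice of the primitive of a polynomial that vanishes at `a`. -/
lemma exists_primitive (a : ℂ) : ∃ I : Polynomial ℂ →ₗ[ℂ] Polynomial ℂ,
    (∀ q, derivative (I q) = q) ∧ ∀ q, (I q).eval a = 0 := by
  obtain ⟨J, hJ⟩ := (derivative : Polynomial ℂ →ₗ[ℂ] _).exists_rightInverse_of_surjective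
    (LinearMap.range_eq_top.2 derivative_surjective)
  have hJ' : ∀ q, derivative (J q) = q := fun q => LinearMap.congr_fun hJ q
  refine ⟨J - (Polynomial.monomial 0).comp ((Polynomial.leval a).comp J), fun q => ?_, fun q => ?_⟩
  · simp [hJ']
  · simp

lemma eq_of_derivative_eq {f g : Polynomial ℂ} {a : ℂ} (h : derivative f = derivative g)
    (ha : f.eval a = g.eval a) : f = g := by
  have h1 : derivative (f - g) = 0 := by rw [map_sub, h, sub_self]
  have h2 := Polynomial.eq_C_of_derivative_eq_zero h1
  have h3 : (f - g).eval a = 0 := by rw [Polynomial.eval_sub, ha, sub_self]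
  rw [h2, Polynomial.eval_C] at h3
  rw [h3, map_zero] at h2
  exact sub_eq_zero.1 h2

end PolynomialOperator

/-! ### An a priori estimate for the Fuchsian operator -/

section Division

open Polynomial (derivative degree natDegree)
open Lagrange (nodal)
open Metric Set

/-- Division by a monic polynomial, as a linear map. -/
def divByMonicHom (Q : Polynomial ℂ) (hQ : Q.Monic) : Polynomial ℂ →ₗ[ℂ] Polynomial ℂ where
  toFun f := f /ₘ Q
  map_add' f g := (Polynomial.div_modByMonic_unique (f /ₘ Q + g /ₘ Q) ((f + g) %ₘ Q) hQ
    ⟨by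
      rw [Polynomial.add_modByMonic]
      linear_combination Polynomial.modByMonic_add_div f Q + Polynomial.modByMonic_add_div g Q,
     Polynomial.degree_modByMonic_lt _ hQ⟩).1
  map_smul' c f := (Polynomial.div_modByMonic_unique (c • (f /ₘ Q)) ((c • f) %ₘ Q) hQ
    ⟨by
      rw [Polynomial.smul_modByMonic, mul_smul_comm, ← smul_add, Polynomial.modByMonic_add_div],
     Polynomial.degree_modByMonic_lt _ hQ⟩).1

/-- A compact set containing `a` on which the primitives, vanishing at `a`, of the polynomials
bounded by `1` are uniformly bounded and equicontinuous. -/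
structure ControlsPrimitives (a : ℂ) (K : Set ℂ) : Prop where
  isCompact : IsCompact K
  mem : a ∈ K
  bound : ∃ M : ℝ, ∀ (q : Polynomial ℂ) (b : ℝ), (∀ x ∈ K, ‖(derivative q).eval x‖ ≤ b) →
    ∀ x ∈ K, ‖q.eval x - q.eval a‖ ≤ M * b
  equicont : ∀ x ∈ K, ∀ ε > 0, ∃ δ > 0, ∀ y ∈ K, dist y x < δ → ∀ q : Polynomial ℂ,
    (∀ z ∈ K, ‖(derivative q).eval z‖ ≤ 1) → ‖q.eval y - q.eval x‖ ≤ ε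

/-- By the maximum principle, a polynomial is controlled by its product with `x - a` on any set
that contains a disc about `a`. -/
lemma norm_eval_le_of_norm_sub_mul_le {K : Set ℂ} {a : ℂ} {r : ℝ} (hr : 0 < r)
    (ha : closedBall a r ⊆ K) (g : Polynomial ℂ) (b : ℝ)
    (hg : ∀ x ∈ K, ‖(x - a) * g.eval x‖ ≤ b) : ∀ x ∈ K, ‖g.eval x‖ ≤ r⁻¹ * b := by
  have far : ∀ x ∈ K, r ≤ dist x a → ‖g.eval x‖ ≤ r⁻¹ * b := by
    intro x hx hxa
    have h1 := hg x hx
    rw [norm_mul, ← dist_eq_norm] at h1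
    rw [le_inv_mul_iff₀ hr]
    exact (mul_le_mul_of_nonneg_right hxa (norm_nonneg _)).trans h1
  intro x hx
  by_cases hxa : r ≤ dist x a
  · exact far x hx hxa
  · refine Complex.norm_le_of_forall_mem_frontier_norm_le (U := ball a r) isBounded_ball
      (g.differentiable.diffContOnCl) (fun z hz => ?_) (subset_closure ?_)
    · rw [frontier_ball a hr.ne'] at hz
      exact far z (ha (sphere_subset_closedBall hz)) hz.ge
    · exact not_le.1 hxa

/-- A polynomial is controlled by its product with `∏ j ∈ s, (x - p j)`. -/
lemma exists_bound_of_nodal_mul {n : ℕ} (p : Fin n → ℂ) {K : Set ℂ}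
    (hp : ∀ j, ∃ r > 0, closedBall (p j) r ⊆ K) (s : Finset (Fin n)) :
    ∃ C : ℝ, 0 ≤ C ∧ ∀ (g : Polynomial ℂ) (b : ℝ), (∀ x ∈ K, ‖(nodal s p * g).eval x‖ ≤ b) →
      ∀ x ∈ K, ‖g.eval x‖ ≤ C * b := by
  classical
  induction s using Finset.induction_on with
  | empty => exact ⟨1, zero_le_one, fun g b h x hx => by simpa using h x hx⟩
  | insert a s ha ih =>
    obtain ⟨C, hC0, hC⟩ := ih
    obtain ⟨r, hr, hrK⟩ := hp a
    refine ⟨C * r⁻¹, by positivity, fun g b h x hx => ?_⟩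
    rw [mul_assoc]
    refine hC g (r⁻¹ * b) (norm_eval_le_of_norm_sub_mul_le hr hrK _ _ fun y hy => ?_) x hx
    have := h y hy
    rw [Lagrange.nodal_insert_eq_nodal ha, mul_assoc, Polynomial.eval_mul] at this
    simpa using this

/-- The remainder of a polynomial modulo `∏ j, (x - p j)` is found by interpolation, so that its
coefficients are controlled by the values at the points `p j`. -/
lemma exists_bound_coeff_modByMonic {n : ℕ} {p : Fin n → ℂ} (hp : Function.Injective p) :
    ∃ C : ℝ, 0 ≤ C ∧ ∀ (h : Polynomial ℂ) (b : ℝ), (∀ j, ‖h.eval (p j)‖ ≤ b) →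
      ∀ k, k < n → ‖(h %ₘ nodal Finset.univ p).coeff k‖ ≤ C * b := by
  classical
  refine ⟨∑ k ∈ Finset.range n, ∑ j, ‖(Lagrange.basis Finset.univ p j).coeff k‖, by positivity,
    fun h b hb k hk => ?_⟩
  have hQ : (nodal Finset.univ p).Monic := Lagrange.nodal_monic
  have h1 : h %ₘ nodal Finset.univ p =
      Lagrange.interpolate Finset.univ p (fun j => h.eval (p j)) := by
    refine Lagrange.eq_interpolate_of_eval_eq _ hp.injOn ?_ fun j _ => ?_
    · refine (Polynomial.degree_modByMonic_lt _ hQ).trans_eq ?_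
      rw [Lagrange.degree_nodal]
    · conv_rhs => rw [← Polynomial.modByMonic_add_div h (nodal Finset.univ p)]
      rw [Polynomial.eval_add, Polynomial.eval_mul,
        Lagrange.eval_nodal_at_node (Finset.mem_univ j), zero_mul, add_zero]
  rw [h1, Lagrange.interpolate_apply, Polynomial.finsetSum_coeff]
  calc ‖∑ j, (Polynomial.C (h.eval (p j)) * Lagrange.basis Finset.univ p j).coeff k‖
      ≤ ∑ j, ‖(Polynomial.C (h.eval (p j)) * Lagrange.basis Finset.univ p j).coeff k‖ :=
        norm_sum_le _ _
    _ ≤ ∑ j, ‖(Lagrange.basis Finset.univ p j).coeff k‖ * b := by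
        refine Finset.sum_le_sum fun j _ => ?_
        rw [Polynomial.coeff_C_mul, norm_mul, mul_comm]
        exact mul_le_mul_of_nonneg_left (hb j) (norm_nonneg _)
    _ = (∑ j, ‖(Lagrange.basis Finset.univ p j).coeff k‖) * b := by rw [Finset.sum_mul]
    _ ≤ _ := by
        rcases n with _ | n
        · omega
        have hb0 : 0 ≤ b := (norm_nonneg _).trans (hb 0)
        refine mul_le_mul_of_nonneg_right ?_ hb0
        exact Finset.single_le_sum
          (f := fun k => ∑ j, ‖(Lagrange.basis Finset.univ p j).coeff k‖)
          (fun _ _ => by positivity) (Finset.mem_range.2 hk)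

/-- Division by `∏ j, (x - p j)` is bounded for the maximum norm on `K`. -/
lemma exists_bound_divByMonic {n : ℕ} {p : Fin n → ℂ} (hp : Function.Injective p) {K : Set ℂ}
    (hK : IsCompact K) (hpK : ∀ j, ∃ r > 0, closedBall (p j) r ⊆ K) :
    ∃ C : ℝ, 0 ≤ C ∧ ∀ (h : Polynomial ℂ) (b : ℝ), (∀ x ∈ K, ‖h.eval x‖ ≤ b) →
      ∀ x ∈ K, ‖(h /ₘ nodal Finset.univ p).eval x‖ ≤ C * b := by
  obtain ⟨C₁, hC₁, h₁⟩ := exists_bound_coeff_modByMonic hp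
  obtain ⟨C₂, hC₂, h₂⟩ := exists_bound_of_nodal_mul p hpK Finset.univ
  obtain ⟨ρ, hρ⟩ := isBounded_iff_forall_norm_le.1 hK.isBounded
  have hQ : (nodal Finset.univ p).Monic := Lagrange.nodal_monic
  refine ⟨C₂ * (1 + ∑ k ∈ Finset.range n, C₁ * |ρ| ^ k), by positivity, fun h b hb => ?_⟩
  rw [mul_assoc]
  refine h₂ _ _ fun x hx => ?_
  have hb0 : 0 ≤ b := (norm_nonneg _).trans (hb x hx)
  have hmul : nodal Finset.univ p * (h /ₘ nodal Finset.univ p) = h - h %ₘ nodal Finset.univ p := by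
    rw [eq_sub_iff_add_eq, add_comm, Polynomial.modByMonic_add_div]
  rw [hmul, Polynomial.eval_sub]
  refine (norm_sub_le _ _).trans ?_
  rw [add_mul, one_mul, Finset.sum_mul]
  refine add_le_add (hb x hx) ?_
  rcases Nat.eq_zero_or_pos n with rfl | hn
  · simp
  have hdeg : (h %ₘ nodal Finset.univ p).natDegree < n := by
    have := Polynomial.natDegree_modByMonic_lt h hQ (by
      intro h0
      have := congrArg Polynomial.natDegree h0
      rw [Lagrange.natDegree_nodal] at this
      simp at this
      omega)
    simpa [Lagrange.natDegree_nodal] using this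
  rw [Polynomial.eval_eq_sum_range' hdeg]
  refine (norm_sum_le _ _).trans (Finset.sum_le_sum fun k hk => ?_)
  have hpj : ∀ j, ‖h.eval (p j)‖ ≤ b := fun j => by
    obtain ⟨r, hr, hrK⟩ := hpK j
    exact hb _ (hrK (mem_closedBall_self hr.le))
  rw [norm_mul, norm_pow]
  have h3 := h₁ h b hpj k (Finset.mem_range.1 hk)
  have h4 : ‖x‖ ^ k ≤ |ρ| ^ k :=
    pow_le_pow_left₀ (norm_nonneg _) ((hρ x hx).trans (le_abs_self _)) _
  calc _ ≤ (C₁ * b) * |ρ| ^ k := mul_le_mul h3 h4 (by positivity) (by positivity)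
    _ = _ := by ring

end Division

section Estimate

open Polynomial (derivative degree natDegree)
open Lagrange (nodal)
open Metric Set
open scoped BoundedContinuousFunction

variable {ι : Type*} [Fintype ι]

/-- The restriction of a vector of polynomials to a compact set `K`. -/
def restrictPoly (ι : Type*) [Fintype ι] (K : Set ℂ) [CompactSpace K] :
    (ι → Polynomial ℂ) →ₗ[ℂ] (K →ᵇ (ι → ℂ)) where
  toFun h := BoundedContinuousFunction.mkOfCompact
    ⟨fun x i => (h i).eval (x : ℂ), continuous_pi fun i =>
      (h i).continuous.comp continuous_subtype_val⟩
  map_add' f g := by ext x i; simp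
  map_smul' c f := by ext x i; simp

lemma restrictPoly_apply (K : Set ℂ) [CompactSpace K] (h : ι → Polynomial ℂ) (x : K) (i : ι) :
    restrictPoly ι K h x i = (h i).eval (x : ℂ) := rfl

lemma norm_eval_le_norm_restrictPoly {K : Set ℂ} [CompactSpace K] (h : ι → Polynomial ℂ) {x : ℂ}
    (hx : x ∈ K) (i : ι) : ‖(h i).eval x‖ ≤ ‖restrictPoly ι K h‖ :=
  (norm_le_pi_norm (restrictPoly ι K h ⟨x, hx⟩) i).trans
    ((restrictPoly ι K h).norm_coe_le_norm ⟨x, hx⟩)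

lemma norm_restrictPoly_le {K : Set ℂ} [CompactSpace K] {h : ι → Polynomial ℂ} {b : ℝ} (hb : 0 ≤ b)
    (hh : ∀ x ∈ K, ∀ i, ‖(h i).eval x‖ ≤ b) : ‖restrictPoly ι K h‖ ≤ b :=
  (BoundedContinuousFunction.norm_le hb).2 fun x =>
    (pi_norm_le_iff_of_nonneg hb).2 fun i => hh x x.2 i

/-- Ascoli's theorem for the family of all `x ↦ G (x, c, w x)`, where the functions `w` form a
bounded equicontinuous family, `c` varies in a bounded set and `G` is a fixed continuous
function. -/
lemma totallyBounded_of_equicontinuous {E : Type*} {K : Set ℂ} [CompactSpace K] (A : Set E)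
    (F : E → (K →ᵇ (ι → ℂ))) (c : E → ι → ℂ) (w : E → K → ι → ℂ)
    {G : ℂ × (ι → ℂ) × (ι → ℂ) → ι → ℂ} (hG : Continuous G)
    (hF : ∀ h ∈ A, ∀ x : K, F h x = G ((x : ℂ), c h, w h x)) {R : ℝ}
    (hc : ∀ h ∈ A, ‖c h‖ ≤ R) (hw : ∀ h ∈ A, ∀ x, ‖w h x‖ ≤ R)
    (heq : ∀ x : K, ∀ ε > 0, ∃ δ > 0, ∀ y : K, dist y x < δ → ∀ h ∈ A, dist (w h y) (w h x) ≤ ε) :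
    TotallyBounded (F '' A) := by
  have hKc : IsCompact K := isCompact_iff_compactSpace.2 inferInstance
  set Z : Set (ℂ × (ι → ℂ) × (ι → ℂ)) := K ×ˢ (closedBall 0 R ×ˢ closedBall 0 R) with hZ
  have hZc : IsCompact Z :=
    hKc.prod ((isCompact_closedBall _ _).prod (isCompact_closedBall _ _))
  have hmem : ∀ h ∈ A, ∀ x : K, ((x : ℂ), c h, w h x) ∈ Z := fun h hh x =>
    ⟨x.2, mem_closedBall_zero_iff.2 (hc h hh), mem_closedBall_zero_iff.2 (hw h hh x)⟩
  refine (BoundedContinuousFunction.arzela_ascoli (G '' Z) (hZc.image hG) (F '' A) ?_ ?_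
    ).totallyBounded.subset subset_closure
  · rintro _ x ⟨h, hh, rfl⟩
    rw [hF h hh]
    exact ⟨_, hmem h hh x, rfl⟩
  · intro x
    rw [Metric.equicontinuousAt_iff]
    intro ε hε
    obtain ⟨η, hη, hGη⟩ := Metric.uniformContinuousOn_iff.1
      (hZc.uniformContinuousOn_of_continuous hG.continuousOn) ε hε
    obtain ⟨δ, hδ, hδw⟩ := heq x (η / 2) (by positivity)
    refine ⟨min δ η, lt_min hδ hη, fun y hy => ?_⟩
    rintro ⟨_, h, hh, rfl⟩
    change dist (F h x) (F h y) < ε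
    rw [hF h hh, hF h hh]
    refine hGη _ (hmem h hh x) _ (hmem h hh y) ?_
    rw [Prod.dist_eq, Prod.dist_eq, dist_self, max_lt_iff, max_lt_iff]
    refine ⟨?_, hη, ?_⟩
    · rw [dist_comm]
      exact hy.trans_le (min_le_right _ _)
    · rw [dist_comm]
      exact lt_of_le_of_lt (hδw y (hy.trans_le (min_le_left _ _)) h hh) (by linarith)

/-- The a priori estimate. Put `h = Q y' + ψ + y(p 0) x ^ (S + 1)`, a parametrization of the pairs
`(y, ψ)` by arbitrary polynomials. Then `Q (y' + ∑ j, (x - p j)⁻¹ B j y) + ψ = h - T h`, where `T`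
involves only the primitive of `y'` and hence is compact for the norm of uniform convergence on
`K`, and `1 - T` is onto by `exists_polyOp_add_eq`. -/
theorem exists_estimate {S : ℕ} {p : Fin (S + 2) → ℂ} (hp : Function.Injective p)
    (B : Fin (S + 2) → Matrix ι ι ℂ)
    (hB : ∀ (k : ℕ) (v : ι → ℂ), (k : ℂ) • v + (∑ j, B j).mulVec v = 0 → v = 0)
    {K : Set ℂ} (hK : ControlsPrimitives (p 0) K) (hpK : ∀ j, ∃ r > 0, closedBall (p j) r ⊆ K) :
    ∃ C : ℝ, ∀ y ψ : ι → Polynomial ℂ, (∀ i, (ψ i).natDegree ≤ S) → ∀ b : ℝ,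
      (∀ x ∈ K, ∀ i, ‖((polyOp p B y + ψ) i).eval x‖ ≤ b) →
      (∀ x ∈ K, ∀ i, ‖(y i).eval x‖ ≤ C * b) ∧ ∀ i k, ‖(ψ i).coeff k‖ ≤ C * b := by
  classical
  have : CompactSpace K := isCompact_iff_compactSpace.1 hK.isCompact
  have hQ : (nodal Finset.univ p).Monic := Lagrange.nodal_monic
  have hQdeg : (nodal Finset.univ p).degree = ((S + 2 : ℕ) : WithBot ℕ) := by
    rw [Lagrange.degree_nodal]; simp
  obtain ⟨I, hI, hI0⟩ := exists_primitive (p 0)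
  obtain ⟨C₁, hC₁, h₁⟩ := exists_bound_coeff_modByMonic hp
  obtain ⟨C₂, hC₂, h₂⟩ := exists_bound_divByMonic hp hK.isCompact hpK
  obtain ⟨M, hM⟩ := hK.bound
  -- the value at `p 0` and the derivative of the function `y` encoded by `h`
  let c : (ι → Polynomial ℂ) →ₗ[ℂ] (ι → ℂ) :=
    LinearMap.pi fun i => (Polynomial.lcoeff ℂ (S + 1)).comp
      ((Polynomial.modByMonicHom (nodal Finset.univ p)).comp (LinearMap.proj i))
  let g : (ι → Polynomial ℂ) →ₗ[ℂ] (ι → Polynomial ℂ) :=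
    LinearMap.pi fun i => (divByMonicHom _ hQ).comp (LinearMap.proj i)
  have hc_apply : ∀ h i, c h i = (h i %ₘ nodal Finset.univ p).coeff (S + 1) := fun h i => rfl
  have hg_apply : ∀ h i, g h i = h i /ₘ nodal Finset.univ p := fun h i => rfl
  let Y : (ι → Polynomial ℂ) →ₗ[ℂ] (ι → Polynomial ℂ) :=
    LinearMap.pi fun i => (Polynomial.monomial 0).comp ((LinearMap.proj i).comp c) +
      I.comp ((LinearMap.proj i).comp g)
  have hY_apply : ∀ h i, Y h i = Polynomial.C (c h i) + I (g h i) := fun h i => rfl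
  let T : (ι → Polynomial ℂ) →ₗ[ℂ] (ι → Polynomial ℂ) :=
    LinearMap.pi (fun i => (Polynomial.monomial (S + 1)).comp ((LinearMap.proj i).comp c)) -
      (polyMatrix p B).comp Y
  have hT_apply : ∀ h i, T h i = Polynomial.monomial (S + 1) (c h i) - polyMatrix p B (Y h) i :=
    fun h i => rfl
  have hparam : ∀ y ψ : ι → Polynomial ℂ, (∀ i, (ψ i).natDegree ≤ S) →
      ∀ h, (h = fun i => nodal Finset.univ p * derivative (y i) +
        (ψ i + Polynomial.monomial (S + 1) ((y i).eval (p 0)))) →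
      (∀ i, h i %ₘ nodal Finset.univ p = ψ i + Polynomial.monomial (S + 1) ((y i).eval (p 0))) ∧
      Y h = y ∧ h - T h = polyOp p B y + ψ := by
    intro y ψ hψ h hh
    have hdiv : ∀ i, h i /ₘ nodal Finset.univ p = derivative (y i) ∧
        h i %ₘ nodal Finset.univ p = ψ i + Polynomial.monomial (S + 1) ((y i).eval (p 0)) := by
      intro i
      refine Polynomial.div_modByMonic_unique _ _ hQ ⟨by rw [hh]; ring, ?_⟩
      rw [hQdeg, Polynomial.degree_lt_iff_coeff_zero]
      intro m hm
      rw [Polynomial.coeff_add, Polynomial.coeff_monomial,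
        Polynomial.coeff_eq_zero_of_natDegree_lt (by have := hψ i; omega), if_neg (by omega),
        add_zero]
    have hci : ∀ i, c h i = (y i).eval (p 0) := by
      intro i
      rw [hc_apply, (hdiv i).2, Polynomial.coeff_add, Polynomial.coeff_monomial,
        Polynomial.coeff_eq_zero_of_natDegree_lt (by have := hψ i; omega), if_pos rfl, zero_add]
    have hYy : Y h = y := by
      ext1 i
      rw [hY_apply, hg_apply, (hdiv i).1]
      refine eq_of_derivative_eq (a := p 0) ?_ ?_
      · rw [map_add, Polynomial.derivative_C, zero_add, hI]
      · rw [Polynomial.eval_add, Polynomial.eval_C, hI0, add_zero, hci]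
    refine ⟨fun i => (hdiv i).2, hYy, ?_⟩
    ext1 i
    rw [Pi.sub_apply, hT_apply, hYy, hci, Pi.add_apply, polyOp_apply, hh]
    ring
  have hsurj : Function.Surjective fun h => h - T h := by
    intro R
    obtain ⟨y, ψ, hψ, hy⟩ := exists_polyOp_add_eq p B hB R
    exact ⟨_, ((hparam y ψ hψ _ rfl).2.2).trans hy⟩
  have hpjK : ∀ j, p j ∈ K := fun j => by
    obtain ⟨r, hr, hrK⟩ := hpK j
    exact hrK (mem_closedBall_self hr.le)
  have hcb : ∀ h (b : ℝ), (∀ x ∈ K, ∀ i, ‖(h i).eval x‖ ≤ b) → ∀ i, ‖c h i‖ ≤ C₁ * b :=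
    fun h b hb i => h₁ (h i) b (fun j => hb _ (hpjK j) i) (S + 1) (by omega)
  have hgb : ∀ h (b : ℝ), (∀ x ∈ K, ∀ i, ‖(h i).eval x‖ ≤ b) →
      ∀ x ∈ K, ∀ i, ‖(g h i).eval x‖ ≤ C₂ * b :=
    fun h b hb x hx i => h₂ (h i) b (fun x hx => hb x hx i) x hx
  have hIb : ∀ h (b : ℝ), (∀ x ∈ K, ∀ i, ‖(h i).eval x‖ ≤ b) →
      ∀ x ∈ K, ∀ i, ‖(I (g h i)).eval x‖ ≤ M * (C₂ * b) := by
    intro h b hb x hx i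
    have := hM (I (g h i)) (C₂ * b) (fun z hz => by rw [hI]; exact hgb h b hb z hz i) x hx
    rwa [hI0, sub_zero] at this
  have hTB : TotallyBounded
      ((fun h => restrictPoly ι K (T h)) '' {h | ‖restrictPoly ι K h‖ ≤ 1}) := by
    have hb1 : ∀ h ∈ {h : ι → Polynomial ℂ | ‖restrictPoly ι K h‖ ≤ 1}, ∀ x ∈ K, ∀ i,
        ‖(h i).eval x‖ ≤ 1 :=
      fun h hh x hx i => (norm_eval_le_norm_restrictPoly h hx i).trans hh
    refine totallyBounded_of_equicontinuous {h : ι → Polynomial ℂ | ‖restrictPoly ι K h‖ ≤ 1}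
      (fun h => restrictPoly ι K (T h)) c (fun h x i => (I (g h i)).eval (x : ℂ))
      (G := fun q i => q.1 ^ (S + 1) * q.2.1 i - ∑ j, (nodal (Finset.univ.erase j) p).eval q.1 *
        ∑ k, B j i k * (q.2.1 k + q.2.2 k)) ?_ ?_ (R := |C₁ * 1| + |M * (C₂ * 1)|) ?_ ?_ ?_
    · fun_prop
    · intro h _ x
      ext i
      rw [restrictPoly_apply, hT_apply, polyMatrix_apply]
      simp only [Polynomial.eval_sub, Polynomial.eval_monomial, Polynomial.eval_finsetSum,
        Polynomial.eval_mul, Polynomial.eval_C, hY_apply, Polynomial.eval_add]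
      rw [mul_comm]
    · intro h hh
      refine (pi_norm_le_iff_of_nonneg (by positivity)).2 fun i => ?_
      exact (hcb h 1 (hb1 h hh) i).trans
        ((le_abs_self _).trans (le_add_of_nonneg_right (abs_nonneg _)))
    · intro h hh x
      refine (pi_norm_le_iff_of_nonneg (by positivity)).2 fun i => ?_
      exact (hIb h 1 (hb1 h hh) x x.2 i).trans
        ((le_abs_self _).trans (le_add_of_nonneg_left (abs_nonneg _)))
    · intro x ε hε
      have hC2' : 0 < C₂ + 1 := by positivity
      obtain ⟨δ, hδ, hδK⟩ := hK.equicont x x.2 (ε / (C₂ + 1)) (by positivity)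
      refine ⟨δ, hδ, fun y hy h hh => ?_⟩
      refine (dist_pi_le_iff hε.le).2 fun i => ?_
      have := hδK y y.2 hy (Polynomial.C ((C₂ + 1 : ℝ) : ℂ)⁻¹ * I (g h i)) (fun z hz => by
        rw [Polynomial.derivative_C_mul, hI, Polynomial.eval_mul, Polynomial.eval_C, norm_mul,
          norm_inv, Complex.norm_real, Real.norm_of_nonneg hC2'.le, inv_mul_le_iff₀ hC2', mul_one]
        have := hgb h 1 (hb1 h hh) z hz i
        linarith)
      rw [Polynomial.eval_mul, Polynomial.eval_mul, Polynomial.eval_C, Polynomial.eval_C,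
        ← mul_sub, norm_mul, norm_inv, Complex.norm_real, Real.norm_of_nonneg hC2'.le,
        inv_mul_le_iff₀ hC2', mul_div_cancel₀ _ hC2'.ne'] at this
      rwa [dist_eq_norm]
  obtain ⟨C₃, hC₃⟩ := exists_bound_of_totallyBounded (restrictPoly ι K) T hTB hsurj
  refine ⟨(C₁ + |M * C₂|) * |C₃|, fun y ψ hψ b hb => ?_⟩
  set h : ι → Polynomial ℂ := fun i => nodal Finset.univ p * derivative (y i) +
        (ψ i + Polynomial.monomial (S + 1) ((y i).eval (p 0))) with hh
  obtain ⟨hrem, hYh, hTh⟩ := hparam y ψ hψ h hh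
  have hhb : ∀ x ∈ K, ∀ i, ‖(h i).eval x‖ ≤ |C₃| * b := by
    intro x hx i
    have hb0 : 0 ≤ b := (norm_nonneg _).trans (hb x hx i)
    refine (norm_eval_le_norm_restrictPoly h hx i).trans ((hC₃ h).trans ?_)
    rw [hTh]
    refine (mul_le_mul_of_nonneg_right (le_abs_self _) (norm_nonneg _)).trans ?_
    exact mul_le_mul_of_nonneg_left (norm_restrictPoly_le hb0 hb) (abs_nonneg _)
  have hb0 : ∀ _ : ι, 0 ≤ b := fun i => (norm_nonneg _).trans (hb (p 0) hK.mem i)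
  refine ⟨fun x hx i => ?_, fun i k => ?_⟩
  · rw [← hYh, hY_apply, Polynomial.eval_add, Polynomial.eval_C]
    refine (norm_add_le _ _).trans ((add_le_add (hcb h _ hhb i) (hIb h _ hhb x hx i)).trans ?_)
    have h3 : M * C₂ * (|C₃| * b) ≤ |M * C₂| * (|C₃| * b) :=
      mul_le_mul_of_nonneg_right (le_abs_self _) (mul_nonneg (abs_nonneg _) (hb0 i))
    linarith
  · have hnn : 0 ≤ |M * C₂| * (|C₃| * b) :=
      mul_nonneg (abs_nonneg _) (mul_nonneg (abs_nonneg _) (hb0 i))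
    have hnn' : 0 ≤ C₁ * (|C₃| * b) := mul_nonneg hC₁ (mul_nonneg (abs_nonneg _) (hb0 i))
    by_cases hk : k ≤ S
    · have h4 := h₁ (h i) (|C₃| * b) (fun j => hhb _ (hpjK j) i) k (by omega)
      rw [hrem i, Polynomial.coeff_add, Polynomial.coeff_monomial, if_neg (by omega),
        add_zero] at h4
      linarith
    · rw [Polynomial.coeff_eq_zero_of_natDegree_lt (by have := hψ i; omega), norm_zero]
      linarith

end Estimate

/-! ### Compact sets that control primitives -/

section Discs

open Polynomial (derivative)
open Metric Set Filter Topology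

lemma norm_eval_sub_le_of_mem_closedBall {c : ℂ} {r b : ℝ} (q : Polynomial ℂ)
    (hq : ∀ x ∈ closedBall c r, ‖(derivative q).eval x‖ ≤ b) {x y : ℂ} (hx : x ∈ closedBall c r)
    (hy : y ∈ closedBall c r) : ‖q.eval y - q.eval x‖ ≤ b * ‖y - x‖ := by
  refine (convex_closedBall c r).norm_image_sub_le_of_norm_deriv_le (f := fun z => q.eval z)
    (fun z _ => q.differentiable z) (fun z hz => ?_) hx hy
  rw [Polynomial.deriv]
  exact hq z hz

/-- Finite unions of closed discs centred on a compact connected set control primitives: any two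
points are joined by a chain of discs, and equicontinuity holds inside each disc. -/
theorem exists_controlsPrimitives {D : Set ℂ} (hDo : IsOpen D) (hD : IsPathConnected D) {a : ℂ}
    (ha : a ∈ D) {F : Set ℂ} (hF : F.Finite) (hFD : F ⊆ D) :
    ∃ K ⊆ D, ControlsPrimitives a K ∧ ∀ x ∈ F, ∃ r > 0, closedBall x r ⊆ K := by
  have hpath : ∀ x, ∃ γ : Path a x, x ∈ F → ∀ t, γ t ∈ D := by
    intro x
    by_cases hx : x ∈ F
    · have h := hD.joinedIn a ha x (hFD hx)
      exact ⟨h.somePath, fun _ => h.somePath_mem⟩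
    · exact ⟨PathConnectedSpace.somePath a x, fun h => absurd h hx⟩
  choose γ hγ using hpath
  set Γ : Set ℂ := {a} ∪ ⋃ x ∈ F, range (γ x) with hΓ
  have hΓc : IsCompact Γ :=
    isCompact_singleton.union (hF.isCompact_biUnion fun x _ => isCompact_range (γ x).continuous)
  have haΓ : a ∈ Γ := Or.inl rfl
  have hΓD : Γ ⊆ D := by
    rintro z (rfl | hz)
    · exact ha
    · obtain ⟨x, hx, t, rfl⟩ := mem_iUnion₂.1 hz
      exact hγ x hx t
  have hΓp : IsPreconnected Γ := by
    refine isPreconnected_of_forall a fun z hz => ?_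
    rcases hz with rfl | hz
    · exact ⟨{z}, fun w hw => Or.inl hw, rfl, rfl, isPreconnected_singleton⟩
    · obtain ⟨x, hx, hz⟩ := mem_iUnion₂.1 hz
      exact ⟨range (γ x), fun w hw => Or.inr (mem_iUnion₂.2 ⟨x, hx, hw⟩), ⟨0, (γ x).source⟩, hz,
        isPreconnected_range (γ x).continuous⟩
  have hFΓ : F ⊆ Γ := fun x hx => Or.inr (mem_iUnion₂.2 ⟨x, hx, 1, (γ x).target⟩)
  obtain ⟨δ, hδ, hδD⟩ := hΓc.exists_cthickening_subset_open hDo hΓD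
  obtain ⟨t, htΓ, htf, htc⟩ := hΓc.finite_cover_balls hδ
  set K : Set ℂ := ⋃ c ∈ t, closedBall c δ with hKdef
  have hcK : ∀ c ∈ t, closedBall c δ ⊆ K := fun c hc =>
    subset_biUnion_of_mem (u := fun c => closedBall c δ) hc
  have hball : ∀ x ∈ Γ, ∃ c ∈ t, x ∈ ball c δ := fun x hx => by
    simpa using htc hx
  refine ⟨K, ?_, ⟨?_, ?_, ?_, ?_⟩, ?_⟩
  · refine iUnion₂_subset fun c hc => (closedBall_subset_cthickening (htΓ hc) δ).trans hδD
  · exact htf.isCompact_biUnion fun c _ => isCompact_closedBall c δ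
  · obtain ⟨c, hc, hac⟩ := hball a haΓ
    exact hcK c hc (ball_subset_closedBall hac)
  · have hstep : ∀ x ∈ Γ, ∃ M : ℝ, ∀ (q : Polynomial ℂ) (b : ℝ),
        (∀ x ∈ K, ‖(derivative q).eval x‖ ≤ b) → ‖q.eval x - q.eval a‖ ≤ M * b := by
      intro x hx
      refine hΓp.induction₂ (fun x y => ∃ M : ℝ, ∀ (q : Polynomial ℂ) (b : ℝ),
        (∀ x ∈ K, ‖(derivative q).eval x‖ ≤ b) → ‖q.eval y - q.eval x‖ ≤ M * b) ?_ ?_ ?_ haΓ hx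
      · intro z hz
        obtain ⟨c, hc, hzc⟩ := hball z hz
        filter_upwards [mem_nhdsWithin_of_mem_nhds (isOpen_ball.mem_nhds hzc)] with y hy
        refine ⟨‖y - z‖, fun q b hq => ?_⟩
        rw [mul_comm]
        exact norm_eval_sub_le_of_mem_closedBall q (fun w hw => hq w (hcK c hc hw))
          (ball_subset_closedBall hzc) (ball_subset_closedBall hy)
      · rintro x y z - - - ⟨M₁, h₁⟩ ⟨M₂, h₂⟩
        refine ⟨M₂ + M₁, fun q b hq => ?_⟩
        rw [add_mul, ← sub_add_sub_cancel (q.eval z) (q.eval y) (q.eval x)]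
        exact (norm_add_le _ _).trans (add_le_add (h₂ q b hq) (h₁ q b hq))
      · rintro x y - - ⟨M, h⟩
        exact ⟨M, fun q b hq => by rw [norm_sub_rev]; exact h q b hq⟩
    choose! M hM using hstep
    refine ⟨δ + ∑ c ∈ htf.toFinset, |M c|, fun q b hq x hx => ?_⟩
    obtain ⟨c, hc, hxc⟩ := mem_iUnion₂.1 hx
    have hb : 0 ≤ b := (norm_nonneg _).trans (hq x hx)
    rw [add_mul, ← sub_add_sub_cancel (q.eval x) (q.eval c) (q.eval a)]
    refine (norm_add_le _ _).trans (add_le_add ?_ ?_)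
    · refine (norm_eval_sub_le_of_mem_closedBall q (fun w hw => hq w (hcK c hc hw))
        (mem_closedBall_self hδ.le) hxc).trans ?_
      rw [mul_comm]
      exact mul_le_mul_of_nonneg_right (mem_closedBall_iff_norm.1 hxc) hb
    · refine (hM c (htΓ hc) q b hq).trans (mul_le_mul_of_nonneg_right ?_ hb)
      exact (le_abs_self _).trans (Finset.single_le_sum (f := fun c => |M c|)
        (fun _ _ => abs_nonneg _) (htf.mem_toFinset.2 hc))
  · intro x hx ε hε
    have hcl : IsClosed (⋃ c ∈ {c ∈ t | x ∉ closedBall c δ}, closedBall c δ) :=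
      (htf.subset (sep_subset _ _)).isClosed_biUnion fun c _ => isClosed_closedBall
    have hxn : x ∈ (⋃ c ∈ {c ∈ t | x ∉ closedBall c δ}, closedBall c δ)ᶜ := by
      intro h
      obtain ⟨c, hc, hxc⟩ := mem_iUnion₂.1 h
      exact hc.2 hxc
    obtain ⟨η, hη, hηK⟩ := Metric.isOpen_iff.1 hcl.isOpen_compl x hxn
    refine ⟨min η ε, lt_min hη hε, fun y hy hyx q hq => ?_⟩
    obtain ⟨c, hc, hyc⟩ := mem_iUnion₂.1 hy
    have hxc : x ∈ closedBall c δ := by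
      by_contra hxc
      exact hηK (hyx.trans_le (min_le_left _ _)) (mem_iUnion₂.2 ⟨c, ⟨hc, hxc⟩, hyc⟩)
    refine (norm_eval_sub_le_of_mem_closedBall q (fun w hw => hq w (hcK c hc hw)) hxc hyc).trans ?_
    rw [one_mul, ← dist_eq_norm]
    exact (hyx.trans_le (min_le_right _ _)).le
  · intro x hx
    obtain ⟨c, hc, hxc⟩ := hball x (hFΓ hx)
    refine ⟨δ - dist x c, sub_pos.2 hxc, (closedBall_subset_closedBall' ?_).trans (hcK c hc)⟩
    linarith

end Discs

/-! ### The complement of a simply connected domain -/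

section Complement

open Metric Set Filter Topology

/-- There is no continuous logarithm of `x - a` on a circle about `a`. -/
lemma not_exp_eq_sub_on_sphere {a : ℂ} {R : ℝ} (hR : 0 < R) {ℓ : ℂ → ℂ} (hℓ : Continuous ℓ)
    (h : ∀ x ∈ sphere a R, Complex.exp (ℓ x) = x - a) : False := by
  set φ : ℝ → ℝ := fun θ => (ℓ (circleMap a R θ)).im - θ with hφ
  have hφc : Continuous φ :=
    (Complex.continuous_im.comp (hℓ.comp (continuous_circleMap a R))).sub continuous_id
  have hcos : ∀ θ, Real.cos (φ θ) = 1 := by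
    intro θ
    have h1 := h _ (circleMap_mem_sphere a hR.le θ)
    rw [circleMap_sub_center, circleMap_zero] at h1
    have h2 : Complex.exp (ℓ (circleMap a R θ) - θ * Complex.I) = R := by
      rw [Complex.exp_sub, h1, mul_div_cancel_right₀ _ (Complex.exp_ne_zero _)]
    have h3 := congrArg Complex.re h2
    have h4 : ‖Complex.exp (ℓ (circleMap a R θ) - θ * Complex.I)‖ = R := by
      rw [h2, Complex.norm_real, Real.norm_of_nonneg hR.le]
    rw [Complex.norm_exp] at h4
    rw [Complex.exp_re, h4, Complex.ofReal_re] at h3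
    have h5 : (ℓ (circleMap a R θ) - θ * Complex.I).im = φ θ := by simp [hφ]
    rw [h5] at h3
    exact mul_left_cancel₀ hR.ne' (h3.trans (mul_one R).symm)
  have hend : φ (2 * Real.pi) = φ 0 - 2 * Real.pi := by
    have : circleMap a R (2 * Real.pi) = circleMap a R 0 := by
      simpa using (periodic_circleMap a R) 0
    simp [hφ, this]
  have hpi := Real.pi_pos
  obtain ⟨θ, -, hθ⟩ := intermediate_value_Icc' (a := 0) (b := 2 * Real.pi) (by positivity)
    hφc.continuousOn (show φ 0 - Real.pi ∈ Icc (φ (2 * Real.pi)) (φ 0) by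
      rw [hend]; constructor <;> linarith)
  have h1 := hcos θ
  rw [hθ, Real.cos_sub_pi, hcos 0] at h1
  norm_num at h1

/-- The complement of a simply connected domain has no compact open piece. Otherwise a logarithm of
`x - a`, for `a` in that piece, could be used to deform the function `x - a` to a nowhere vanishing
continuous function on the plane which equals `x - a` on a large circle. -/
theorem eq_empty_of_compl_eq_union {D H F : Set ℂ} (hDo : IsOpen D) (hD : IsSimplyConnected D)
    (hH : IsCompact H) (hF : IsClosed F) (hHF : Disjoint H F) (hunion : Dᶜ = H ∪ F) : H = ∅ := by
  classical
  by_contra hne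
  obtain ⟨a, haH⟩ := nonempty_iff_ne_empty.2 hne
  have hHD : ∀ x ∈ H, x ∉ D := fun x hx => by
    have : x ∈ Dᶜ := hunion ▸ Or.inl hx
    exact this
  have hFD : ∀ x ∈ F, x ∉ D := fun x hx => by
    have : x ∈ Dᶜ := hunion ▸ Or.inr hx
    exact this
  obtain ⟨R, hR, hHR⟩ : ∃ R > 0, H ⊆ ball a R := by
    obtain ⟨R, hR⟩ := hH.isBounded.subset_ball_lt 0 a
    exact ⟨R, hR.1, hR.2⟩
  have hdisj : H ⊆ (F ∪ (ball a R)ᶜ)ᶜ := by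
    intro x hx h
    rcases h with h | h
    · exact disjoint_left.1 hHF hx h
    · exact h (hHR hx)
  obtain ⟨V₂, hV₂o, hHV₂, hV₂⟩ := normal_exists_closure_subset hH.isClosed
    (hF.union isOpen_ball.isClosed_compl).isOpen_compl hdisj
  obtain ⟨V₁, hV₁o, hHV₁, hV₁⟩ := normal_exists_closure_subset hH.isClosed hV₂o hHV₂
  obtain ⟨χ, hχ0, hχ1, -⟩ := exists_continuous_zero_one_of_isClosed hV₂o.isClosed_compl
    (isClosed_closure (s := V₁)) (disjoint_left.2 fun x hx hx' => hx (hV₁ hx'))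
  obtain ⟨ℓ, hℓc, hℓ⟩ := Complex.exists_continuousOn_eqOn_exp_comp hD hDo
    (g := fun x => x - a) (by fun_prop) (by
      rintro ⟨x, hx, hxa⟩
      rw [sub_eq_zero.1 hxa] at hx
      exact hHD a haH hx)
  set G : ℂ → ℂ := fun x => if x ∈ D then Complex.exp ((1 - (χ x : ℂ)) * ℓ x) else
    if x ∈ V₁ then 1 else x - a with hG
  have hG₁ : ∀ x ∈ V₁, G x = 1 := by
    intro x hx
    by_cases hxD : x ∈ D
    · have : χ x = 1 := hχ1 (subset_closure hx)
      simp [hG, hxD, this]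
    · simp [hG, hxD, hx]
  have hG₂ : ∀ x ∉ V₂, G x = x - a := by
    intro x hx
    by_cases hxD : x ∈ D
    · have : χ x = 0 := hχ0 hx
      have h2 := hℓ hxD
      simp only [Function.comp_apply] at h2
      simp [hG, hxD, this, h2]
    · have : x ∉ V₁ := fun h => hx (hV₁ (subset_closure h))
      simp [hG, hxD, this]
  have hGc : Continuous G := by
    rw [continuous_iff_continuousAt]
    intro x
    by_cases hxD : x ∈ D
    · have h1 : ContinuousOn (fun x => Complex.exp ((1 - (χ x : ℂ)) * ℓ x)) D := by fun_prop
      refine (h1.continuousAt (hDo.mem_nhds hxD)).congr ?_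
      filter_upwards [hDo.mem_nhds hxD] with y hy
      simp [hG, hy]
    · rcases (show x ∈ H ∪ F from hunion ▸ hxD) with hx | hx
      · refine (continuousAt_const (y := (1 : ℂ))).congr ?_
        filter_upwards [hV₁o.mem_nhds (hHV₁ hx)] with y hy
        exact (hG₁ y hy).symm
      · refine (continuous_id.sub continuous_const).continuousAt.congr
          (f := fun x => x - a) ?_
        have hx2 : x ∈ (closure V₂)ᶜ := fun h => hV₂ h (Or.inl hx)
        filter_upwards [isClosed_closure.isOpen_compl.mem_nhds hx2] with y hy
        exact (hG₂ y fun h => hy (subset_closure h)).symm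
  have hG0 : ∀ x, G x ≠ 0 := by
    intro x
    by_cases hxD : x ∈ D
    · simp [hG, hxD]
    · by_cases hxV : x ∈ V₁
      · simp [hG, hxD, hxV]
      · have hxa : x ≠ a := by
          rintro rfl
          exact hxV (hHV₁ haH)
        simpa [hG, hxD, hxV, sub_eq_zero] using hxa
  obtain ⟨m, hmc, hm⟩ := Complex.exists_continuousOn_eqOn_exp_comp (U := (univ : Set ℂ))
    (by
      rw [isSimplyConnected_iff_exists_homotopy_refl_forall_mem]
      refine ⟨isPathConnected_univ, fun x p _ => ?_⟩
      obtain ⟨h⟩ := SimplyConnectedSpace.paths_homotopic p (Path.refl x)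
      exact ⟨h, fun _ => trivial⟩) isOpen_univ hGc.continuousOn (by
      rintro ⟨x, -, hx⟩
      exact hG0 x hx)
  refine not_exp_eq_sub_on_sphere hR (continuousOn_univ.1 hmc) (a := a) fun x hx => ?_
  rw [← hG₂ x fun h => (hV₂ (subset_closure h)) (Or.inr ?_)]
  · exact hm (mem_univ x)
  · rw [mem_compl_iff, mem_ball, not_lt]
    exact hx.ge

end Complement

/-! ### The Cauchy–Pompeiu formula -/

section Pompeiu

open Metric Set Filter Topology MeasureTheory

/-- The operator `2 i ∂/∂z̄`. -/
def dbar (φ : ℂ → ℂ) (ζ : ℂ) : ℂ := Complex.I * fderiv ℝ φ ζ 1 - fderiv ℝ φ ζ Complex.I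

lemma dbar_eq_zero {φ : ℂ → ℂ} {ζ : ℂ} (h : DifferentiableAt ℂ φ ζ) : dbar φ ζ = 0 := by
  rw [dbar, h.fderiv_restrictScalars ℝ]
  simp only [ContinuousLinearMap.coe_restrictScalars']
  have : fderiv ℂ φ ζ Complex.I = Complex.I * fderiv ℂ φ ζ 1 := by
    rw [← smul_eq_mul, ← map_smul, smul_eq_mul, mul_one]
  rw [this, sub_self]

lemma continuous_dbar {φ : ℂ → ℂ} (hφ : ContDiff ℝ 1 φ) : Continuous (dbar φ) := by
  have := hφ.continuous_fderiv one_ne_zero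
  unfold dbar
  fun_prop

lemma dbar_eq_zero_of_notMem_tsupport {φ : ℂ → ℂ} {ζ : ℂ} (h : ζ ∉ tsupport φ) :
    dbar φ ζ = 0 := by
  have : fderiv ℝ φ ζ = 0 := by
    by_contra hne
    exact h (support_fderiv_subset ℝ hne)
  simp [dbar, this]

lemma continuous_dbar_mul_inv {φ : ℂ → ℂ} (hφ : ContDiff ℝ 1 φ) {a : ℂ}
    (h0 : ∀ᶠ ζ in 𝓝 a, DifferentiableAt ℂ φ ζ) : Continuous fun ζ => dbar φ ζ * (ζ - a)⁻¹ := by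
  rw [continuous_iff_continuousAt]
  intro ζ
  by_cases hζ : ζ = a
  · subst hζ
    refine (continuousAt_const (y := (0 : ℂ))).congr ?_
    filter_upwards [h0] with z hz
    rw [dbar_eq_zero hz, zero_mul]
  · exact (continuous_dbar hφ).continuousAt.mul
      ((continuous_id.sub continuous_const).continuousAt.inv₀ (sub_ne_zero.2 hζ))

/-- The contribution of a pair of opposite sides of a square to the integral of the Cauchy
kernel. -/
lemma integral_inv_sub_inv {N : ℝ} (hN : 0 < N) :
    (∫ t : ℝ in (-N)..N, ((t : ℂ) - N * Complex.I)⁻¹ - ((t : ℂ) + N * Complex.I)⁻¹) =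
      Real.pi * Complex.I := by
  have h1 : ∀ t : ℝ, ((t : ℂ) - N * Complex.I)⁻¹ - ((t : ℂ) + N * Complex.I)⁻¹ =
      (2 * Complex.I * N⁻¹) * (((1 + (t / N) ^ 2)⁻¹ : ℝ) : ℂ) := by
    intro t
    have hN' : (N : ℂ) ≠ 0 := by exact_mod_cast hN.ne'
    have e1 : ((t : ℂ) - N * Complex.I) ≠ 0 := by
      intro h; have := congrArg Complex.im h; simp at this; exact hN.ne' this
    have e2 : ((t : ℂ) + N * Complex.I) ≠ 0 := by
      intro h; have := congrArg Complex.im h; simp at this; exact hN.ne' this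
    have e3 : (1 + ((t : ℂ) / N) ^ 2) ≠ 0 := by
      have : (1 + (t / N) ^ 2 : ℝ) ≠ 0 := by positivity
      exact_mod_cast this
    push_cast
    have e4 : (N : ℂ) ^ 2 + t ^ 2 ≠ 0 := by
      have : (N ^ 2 + t ^ 2 : ℝ) ≠ 0 := by positivity
      exact_mod_cast this
    have e5 : ((t : ℂ) - N * Complex.I) * ((t : ℂ) + N * Complex.I) = N ^ 2 + t ^ 2 := by
      linear_combination -(N : ℂ) ^ 2 * Complex.I_sq
    have e6 : (1 + ((t : ℂ) / N) ^ 2) = (N ^ 2 + t ^ 2) / N ^ 2 := by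
      field_simp
    rw [inv_sub_inv e1 e2, e5, e6]
    field_simp
    ring
  simp_rw [h1]
  rw [intervalIntegral.integral_const_mul, intervalIntegral.integral_ofReal,
    intervalIntegral.integral_comp_div (fun x : ℝ => (1 + x ^ 2)⁻¹) hN.ne', integral_inv_one_add_sq,
    neg_div, div_self hN.ne', Real.arctan_neg, Real.arctan_one]
  have hN' : (N : ℂ) ≠ 0 := by exact_mod_cast hN.ne'
  push_cast
  rw [smul_eq_mul]
  push_cast
  field_simp
  ring

/-- The Cauchy–Pompeiu formula at the origin: Green's formula on a large square for the difference
quotient of `φ`. -/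
lemma integral_dbar_mul_inv_zero {φ : ℂ → ℂ} (hφ : ContDiff ℝ 1 φ) (hc : HasCompactSupport φ)
    (h0 : ∀ᶠ ζ in 𝓝 0, DifferentiableAt ℂ φ ζ) :
    ∫ ζ, dbar φ ζ * ζ⁻¹ = -(2 * Real.pi * Complex.I) * φ 0 := by
  obtain ⟨N, hN, hNs⟩ : ∃ N : ℝ, 0 < N ∧ tsupport φ ⊆ ball 0 N := by
    obtain ⟨N, hN⟩ := hc.isCompact.isBounded.subset_ball_lt 0 0
    exact ⟨N, hN.1, hN.2⟩
  have hφ0 : ∀ ζ : ℂ, N ≤ ‖ζ‖ → φ ζ = 0 := fun ζ hζ => by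
    by_contra h
    have := hNs (subset_tsupport φ h)
    rw [mem_ball_zero_iff] at this
    linarith
  set h : ℂ → ℂ := fun ζ => dbar φ ζ * ζ⁻¹ with hh
  have hhc : Continuous h := by
    have := continuous_dbar_mul_inv hφ h0
    simpa using this
  have hh0 : ∀ ζ : ℂ, N ≤ ‖ζ‖ → h ζ = 0 := fun ζ hζ => by
    have : ζ ∉ tsupport φ := fun h => by
      have := hNs h
      rw [mem_ball_zero_iff] at this
      linarith
    simp [hh, dbar_eq_zero_of_notMem_tsupport this]
  have hhs : HasCompactSupport h := HasCompactSupport.of_support_subset_isCompact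
    (isCompact_closedBall 0 N) fun ζ hζ => by
      rw [mem_closedBall_zero_iff]
      by_contra hlt
      exact hζ (hh0 ζ (not_le.1 hlt).le)
  -- the integral over the plane as an iterated integral
  have hplane : ∫ ζ, h ζ = ∫ s : ℝ in (-N)..N, ∫ t : ℝ in (-N)..N, h (s + t * Complex.I) := by
    have e1 := Complex.volume_preserving_equiv_real_prod.symm.integral_comp'
      (g := h) (f := Complex.measurableEquivRealProd.symm)
    have hint : Integrable (fun q : ℝ × ℝ => h (q.1 + q.2 * Complex.I)) := by
      have := (Complex.volume_preserving_equiv_real_prod.symm).integrable_comp_of_integrable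
        (hhc.integrable_of_hasCompactSupport hhs)
      refine this.congr (Eventually.of_forall fun q => ?_)
      exact congrArg h (Complex.mk_eq_add_mul_I q.1 q.2)
    rw [← e1]
    have e2 : (∫ q : ℝ × ℝ, h (Complex.measurableEquivRealProd.symm q)) =
        ∫ q : ℝ × ℝ, h (q.1 + q.2 * Complex.I) := by
      refine integral_congr_ae (Eventually.of_forall fun q => ?_)
      exact congrArg h (Complex.mk_eq_add_mul_I q.1 q.2)
    rw [e2, Measure.volume_eq_prod, integral_prod _ hint]
    have e3 : ∀ s : ℝ, ∫ t : ℝ, h (s + t * Complex.I) =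
        ∫ t : ℝ in (-N)..N, h (s + t * Complex.I) := by
      intro s
      rw [intervalIntegral.integral_eq_integral_of_support_subset]
      intro t ht
      by_contra hcon
      refine ht (hh0 _ ?_)
      have h1 : |((s : ℂ) + t * Complex.I).im| ≤ _ := Complex.abs_im_le_norm _
      refine le_trans ?_ h1
      simp only [Complex.add_im, Complex.ofReal_im, Complex.mul_im, Complex.ofReal_re,
        Complex.I_im, Complex.I_re, mul_one, mul_zero, zero_add, add_zero]
      by_contra hlt
      rw [not_le, abs_lt] at hlt
      exact hcon ⟨hlt.1, hlt.2.le⟩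
    simp_rw [e3]
    rw [intervalIntegral.integral_eq_integral_of_support_subset]
    intro s hs
    by_contra hcon
    refine hs ?_
    have : ∀ t : ℝ, h (s + t * Complex.I) = 0 := by
      intro t
      refine hh0 _ ?_
      have h1 : |((s : ℂ) + t * Complex.I).re| ≤ _ := Complex.abs_re_le_norm _
      refine le_trans ?_ h1
      simp only [Complex.add_re, Complex.ofReal_im, Complex.mul_re, Complex.ofReal_re,
        Complex.I_im, Complex.I_re, mul_one, mul_zero, add_zero, sub_self]
      by_contra hlt
      rw [not_le, abs_lt] at hlt
      exact hcon ⟨hlt.1, hlt.2.le⟩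
    simp [this]
  -- Green's formula
  let g : ℂ → ℂ := dslope φ 0
  have hg : ∀ ζ ≠ 0, g ζ = (φ ζ - φ 0) * ζ⁻¹ := fun ζ hζ => by
    change dslope φ 0 ζ = _
    rw [dslope_of_ne _ hζ, slope_def_field, sub_zero, div_eq_mul_inv]
  let g' : ℂ → ℂ →L[ℝ] ℂ := fun ζ => ζ⁻¹ • fderiv ℝ φ ζ -
    ((φ ζ - φ 0) * (ζ ^ 2)⁻¹) • ContinuousLinearMap.id ℝ ℂ
  have hg'h : ∀ ζ, Complex.I • g' ζ 1 - g' ζ Complex.I = h ζ := by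
    intro ζ
    simp only [g', hh, dbar, sub_apply, smul_apply,
      ContinuousLinearMap.id_apply, smul_eq_mul]
    ring
  have hgd : ∀ ζ ≠ 0, HasFDerivAt g (g' ζ) ζ := by
    intro ζ hζ
    have d1 : HasFDerivAt φ (fderiv ℝ φ ζ) ζ := (hφ.differentiable one_ne_zero ζ).hasFDerivAt
    have d2 : HasFDerivAt (fun z : ℂ => z⁻¹)
        (((-(ζ ^ 2)⁻¹) : ℂ) • ContinuousLinearMap.id ℝ ℂ) ζ := by
      have := ((hasDerivAt_inv hζ).hasFDerivAt).restrictScalars ℝ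
      refine this.congr_fderiv ?_
      ext z
      simp [mul_comm]
    have d3 := (d1.sub_const (φ 0)).mul d2
    refine (d3.congr_of_eventuallyEq ?_).congr_fderiv ?_
    · filter_upwards [isOpen_ne.mem_nhds hζ] with z hz
      exact hg z hz
    · refine ContinuousLinearMap.ext fun v => ?_
      simp only [g', sub_apply, smul_apply,
        ContinuousLinearMap.id_apply, smul_eq_mul, add_apply]
      ring
  have hgc : Continuous g := by
    rw [continuous_iff_continuousAt]
    intro ζ
    by_cases hζ : ζ = 0
    · rw [hζ]
      exact continuousAt_dslope_same.2 h0.self_of_nhds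
    · exact (hgd ζ hζ).continuousAt
  have hgreen := Complex.integral_boundary_rect_of_hasFDerivAt_real_off_countable g g'
    ⟨-N, -N⟩ ⟨N, N⟩ {0} (countable_singleton 0) hgc.continuousOn
    (fun ζ hζ => hgd ζ hζ.2) (by
      simp_rw [hg'h]
      exact (hhc.integrable_of_hasCompactSupport hhs).integrableOn)
  simp_rw [hg'h] at hgreen
  rw [hplane, ← hgreen]
  have hbd : ∀ ζ : ℂ, N ≤ ‖ζ‖ → g ζ = -φ 0 * ζ⁻¹ := fun ζ hζ => by
    have : ζ ≠ 0 := fun h => by rw [h, norm_zero] at hζ; linarith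
    rw [hg ζ this, hφ0 ζ hζ, zero_sub]
  have hc1 : ∀ t : ℝ, g (t + ((-N : ℝ) : ℂ) * Complex.I) = -φ 0 * ((t : ℂ) - N * Complex.I)⁻¹ := by
    intro t
    rw [hbd _ ((le_abs_self N).trans (by
      simpa using Complex.abs_im_le_norm (t + ((-N : ℝ) : ℂ) * Complex.I)))]
    congr 2
    push_cast
    ring
  have hc2 : ∀ t : ℝ, g (t + (N : ℂ) * Complex.I) = -φ 0 * ((t : ℂ) + N * Complex.I)⁻¹ := by
    intro t
    rw [hbd _ ((le_abs_self N).trans (by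
      simpa using Complex.abs_im_le_norm (t + (N : ℂ) * Complex.I)))]
  have hI : Complex.I ≠ 0 := Complex.I_ne_zero
  have hc3 : ∀ t : ℝ, g ((N : ℂ) + t * Complex.I) =
      Complex.I⁻¹ * (-φ 0 * ((t : ℂ) - N * Complex.I)⁻¹) := by
    intro t
    rw [hbd _ ((le_abs_self N).trans (by
      simpa using Complex.abs_re_le_norm ((N : ℂ) + t * Complex.I)))]
    have : (N : ℂ) + t * Complex.I = Complex.I * (t - N * Complex.I) := by
      linear_combination (N : ℂ) * Complex.I_sq
    rw [this, mul_inv]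
    ring
  have hc4 : ∀ t : ℝ, g (((-N : ℝ) : ℂ) + t * Complex.I) =
      Complex.I⁻¹ * (-φ 0 * ((t : ℂ) + N * Complex.I)⁻¹) := by
    intro t
    rw [hbd _ ((le_abs_self N).trans (by
      simpa using Complex.abs_re_le_norm (((-N : ℝ) : ℂ) + t * Complex.I)))]
    have : ((-N : ℝ) : ℂ) + t * Complex.I = Complex.I * (t + N * Complex.I) := by
      push_cast
      linear_combination -(N : ℂ) * Complex.I_sq
    rw [this, mul_inv]
    ring
  have hi1 : IntervalIntegrable (fun t : ℝ => ((t : ℂ) - N * Complex.I)⁻¹) volume (-N) N := by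
    refine Continuous.intervalIntegrable (Continuous.inv₀ (by fun_prop) fun t h => ?_) _ _
    have := congrArg Complex.im h
    simp at this
    exact hN.ne' this
  have hi2 : IntervalIntegrable (fun t : ℝ => ((t : ℂ) + N * Complex.I)⁻¹) volume (-N) N := by
    refine Continuous.intervalIntegrable (Continuous.inv₀ (by fun_prop) fun t h => ?_) _ _
    have := congrArg Complex.im h
    simp at this
    exact hN.ne' this
  have hsum := integral_inv_sub_inv hN
  rw [intervalIntegral.integral_sub hi1 hi2] at hsum
  simp only [hc1, hc2, hc3, hc4, intervalIntegral.integral_const_mul, smul_eq_mul]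
  rw [mul_inv_cancel_left₀ hI, mul_inv_cancel_left₀ hI]
  linear_combination -(2 * φ 0) * hsum

/-- The Cauchy–Pompeiu formula for compactly supported functions. -/
theorem integral_dbar_mul_inv {φ : ℂ → ℂ} (hφ : ContDiff ℝ 1 φ) (hc : HasCompactSupport φ) {a : ℂ}
    (h0 : ∀ᶠ ζ in 𝓝 a, DifferentiableAt ℂ φ ζ) :
    ∫ ζ, dbar φ ζ * (ζ - a)⁻¹ = -(2 * Real.pi * Complex.I) * φ a := by
  have h1 : Tendsto (fun ζ : ℂ => ζ + a) (𝓝 0) (𝓝 a) := by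
    have : Continuous fun ζ : ℂ => ζ + a := by fun_prop
    simpa using this.tendsto 0
  have h2 := integral_dbar_mul_inv_zero (φ := fun ζ => φ (ζ + a)) (by fun_prop)
    (hc.comp_homeomorph (Homeomorph.addRight a)) (by
      filter_upwards [h1.eventually h0] with ζ hζ
      exact hζ.comp ζ (by fun_prop))
  rw [zero_add] at h2
  rw [← h2, ← integral_add_right_eq_self (fun ζ => dbar φ ζ * (ζ - a)⁻¹) a]
  refine integral_congr_ae (Eventually.of_forall fun ζ => ?_)
  simp only [dbar, add_sub_cancel_right, fderiv_comp_add_right]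

end Pompeiu

/-! ### Runge's theorem on simply connected domains -/

section Runge

open Metric Set Filter Topology MeasureTheory

/-- The uniform closure `P(K)` of the polynomials in the continuous functions on `K`. -/
abbrev polynomialClosure (K : Set ℂ) [CompactSpace K] : Subalgebra ℂ C(K, ℂ) :=
  (polynomialFunctions K).topologicalClosure

variable {K : Set ℂ} [CompactSpace K]

instance : CompleteSpace (polynomialClosure K) :=
  (Subalgebra.isClosed_topologicalClosure _).completeSpace_coe

/-- The coordinate function as an element of `P(K)`. -/
def coordinate (K : Set ℂ) [CompactSpace K] : polynomialClosure K :=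
  ⟨Polynomial.toContinuousMapOnAlgHom K Polynomial.X,
    Subalgebra.le_topologicalClosure _ ⟨Polynomial.X, by simp, rfl⟩⟩

/-- Evaluation at a point of `K` as a character of `P(K)`. -/
def evalAt (x : K) : polynomialClosure K →ₐ[ℂ] ℂ :=
  (ContinuousMap.evalAlgHom ℂ ℂ x).comp (polynomialClosure K).val

lemma evalAt_apply (x : K) (g : polynomialClosure K) : evalAt x g = (g : C(K, ℂ)) x := rfl

lemma evalAt_coordinate (x : K) : evalAt x (coordinate K) = x := by
  simp [evalAt_apply, coordinate]

lemma evalAt_resolvent (x : K) {ζ : ℂ} (hζ : ζ ∈ resolventSet ℂ (coordinate K)) :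
    evalAt x (resolvent (coordinate K) ζ) = (ζ - x)⁻¹ := by
  have h : (algebraMap ℂ (polynomialClosure K) ζ - coordinate K) *
      resolvent (coordinate K) ζ = 1 := Ring.mul_inverse_cancel _ hζ
  have h2 := congrArg (evalAt x) h
  rw [map_mul, map_sub, AlgHom.commutes, evalAt_coordinate, map_one] at h2
  exact eq_inv_of_mul_eq_one_right h2

/-- A point of `K` is a value of the coordinate at a character of `P(K)`. -/
lemma subset_spectrum_coordinate : K ⊆ spectrum ℂ (coordinate K) := by
  intro x hx hr
  have h := (spectrum.mem_resolventSet_iff.1 hr).map (evalAt (⟨x, hx⟩ : K))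
  rw [map_sub, AlgHom.commutes, evalAt_coordinate] at h
  simp at h

/-- The boundary of the spectrum of the coordinate in `P(K)` lies in `K`, because inverses of
limits are limits of inverses as long as they exist in `C(K)`. -/
lemma mem_resolventSet_of_mem_closure {a : ℂ} (haK : a ∉ K)
    (ha : a ∈ closure (resolventSet ℂ (coordinate K))) :
    a ∈ resolventSet ℂ (coordinate K) := by
  have hc : ∀ ζ : ℂ, ((algebraMap ℂ (polynomialClosure K) ζ - coordinate K : polynomialClosure K) :
      C(K, ℂ)) = algebraMap ℂ C(K, ℂ) ζ - coordinate K := fun ζ => rfl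
  have hx : ∀ (ζ : ℂ) (x : K), (algebraMap ℂ C(K, ℂ) ζ - coordinate K : C(K, ℂ)) x = ζ - x := by
    intro ζ x
    have := evalAt_coordinate x
    rw [evalAt_apply] at this
    simp [this, Algebra.algebraMap_eq_smul_one]
  have hu : IsUnit (algebraMap ℂ C(K, ℂ) a - coordinate K : C(K, ℂ)) := by
    rw [ContinuousMap.isUnit_iff_forall_ne_zero]
    intro x
    rw [hx, sub_ne_zero]
    rintro rfl
    exact haK x.2
  obtain ⟨u, hu⟩ := hu
  have hcont : ContinuousAt
      (fun ζ : ℂ => Ring.inverse (algebraMap ℂ C(K, ℂ) ζ - coordinate K : C(K, ℂ))) a := by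
    refine ContinuousAt.comp (f := fun ζ : ℂ => (algebraMap ℂ C(K, ℂ) ζ - coordinate K : C(K, ℂ)))
      (g := Ring.inverse) ?_ ?_
    · rw [← hu]
      exact NormedRing.inverse_continuousAt u
    · exact ((continuous_algebraMap ℂ C(K, ℂ)).sub continuous_const).continuousAt
  have hmem : Ring.inverse (algebraMap ℂ C(K, ℂ) a - coordinate K : C(K, ℂ)) ∈
      polynomialClosure K := by
    refine (Subalgebra.isClosed_topologicalClosure _).mem_of_frequently_of_tendsto ?_ hcont
    refine (mem_closure_iff_frequently.1 ha).mono fun ζ hζ => ?_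
    have hi : IsUnit (algebraMap ℂ C(K, ℂ) ζ - coordinate K : C(K, ℂ)) := by
      rw [← hc]
      exact (spectrum.mem_resolventSet_iff.1 hζ).map (polynomialClosure K).val
    have h1 : (algebraMap ℂ C(K, ℂ) ζ - coordinate K : C(K, ℂ)) *
        (resolvent (coordinate K) ζ : polynomialClosure K) = 1 := by
      rw [← hc]
      exact congrArg Subtype.val (Ring.mul_inverse_cancel _ (spectrum.mem_resolventSet_iff.1 hζ))
    have h2 : Ring.inverse (algebraMap ℂ C(K, ℂ) ζ - coordinate K : C(K, ℂ)) =
        (resolvent (coordinate K) ζ : polynomialClosure K) := by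
      rw [← mul_one (Ring.inverse _), ← h1, Ring.inverse_mul_cancel_left _ _ hi]
    change Ring.inverse (algebraMap ℂ C(K, ℂ) ζ - coordinate K : C(K, ℂ)) ∈ _
    rw [h2]
    exact Subtype.mem _
  rw [spectrum.mem_resolventSet_iff]
  refine IsUnit.of_mul_eq_one ⟨_, hmem⟩ (Subtype.ext ?_)
  have hu' : IsUnit (algebraMap ℂ C(K, ℂ) a - coordinate K : C(K, ℂ)) := hu ▸ u.isUnit
  exact Ring.mul_inverse_cancel _ hu'

/-- On a simply connected domain the polynomial hull of a compact subset stays inside the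
domain. -/
lemma spectrum_coordinate_subset {D : Set ℂ} (hDo : IsOpen D) (hD : IsSimplyConnected D)
    (hKD : K ⊆ D) : spectrum ℂ (coordinate K) ⊆ D := by
  have hH := eq_empty_of_compl_eq_union hDo hD
    (H := spectrum ℂ (coordinate K) ∩ Dᶜ) (F := Dᶜ ∩ resolventSet ℂ (coordinate K))
    ((spectrum.isCompact _).inter_right hDo.isClosed_compl) ?_ ?_ ?_
  · intro x hx
    by_contra hxD
    exact (hH.subset ⟨hx, hxD⟩ : x ∈ (∅ : Set ℂ))
  · refine isClosed_of_closure_subset fun a ha => ?_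
    have h1 : a ∈ Dᶜ := closure_minimal inter_subset_left hDo.isClosed_compl ha
    exact ⟨h1, mem_resolventSet_of_mem_closure (fun h => h1 (hKD h))
      (closure_mono inter_subset_right ha)⟩
  · exact disjoint_left.2 fun x hx hx' => hx.1 hx'.2
  · ext x
    by_cases hx : x ∈ resolventSet ℂ (coordinate K) <;> simp [spectrum, hx]

/-- **Runge's theorem** on simply connected domains: holomorphic functions are approximated by
polynomials uniformly on compact sets. The function is written as the integral over the plane of
`dbar φ ζ` times the resolvent of the coordinate in `P(K)`, so that it belongs to `P(K)`. -/
theorem exists_polynomial_near {D : Set ℂ} (hDo : IsOpen D) (hD : IsSimplyConnected D)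
    {K : Set ℂ} (hK : IsCompact K) (hKD : K ⊆ D) {R : ℂ → ℂ} (hR : DifferentiableOn ℂ R D)
    {ε : ℝ} (hε : 0 < ε) : ∃ q : Polynomial ℂ, ∀ x ∈ K, ‖R x - q.eval x‖ < ε := by
  have : CompactSpace K := isCompact_iff_compactSpace.1 hK
  have hσ := spectrum_coordinate_subset hDo hD hKD
  obtain ⟨L, hL, hσL, hLD⟩ := exists_compact_between
    (spectrum.isCompact (𝕜 := ℂ) (coordinate K)) hDo hσ
  obtain ⟨χ, hχ1, hχ0, -⟩ := exists_contMDiffMap_one_nhds_of_subset_interior (n := 1)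
    (modelWithCornersSelf ℝ ℂ) (spectrum.isClosed (𝕜 := ℂ) (coordinate K)) hσL
  have hχ : ContDiff ℝ 1 χ := χ.contMDiff.contDiff
  let φ : ℂ → ℂ := fun ζ => χ ζ * R ζ
  have hφL : ∀ ζ ∉ L, φ ζ = 0 := fun ζ hζ => by simp [φ, hχ0 ζ hζ]
  have hφs : HasCompactSupport φ := HasCompactSupport.intro hL hφL
  have hφ : ContDiff ℝ 1 φ := by
    rw [contDiff_iff_contDiffAt]
    intro ζ
    by_cases hζ : ζ ∈ D
    · have h1 : ContDiffAt ℝ 1 R ζ :=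
        ((hR.analyticAt (hDo.mem_nhds hζ)).contDiffAt).restrict_scalars ℝ
      have h2 : ContDiffAt ℝ 1 (fun z : ℂ => ((χ z : ℝ) : ℂ)) ζ :=
        Complex.ofRealCLM.contDiff.contDiffAt.comp ζ hχ.contDiffAt
      exact h2.mul h1
    · have h1 : Lᶜ ∈ 𝓝 ζ := hL.isClosed.isOpen_compl.mem_nhds fun h => hζ (hLD h)
      refine (contDiffAt_const (c := (0 : ℂ))).congr_of_eventuallyEq ?_
      filter_upwards [h1] with z hz
      exact hφL z hz
  have hφR : ∀ a ∈ spectrum ℂ (coordinate K), ∀ᶠ ζ in 𝓝 a, φ ζ = R ζ := by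
    intro a ha
    filter_upwards [eventually_nhdsSet_iff_forall.1 hχ1 a ha] with ζ hζ
    simp [φ, hζ]
  have hφd : ∀ a ∈ spectrum ℂ (coordinate K), ∀ᶠ ζ in 𝓝 a, DifferentiableAt ℂ φ ζ := by
    intro a ha
    filter_upwards [(hφR a ha).eventually_nhds, hDo.mem_nhds (hσ ha)] with ζ h1 h2
    exact ((hR.differentiableAt (hDo.mem_nhds h2))).congr_of_eventuallyEq h1
  -- near the spectrum, where the resolvent is not defined, the factor `dbar φ` vanishes
  let G : ℂ → polynomialClosure K := fun ζ => dbar φ ζ • resolvent (coordinate K) ζ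
  have hGc : Continuous G := by
    rw [continuous_iff_continuousAt]
    intro a
    by_cases ha : a ∈ resolventSet ℂ (coordinate K)
    · exact (continuous_dbar hφ).continuousAt.smul
        (spectrum.hasDerivAt_resolvent_const_left ha).continuousAt
    · refine (continuousAt_const (y := (0 : polynomialClosure K))).congr ?_
      filter_upwards [hφd a ha] with z hz
      simp [G, dbar_eq_zero hz]
  have hGs : HasCompactSupport G := HasCompactSupport.intro hφs.isCompact fun ζ hζ => by
    simp [G, dbar_eq_zero_of_notMem_tsupport hζ]
  have hGi : Integrable G := hGc.integrable_of_hasCompactSupport hGs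
  let g : polynomialClosure K := (-(2 * Real.pi * Complex.I))⁻¹ • ∫ ζ, G ζ
  have hg : ∀ x : K, (g : C(K, ℂ)) x = R x := by
    intro x
    have hxσ := subset_spectrum_coordinate x.2
    let ev : polynomialClosure K →L[ℂ] ℂ :=
      ⟨(evalAt x).toLinearMap, (continuous_eval_const x).comp continuous_subtype_val⟩
    have h1 : ev (∫ ζ, G ζ) = ∫ ζ, dbar φ ζ * (ζ - x)⁻¹ := by
      rw [← ev.integral_comp_comm hGi]
      refine integral_congr_ae (Eventually.of_forall fun ζ => ?_)
      by_cases hζ : ζ ∈ resolventSet ℂ (coordinate K)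
      · change evalAt x (G ζ) = _
        simp only [G]
        rw [map_smul, evalAt_resolvent x hζ, smul_eq_mul]
      · have := dbar_eq_zero (hφd ζ hζ).self_of_nhds
        simp [G, this]
    rw [integral_dbar_mul_inv hφ hφs (hφd x hxσ), (hφR x hxσ).self_of_nhds] at h1
    have h2 : (g : C(K, ℂ)) x = ev g := rfl
    rw [h2]
    simp only [g]
    rw [map_smul, h1, smul_eq_mul, inv_mul_cancel_left₀]
    simp [Real.pi_ne_zero]
  obtain ⟨P, hP, hPg⟩ := Metric.mem_closure_iff.1 g.2 ε hε
  obtain ⟨q, -, rfl⟩ := hP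
  refine ⟨q, fun x hx => ?_⟩
  have := (ContinuousMap.dist_lt_iff hε).1 hPg ⟨x, hx⟩
  rw [hg, dist_eq_norm] at this
  simpa using this

end Runge

/-! ### Linear Fuchsian systems on a simply connected domain -/

section Linear

open Metric Set Filter Topology Lagrange Polynomial

/-- Runge's theorem with a single sequence of polynomials. -/
lemma exists_seq_tendstoUniformlyOn {D : Set ℂ} (hDo : IsOpen D) (hD : IsSimplyConnected D)
    {R : ℂ → ℂ} (hR : DifferentiableOn ℂ R D) :
    ∃ q : ℕ → Polynomial ℂ, ∀ K ⊆ D, IsCompact K →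
      TendstoUniformlyOn (fun n x => (q n).eval x) R atTop K := by
  have : LocallyCompactSpace D := hDo.locallyCompactSpace
  let E : CompactExhaustion D := default
  have hE : ∀ n, IsCompact (Subtype.val '' E n) := fun n =>
    (E.isCompact n).image continuous_subtype_val
  have h : ∀ n : ℕ, ∃ q : Polynomial ℂ, ∀ x ∈ Subtype.val '' E n,
      ‖R x - q.eval x‖ < 1 / ((n : ℝ) + 1) := fun n =>
    exists_polynomial_near hDo hD (hE n) (Subtype.coe_image_subset _ _) hR (by positivity)
  choose q hq using h
  refine ⟨q, fun K hKD hK => ?_⟩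
  obtain ⟨N, hN⟩ := E.exists_superset_of_isCompact
    (Topology.IsInducing.subtypeVal.isCompact_preimage_iff (K := K) (by simpa using hKD) |>.2 hK)
  rw [Metric.tendstoUniformlyOn_iff]
  intro ε hε
  filter_upwards [(tendsto_one_div_add_atTop_nhds_zero_nat).eventually_lt_const hε,
    eventually_ge_atTop N] with n hn hNn x hx
  rw [dist_eq_norm]
  exact (hq n x ⟨⟨x, hKD hx⟩, E.subset hNn (hN hx), rfl⟩).trans hn

variable {ι : Type*} [Fintype ι] {S : ℕ}

/-- The expression `Q v' + ∑ j, (∏ l ≠ j, (x - p l)) B j v`, in which the Fuchsian operator appears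
after multiplication by `Q`. -/
def clearedOp {n : ℕ} (p : Fin n → ℂ) (B : Fin n → Matrix ι ι ℂ) (x : ℂ) (v v' : ι → ℂ) (i : ι) :
    ℂ :=
  (nodal Finset.univ p).eval x * v' i +
    ∑ j, (nodal (Finset.univ.erase j) p).eval x * ∑ k, B j i k * v k

lemma eval_polyOp {n : ℕ} (p : Fin n → ℂ) (B : Fin n → Matrix ι ι ℂ) (y : ι → Polynomial ℂ)
    (i : ι) (x : ℂ) : (polyOp p B y i).eval x =
      clearedOp p B x (fun k => (y k).eval x) (fun k => (derivative (y k)).eval x) i := by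
  simp [polyOp_apply, polyMatrix_apply, clearedOp, eval_finsetSum]

lemma clearedOp_sub {n : ℕ} (p : Fin n → ℂ) (B : Fin n → Matrix ι ι ℂ) (x : ℂ)
    (v v' w w' : ι → ℂ) (i : ι) : clearedOp p B x v v' i - clearedOp p B x w w' i =
      clearedOp p B x (fun k => v k - w k) (fun k => v' k - w' k) i := by
  simp only [clearedOp, mul_sub, Finset.sum_sub_distrib]
  ring

/-- Off the poles, multiplication by `Q` clears the denominators. -/
lemma clearedOp_eq_iff {n : ℕ} {p : Fin n → ℂ} (B : Fin n → Matrix ι ι ℂ) {x : ℂ}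
    (hx : x ∉ range p) (v v' : ι → ℂ) (i : ι) (a b : ℂ) :
    clearedOp p B x v v' i + a = b ↔
      v' i + ∑ k, (∑ j, (x - p j)⁻¹ * B j i k) * v k + (Q p x)⁻¹ * a = (Q p x)⁻¹ * b := by
  have hne : ∀ j, x - p j ≠ 0 := fun j h => hx ⟨j, (sub_eq_zero.1 h).symm⟩
  have hQ : Q p x ≠ 0 := Finset.prod_ne_zero_iff.2 fun j _ => hne j
  have e1 : (nodal Finset.univ p).eval x = Q p x := by simp [eval_nodal, Q]
  have e2 : ∀ j, (nodal (Finset.univ.erase j) p).eval x = Q p x * (x - p j)⁻¹ := by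
    intro j
    rw [eval_nodal, Q, ← Finset.mul_prod_erase _ _ (Finset.mem_univ j)]
    field_simp [hne j]
  have e3 : clearedOp p B x v v' i =
      Q p x * (v' i + ∑ k, (∑ j, (x - p j)⁻¹ * B j i k) * v k) := by
    simp only [clearedOp, e1, e2, mul_add, Finset.sum_mul, Finset.mul_sum]
    rw [Finset.sum_comm]
    congr 1
    refine Finset.sum_congr rfl fun k _ => Finset.sum_congr rfl fun j _ => ?_
    ring
  rw [e3]
  constructor
  · rintro rfl
    field_simp
  · intro h
    have := congrArg (Q p x * ·) h
    simpa [mul_add, mul_inv_cancel_left₀ hQ] using this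

lemma exists_bound_clearedOp {n : ℕ} (p : Fin n → ℂ) (B : Fin n → Matrix ι ι ℂ) {K : Set ℂ}
    (hK : IsCompact K) : ∃ C : ℝ, 0 ≤ C ∧ ∀ x ∈ K, ∀ (v v' : ι → ℂ) (ε : ℝ), (∀ k, ‖v k‖ ≤ ε) →
      (∀ k, ‖v' k‖ ≤ ε) → ∀ i, ‖clearedOp p B x v v' i‖ ≤ C * ε := by
  let g : ι → ℂ → ℝ := fun i x => ‖(nodal Finset.univ p).eval x‖ +
    ∑ j, ‖(nodal (Finset.univ.erase j) p).eval x‖ * ∑ k, ‖B j i k‖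
  have hg : ∀ i, ∃ C, ∀ x ∈ K, ‖g i x‖ ≤ C := fun i =>
    hK.exists_bound_of_continuousOn (f := g i) (by simp only [g]; fun_prop)
  choose C hC using hg
  refine ⟨∑ i, |C i|, by positivity, fun x hx v v' ε hv hv' i => ?_⟩
  have hε : 0 ≤ ε := (norm_nonneg (v i)).trans (hv i)
  have h1 : ‖clearedOp p B x v v' i‖ ≤ g i x * ε := by
    simp only [clearedOp, g, add_mul, Finset.sum_mul, Finset.mul_sum]
    refine (norm_add_le _ _).trans (add_le_add ?_ ?_)
    · rw [norm_mul]
      exact mul_le_mul_of_nonneg_left (hv' i) (norm_nonneg _)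
    · refine (norm_sum_le _ _).trans (Finset.sum_le_sum fun j _ => ?_)
      refine (norm_sum_le _ _).trans (Finset.sum_le_sum fun k _ => ?_)
      rw [norm_mul, norm_mul, mul_assoc]
      gcongr
      exact hv k
  refine h1.trans (mul_le_mul_of_nonneg_right ?_ hε)
  calc g i x ≤ ‖g i x‖ := le_abs_self _
    _ ≤ C i := hC i x hx
    _ ≤ |C i| := le_abs_self _
    _ ≤ _ := Finset.single_le_sum (f := fun i => |C i|) (fun i _ => abs_nonneg _)
        (Finset.mem_univ i)

/-- Compact sets on which `exists_estimate` applies: every point of `D` is interior to one. -/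
lemma exists_compact_estimate {D : Set ℂ} (hDo : IsOpen D) (hD : IsSimplyConnected D)
    {p : Fin (S + 2) → ℂ} (hp : Function.Injective p) (hpD : ∀ j, p j ∈ D)
    (B : Fin (S + 2) → Matrix ι ι ℂ)
    (hB : ∀ (k : ℕ) (v : ι → ℂ), (k : ℂ) • v + (∑ j, B j).mulVec v = 0 → v = 0)
    {a : ℂ} (ha : a ∈ D) :
    ∃ K ⊆ D, IsCompact K ∧ K ∈ 𝓝 a ∧ ∃ C : ℝ, 0 ≤ C ∧ ∀ y ψ : ι → Polynomial ℂ,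
      (∀ i, (ψ i).natDegree ≤ S) → ∀ b : ℝ, 0 ≤ b →
      (∀ x ∈ K, ∀ i, ‖((polyOp p B y + ψ) i).eval x‖ ≤ b) →
      (∀ x ∈ K, ∀ i, ‖(y i).eval x‖ ≤ C * b) ∧ ∀ i k, ‖(ψ i).coeff k‖ ≤ C * b := by
  obtain ⟨K, hKD, hK, hKF⟩ := exists_controlsPrimitives hDo hD.isPathConnected (hpD 0)
    (F := insert a (range p)) ((finite_range p).insert a)
    (insert_subset ha (range_subset_iff.2 hpD))
  obtain ⟨C, hC⟩ := exists_estimate hp B hB hK fun j => hKF _ (mem_insert_of_mem _ ⟨j, rfl⟩)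
  obtain ⟨r, hr, hrK⟩ := hKF a (mem_insert _ _)
  refine ⟨K, hKD, hK.isCompact, mem_of_superset (closedBall_mem_nhds a hr) hrK, |C|,
    abs_nonneg C, fun y ψ hψ b hb h => ?_⟩
  have hle : C * b ≤ |C| * b := mul_le_mul_of_nonneg_right (le_abs_self C) hb
  obtain ⟨h1, h2⟩ := hC y ψ hψ b h
  exact ⟨fun x hx i => (h1 x hx i).trans hle, fun i k => (h2 i k).trans hle⟩

variable {D : Set ℂ} {p : Fin (S + 2) → ℂ} {B : Fin (S + 2) → Matrix ι ι ℂ}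

/-- The inhomogeneous Fuchsian system is solvable by functions holomorphic on all of `D`, after a
polynomial correction of degree at most `S` of the right-hand side: the solutions for polynomials
converging to `R` form a Cauchy sequence by `exists_estimate`. -/
theorem exists_solution (hDo : IsOpen D) (hD : IsSimplyConnected D)
    (hp : Function.Injective p) (hpD : ∀ j, p j ∈ D)
    (hB : ∀ (k : ℕ) (v : ι → ℂ), (k : ℂ) • v + (∑ j, B j).mulVec v = 0 → v = 0)
    {R : ι → ℂ → ℂ} (hR : ∀ i, DifferentiableOn ℂ (R i) D) :
    ∃ (y : ι → ℂ → ℂ) (ψ : ι → Polynomial ℂ), (∀ i, DifferentiableOn ℂ (y i) D) ∧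
      (∀ i, (ψ i).natDegree ≤ S) ∧ ∀ x ∈ D \ range p, ∀ i,
        deriv (y i) x + ∑ k, (∑ j, (x - p j)⁻¹ * B j i k) * y k x + (Q p x)⁻¹ * (ψ i).eval x =
          (Q p x)⁻¹ * R i x := by
  choose q hq using fun i => exists_seq_tendstoUniformlyOn hDo hD (hR i)
  choose y ψ hψ hyψ using fun n => exists_polyOp_add_eq p B hB fun i => q i n
  -- the approximate solutions form a Cauchy sequence
  have hCauchy : ∀ a ∈ D, ∃ K ⊆ D, K ∈ 𝓝 a ∧ ∀ ε > 0, ∃ N, ∀ m ≥ N, ∀ n ≥ N,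
      (∀ x ∈ K, ∀ i, ‖(y m i).eval x - (y n i).eval x‖ < ε) ∧
        ∀ i k, ‖(ψ m i).coeff k - (ψ n i).coeff k‖ < ε := by
    intro a ha
    obtain ⟨K, hKD, hK, hKa, C, hC0, hC⟩ := exists_compact_estimate hDo hD hp hpD B hB ha
    refine ⟨K, hKD, hKa, fun ε hε => ?_⟩
    have hb : 0 < ε / (C + 1) := by positivity
    have hu : ∀ i, ∀ᶠ n in atTop, ∀ x ∈ K, dist (R i x) ((q i n).eval x) < ε / (C + 1) / 2 :=
      fun i => Metric.tendstoUniformlyOn_iff.1 (hq i K hKD hK) _ (by positivity)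
    obtain ⟨N, hN⟩ := eventually_atTop.1 (eventually_all.2 hu)
    refine ⟨N, fun m hm n hn => ?_⟩
    have hmain := hC (y m - y n) (ψ m - ψ n) (fun i => ?_) (ε / (C + 1)) hb.le ?_
    · have hlt : C * (ε / (C + 1)) < ε := by
        rw [mul_div_assoc', div_lt_iff₀ (by positivity)]
        nlinarith
      refine ⟨fun x hx i => lt_of_le_of_lt ?_ hlt, fun i k => lt_of_le_of_lt ?_ hlt⟩
      · simpa using hmain.1 x hx i
      · simpa using hmain.2 i k
    · exact (natDegree_sub_le _ _).trans (max_le (hψ m i) (hψ n i))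
    · intro x hx i
      have e : polyOp p B (y m - y n) + (ψ m - ψ n) = (fun i => q i m) - fun i => q i n := by
        rw [← hyψ m, ← hyψ n, map_sub]
        abel
      rw [e, Pi.sub_apply, eval_sub, ← dist_eq_norm]
      refine (dist_triangle_left _ _ (R i x)).trans ?_
      have := hN m hm i x hx
      have := hN n hn i x hx
      linarith
  have hylim : ∀ i x, ∃ l, x ∈ D → Tendsto (fun n => (y n i).eval x) atTop (𝓝 l) := by
    intro i x
    by_cases hx : x ∈ D
    · obtain ⟨K, hKD, hKa, h⟩ := hCauchy x hx
      obtain ⟨l, hl⟩ := cauchySeq_tendsto_of_complete (u := fun n => (y n i).eval x)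
        (Metric.cauchySeq_iff.2 fun ε hε => by
          obtain ⟨N, hN⟩ := h ε hε
          refine ⟨N, fun m hm n hn => ?_⟩
          rw [dist_eq_norm]
          exact (hN m hm n hn).1 x (mem_of_mem_nhds hKa) i)
      exact ⟨l, fun _ => hl⟩
    · exact ⟨0, fun h => absurd h hx⟩
  choose Y hY using hylim
  have hψlim : ∀ i k, ∃ l, Tendsto (fun n => (ψ n i).coeff k) atTop (𝓝 l) := by
    intro i k
    obtain ⟨K, hKD, hKa, h⟩ := hCauchy (p 0) (hpD 0)
    refine cauchySeq_tendsto_of_complete (Metric.cauchySeq_iff.2 fun ε hε => ?_)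
    obtain ⟨N, hN⟩ := h ε hε
    refine ⟨N, fun m hm n hn => ?_⟩
    rw [dist_eq_norm]
    exact (hN m hm n hn).2 i k
  choose c hc using hψlim
  have hYloc : ∀ i, TendstoLocallyUniformlyOn (fun n x => (y n i).eval x) (Y i) atTop D := by
    intro i
    rw [Metric.tendstoLocallyUniformlyOn_iff]
    intro ε hε a ha
    obtain ⟨K, hKD, hKa, h⟩ := hCauchy a ha
    refine ⟨K, mem_nhdsWithin_of_mem_nhds hKa, ?_⟩
    obtain ⟨N, hN⟩ := h (ε / 2) (by positivity)
    filter_upwards [eventually_ge_atTop N] with n hn x hx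
    have hle : dist (Y i x) ((y n i).eval x) ≤ ε / 2 := by
      refine le_of_tendsto ((hY i x (hKD hx)).dist tendsto_const_nhds) ?_
      filter_upwards [eventually_ge_atTop N] with m hm
      rw [dist_eq_norm]
      exact ((hN m hm n hn).1 x hx i).le
    linarith
  have hdiff : ∀ i n, DifferentiableOn ℂ (fun x => (y n i).eval x) D := fun i n =>
    (y n i).differentiable.differentiableOn
  have hderiv : ∀ i, ∀ x ∈ D, Tendsto (fun n => (derivative (y n i)).eval x) atTop
      (𝓝 (deriv (Y i) x)) := by
    intro i x hx
    have := ((hYloc i).deriv (Eventually.of_forall (hdiff i)) hDo).tendsto_at hx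
    simpa [Function.comp_def, Polynomial.deriv] using this
  have hψev : ∀ i n x, (ψ n i).eval x = ∑ k ∈ Finset.range (S + 1), (ψ n i).coeff k * x ^ k :=
    fun i n x => eval_eq_sum_range' (Nat.lt_succ_of_le (hψ n i)) x
  refine ⟨Y, fun i => ∑ k ∈ Finset.range (S + 1), Polynomial.C (c i k) * Polynomial.X ^ k,
    fun i => (hYloc i).differentiableOn (Eventually.of_forall (hdiff i)) hDo, fun i => ?_,
    fun x hx i => ?_⟩
  · refine natDegree_sum_le_of_forall_le _ _ fun k hk => ?_
    exact (natDegree_C_mul_X_pow_le _ _).trans (Nat.lt_succ_iff.1 (Finset.mem_range.1 hk))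
  · have key := (clearedOp_eq_iff B hx.2 (fun k => Y k x) (fun k => deriv (Y k) x) i
      ((∑ k ∈ Finset.range (S + 1), Polynomial.C (c i k) * Polynomial.X ^ k).eval x) (R i x)).1
    refine key ?_
    have h1 : ∀ n, clearedOp p B x (fun k => (y n k).eval x)
        (fun k => (derivative (y n k)).eval x) i + (ψ n i).eval x = (q i n).eval x := by
      intro n
      rw [← eval_polyOp, ← eval_add, ← Pi.add_apply, hyψ]
    have h2 : Tendsto (fun n => (q i n).eval x) atTop (𝓝 (R i x)) :=
      (hq i {x} (singleton_subset_iff.2 hx.1) isCompact_singleton).tendsto_at rfl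
    refine tendsto_nhds_unique ?_ h2
    simp_rw [← h1]
    refine Tendsto.add ?_ ?_
    · refine ((hderiv i x hx.1).const_mul _).add (tendsto_finsetSum _ fun j _ => ?_)
      exact (tendsto_finsetSum _ fun k _ => (hY k x hx.1).const_mul _).const_mul _
    · simp_rw [hψev, eval_finsetSum, eval_mul, eval_C, eval_pow, eval_X]
      exact tendsto_finsetSum _ fun k _ => (hc i k).mul_const _

/-- The solution and the correction in `exists_solution` are unique: after approximation of `y` by
polynomials, `exists_estimate` applies with an arbitrarily small right-hand side. -/
theorem eq_zero_of_homogeneous (hDo : IsOpen D) (hD : IsSimplyConnected D)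
    (hp : Function.Injective p) (hpD : ∀ j, p j ∈ D)
    (hB : ∀ (k : ℕ) (v : ι → ℂ), (k : ℂ) • v + (∑ j, B j).mulVec v = 0 → v = 0)
    {y : ι → ℂ → ℂ} {ψ : ι → Polynomial ℂ} (hy : ∀ i, DifferentiableOn ℂ (y i) D)
    (hψ : ∀ i, (ψ i).natDegree ≤ S)
    (h : ∀ x ∈ D \ range p, ∀ i,
      deriv (y i) x + ∑ k, (∑ j, (x - p j)⁻¹ * B j i k) * y k x + (Q p x)⁻¹ * (ψ i).eval x = 0) :
    (∀ x ∈ D, ∀ i, y i x = 0) ∧ ψ = 0 := by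
  have hy' : ∀ i, DifferentiableOn ℂ (deriv (y i)) D := fun i => (hy i).deriv hDo
  -- the equation without denominators extends to the poles
  have hcl : ∀ x ∈ D, ∀ i,
      clearedOp p B x (fun k => y k x) (fun k => deriv (y k) x) i + (ψ i).eval x = 0 := by
    intro x hx i
    have hoff : ∀ z ∈ D \ range p,
        clearedOp p B z (fun k => y k z) (fun k => deriv (y k) z) i + (ψ i).eval z = 0 :=
      fun z hz => (clearedOp_eq_iff B hz.2 _ _ i _ 0).2 (by rw [h z hz i, mul_zero])
    have hcont : ContinuousAt (fun z => clearedOp p B z (fun k => y k z)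
        (fun k => deriv (y k) z) i + (ψ i).eval z) x := by
      have c1 : ∀ k, ContinuousAt (y k) x := fun k =>
        ((hy k).differentiableAt (hDo.mem_nhds hx)).continuousAt
      have c2 : ∀ k, ContinuousAt (deriv (y k)) x := fun k =>
        ((hy' k).differentiableAt (hDo.mem_nhds hx)).continuousAt
      unfold clearedOp
      fun_prop
    refine tendsto_nhds_unique (hcont.tendsto.mono_left (nhdsWithin_le_nhds (s := {x}ᶜ))) ?_
    refine tendsto_const_nhds.congr' ?_
    have hfin : (range p \ {x})ᶜ ∈ 𝓝 x :=
      ((finite_range p).sdiff).isClosed.isOpen_compl.mem_nhds fun hh => hh.2 rfl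
    filter_upwards [self_mem_nhdsWithin, mem_nhdsWithin_of_mem_nhds hfin,
      mem_nhdsWithin_of_mem_nhds (hDo.mem_nhds hx)] with z hz1 hz2 hz3
    exact (hoff z ⟨hz3, fun hz4 => hz2 ⟨hz4, hz1⟩⟩).symm
  choose q hq using fun i => exists_seq_tendstoUniformlyOn hDo hD (hy i)
  have hq' : ∀ i, ∀ K ⊆ D, IsCompact K →
      TendstoUniformlyOn (fun n x => (derivative (q i n)).eval x) (deriv (y i)) atTop K := by
    intro i K hKD hK
    have h1 : TendstoLocallyUniformlyOn (fun n x => (q i n).eval x) (y i) atTop D :=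
      (tendstoLocallyUniformlyOn_iff_forall_isCompact hDo).2 (hq i)
    have h2 := (tendstoLocallyUniformlyOn_iff_forall_isCompact hDo).1
      (h1.deriv (Eventually.of_forall fun n => (q i n).differentiable.differentiableOn) hDo)
      K hKD hK
    refine h2.congr (Eventually.of_forall fun n x _ => ?_)
    simp
  have hsmall : ∀ a ∈ D, (∀ i, y i a = 0) ∧ ∀ i k, (ψ i).coeff k = 0 := by
    intro a ha
    obtain ⟨K, hKD, hK, hKa, C, hC0, hC⟩ := exists_compact_estimate hDo hD hp hpD B hB ha
    obtain ⟨M, hM0, hM⟩ := exists_bound_clearedOp p B hK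
    have hε : ∀ ε > 0, (∀ i, ‖y i a‖ ≤ ε + C * (M * ε)) ∧
        ∀ i k, ‖(ψ i).coeff k‖ ≤ ε + C * (M * ε) := by
      intro ε hε
      have h1 : ∀ᶠ n in atTop, ∀ i, ∀ x ∈ K, dist (y i x) ((q i n).eval x) < ε :=
        eventually_all.2 fun i => Metric.tendstoUniformlyOn_iff.1 (hq i K hKD hK) ε hε
      have h2 : ∀ᶠ n in atTop, ∀ i, ∀ x ∈ K,
          dist (deriv (y i) x) ((derivative (q i n)).eval x) < ε :=
        eventually_all.2 fun i => Metric.tendstoUniformlyOn_iff.1 (hq' i K hKD hK) ε hε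
      obtain ⟨n, hn1, hn2⟩ := (h1.and h2).exists
      obtain ⟨e1, e2⟩ := hC (fun i => q i n) ψ hψ (M * ε) (by positivity) (fun x hx i => by
        rw [Pi.add_apply, eval_add, eval_polyOp, ← sub_zero (_ + _), ← hcl x (hKD hx) i,
          add_sub_add_right_eq_sub, clearedOp_sub]
        refine hM x hx _ _ ε (fun k => ?_) (fun k => ?_) i
        · rw [← dist_eq_norm, dist_comm]
          exact (hn1 k x hx).le
        · rw [← dist_eq_norm, dist_comm]
          exact (hn2 k x hx).le)
      refine ⟨fun i => ?_, fun i k => (e2 i k).trans (by linarith)⟩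
      have h3 := hn1 i a (mem_of_mem_nhds hKa)
      rw [dist_eq_norm] at h3
      have h4 := e1 a (mem_of_mem_nhds hKa) i
      calc ‖y i a‖ = ‖(y i a - (q i n).eval a) + (q i n).eval a‖ := by rw [sub_add_cancel]
        _ ≤ _ := (norm_add_le _ _).trans (add_le_add h3.le h4)
    have hz : ∀ z : ℂ, (∀ ε > 0, ‖z‖ ≤ ε + C * (M * ε)) → z = 0 := by
      intro z hz
      have hlim : Tendsto (fun ε : ℝ => ε + C * (M * ε)) (𝓝[>] 0) (𝓝 0) := by
        have : Continuous fun ε : ℝ => ε + C * (M * ε) := by fun_prop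
        simpa using (this.tendsto 0).mono_left nhdsWithin_le_nhds
      have := ge_of_tendsto hlim (by
        filter_upwards [self_mem_nhdsWithin] with ε hε using hz ε hε)
      exact norm_le_zero_iff.1 this
    exact ⟨fun i => hz _ fun ε he => (hε ε he).1 i, fun i k => hz _ fun ε he => (hε ε he).2 i k⟩
  refine ⟨fun x hx => (hsmall x hx).1, ?_⟩
  ext i k
  simpa using (hsmall (p 0) (hpD 0)).2 i k

end Linear

/-! ### Eigenvalues of the linearized conjugation -/

section Eigenvalues

open Finsupp

/-- If the endomorphism `f` acts on a nonzero tuple of vectors by the matrix `C`, then `f` has an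
eigenvector in their span whose eigenvalue is an eigenvalue of `C`: by the Cayley–Hamilton theorem
the characteristic polynomial of `C` in `f` annihilates the span. -/
lemma exists_eigenvector_mem_span {V n : Type*} [AddCommGroup V] [Module ℂ V] [Fintype n]
    [DecidableEq n] (f : Module.End ℂ V) (G : n → V) (C : Matrix n n ℂ)
    (hG : ∀ i, f (G i) = ∑ k, C i k • G k) (h0 : G ≠ 0) :
    ∃ c ∈ C.charpoly.roots, ∃ P ∈ Submodule.span ℂ (Set.range G), P ≠ 0 ∧ f P = c • P := by
  let T : (n → ℂ) →ₗ[ℂ] V := Fintype.linearCombination ℂ G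
  have hT : ∀ a, f (T a) = T (C.transpose.mulVec a) := by
    intro a
    simp only [T, Fintype.linearCombination_apply, map_sum, map_smul, hG, Finset.smul_sum,
      Matrix.mulVec, dotProduct, Finset.sum_smul, Matrix.transpose_apply, smul_smul]
    rw [Finset.sum_comm]
    simp only [mul_comm]
  have hTs : ∀ i, T (Pi.single i 1) = G i := fun i => by
    simp [T, Fintype.linearCombination_apply_single]
  have haeval : ∀ (q : Polynomial ℂ) (a : n → ℂ),
      Polynomial.aeval f q (T a) = T ((Polynomial.aeval C.transpose q).mulVec a) := by
    intro q
    induction q using Polynomial.induction_on' with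
    | add q r hq hr => intro a; simp [hq, hr, Matrix.add_mulVec]
    | monomial k c =>
      have hpow : ∀ a, (f ^ k) (T a) = T ((C.transpose ^ k).mulVec a) := by
        induction k with
        | zero => simp
        | succ k ih =>
          intro a
          rw [pow_succ, Module.End.mul_apply, hT, ih, Matrix.mulVec_mulVec, ← pow_succ]
      intro a
      rw [Polynomial.aeval_monomial, Polynomial.aeval_monomial, Module.End.mul_apply, hpow,
        Module.algebraMap_end_apply, ← Algebra.smul_def, Matrix.smul_mulVec, map_smul]
  have hker : ∀ P ∈ LinearMap.range T, Polynomial.aeval f C.charpoly P = 0 := by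
    rintro _ ⟨a, rfl⟩
    rw [haeval, ← Matrix.charpoly_transpose, Matrix.aeval_self_charpoly, Matrix.zero_mulVec,
      map_zero]
  have hinv : ∀ P ∈ LinearMap.range T, f P ∈ LinearMap.range T := by
    rintro _ ⟨a, rfl⟩
    exact ⟨_, (hT a).symm⟩
  have hnt : Nontrivial (LinearMap.range T) := by
    obtain ⟨i, hi⟩ := Function.ne_iff.1 h0
    exact ⟨⟨⟨G i, ⟨_, hTs i⟩⟩, 0, fun h => hi (congrArg Subtype.val h)⟩⟩
  obtain ⟨c, hc⟩ := Module.End.exists_eigenvalue (f.restrict hinv)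
  obtain ⟨P, hP⟩ := hc.exists_hasEigenvector
  have hfP : f P = c • (P : V) := congrArg Subtype.val hP.apply_eq_smul
  have hP0 : (P : V) ≠ 0 := fun h => hP.2 (Subtype.ext h)
  refine ⟨c, ?_, P, ?_, hP0, hfP⟩
  · rw [Polynomial.mem_roots (Matrix.charpoly_monic C).ne_zero]
    have h1 : Module.End.HasEigenvector f c P := Module.End.hasEigenvector_iff.2
      ⟨Module.End.mem_eigenspace_iff.2 hfP, hP0⟩
    have h2 := Module.End.aeval_apply_of_hasEigenvector (p := C.charpoly) h1
    rw [hker P P.2] at h2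
    exact (smul_eq_zero.1 h2.symm).resolve_right hP0
  · obtain ⟨a, ha⟩ := P.2
    rw [← ha]
    simp only [T, Fintype.linearCombination_apply]
    exact Submodule.sum_mem _ fun i _ => Submodule.smul_mem _ _ (Submodule.subset_span ⟨i, rfl⟩)

variable {d : ℕ}

/-- Formal series all of whose terms have degree `n`. -/
def homogeneous (d n : ℕ) : Submodule ℂ (MvPowerSeries (Fin d) ℂ) where
  carrier := {P | ∀ m, m.degree ≠ n → coeff m P = 0}
  add_mem' hP hR m hm := by simp [hP m hm, hR m hm]
  zero_mem' m _ := by simp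
  smul_mem' c P hP m hm := by simp [hP m hm]

lemma pderiv_mem_homogeneous {n : ℕ} {P : MvPowerSeries (Fin d) ℂ} (hP : P ∈ homogeneous d (n + 1))
    (k : Fin d) : pderiv ℂ k P ∈ homogeneous d n := by
  intro m hm
  rw [coeff_pderiv, hP, zero_mul]
  simpa using hm

lemma exists_pderiv_ne_zero {n : ℕ} {P : MvPowerSeries (Fin d) ℂ} (hP : P ∈ homogeneous d (n + 1))
    (h0 : P ≠ 0) : (fun k => pderiv ℂ k P) ≠ 0 := by
  obtain ⟨m, hm⟩ := (MvPowerSeries.ne_zero_iff_exists_coeff_ne_zero P).1 h0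
  have hdeg : m.degree = n + 1 := by
    by_contra h
    exact hm (hP m h)
  have hm0 : m ≠ 0 := by
    rintro rfl
    simp at hdeg
  obtain ⟨k, hk⟩ := Finsupp.ne_iff.1 hm0
  intro h
  have h1 := congrArg (coeff (m - single k 1)) (congrFun h k)
  have h2 : m - single k 1 + single k 1 = m := by
    refine tsub_add_cancel_of_le ?_
    rw [Finsupp.single_le_iff]
    exact Nat.one_le_iff_ne_zero.2 hk
  rw [coeff_pderiv, h2] at h1
  simp only [Pi.zero_apply, map_zero, mul_eq_zero, hm, false_or] at h1
  exact Nat.cast_add_one_ne_zero _ h1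

/-- The derivation `P ↦ dP · (M w)` along the linear vector field `M`. -/
def lieDeriv (M : Matrix (Fin d) (Fin d) ℂ) :
    Derivation ℂ (MvPowerSeries (Fin d) ℂ) (MvPowerSeries (Fin d) ℂ) :=
  ∑ k, linearSeries M k • pderiv ℂ k

lemma lieDeriv_apply (M : Matrix (Fin d) (Fin d) ℂ) (P : MvPowerSeries (Fin d) ℂ) :
    lieDeriv M P = ∑ k, pderiv ℂ k P * linearSeries M k := by
  have h : ⇑(lieDeriv M) = ∑ k, ⇑(linearSeries M k • pderiv ℂ k) :=
    map_sum Derivation.coeFnAddMonoidHom _ _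
  simp [h, mul_comm]

lemma pderiv_linearSeries (M : Matrix (Fin d) (Fin d) ℂ) (k l : Fin d) :
    pderiv ℂ l (linearSeries M k) = C (M k l) := by
  simp only [linearSeries, map_sum, Derivation.map_smul, pderiv_X, Pi.single_apply, smul_ite,
    smul_zero, Finset.sum_ite_eq', Finset.mem_univ, if_true]
  rw [smul_eq_C_mul, mul_one]

lemma pderiv_comm (k l : Fin d) (P : MvPowerSeries (Fin d) ℂ) :
    pderiv ℂ k (pderiv ℂ l P) = pderiv ℂ l (pderiv ℂ k P) := by
  ext m
  simp only [coeff_pderiv]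
  rw [add_right_comm]
  by_cases h : k = l
  · rw [h]
  · simp [h, Ne.symm h]
    ring

/-- The gradient of an eigenvector of `lieDeriv M` is acted on by a matrix. -/
lemma lieDeriv_pderiv (M : Matrix (Fin d) (Fin d) ℂ) (l : Fin d) (P : MvPowerSeries (Fin d) ℂ) :
    lieDeriv M (pderiv ℂ l P) =
      pderiv ℂ l (lieDeriv M P) - ∑ k, M k l • pderiv ℂ k P := by
  simp only [lieDeriv_apply, map_sum, Derivation.leibniz, pderiv_linearSeries,
    Finset.sum_add_distrib, smul_eq_mul, smul_eq_C_mul]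
  rw [eq_sub_iff_add_eq, add_comm]
  congr 1
  · refine Finset.sum_congr rfl fun k _ => ?_
    ring
  · refine Finset.sum_congr rfl fun k _ => ?_
    rw [pderiv_comm, mul_comm]

/-- On series homogeneous of degree `n`, the eigenvalues of `lieDeriv M` are sums of `n`
eigenvalues of `M`. By induction on `n`: by `lieDeriv_pderiv` the partial derivatives of an
eigenvector of eigenvalue `c` span a space on which `c - lieDeriv M` acts by the transpose of
`M`. -/
lemma exists_eq_sum_of_lieDeriv_eq {M : Matrix (Fin d) (Fin d) ℂ} {ev : Fin d → ℂ}
    (hev : M.charpoly.roots = Finset.univ.val.map ev) (n : ℕ) :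
    ∀ (P : MvPowerSeries (Fin d) ℂ) (c : ℂ), P ∈ homogeneous d n → P ≠ 0 →
      lieDeriv M P = c • P → ∃ m : Fin d → ℕ, ∑ l, m l = n ∧ c = ∑ l, (m l : ℂ) * ev l := by
  induction n with
  | zero =>
    intro P c hP h0 hc
    refine ⟨0, by simp, ?_⟩
    have hPC : P = C (coeff 0 P) := by
      ext m
      rw [coeff_C]
      split_ifs with hm
      · rw [hm]
      · exact hP m fun h => hm ((Finsupp.degree_eq_zero_iff m).1 h)
    have hD : lieDeriv M P = 0 := by
      rw [hPC, lieDeriv_apply]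
      simp
    rw [hD] at hc
    simpa using (smul_eq_zero.1 hc.symm).resolve_right h0
  | succ n ih =>
    intro P c hP h0 hc
    obtain ⟨b, hb, P', hP', hP'0, hbP⟩ := exists_eigenvector_mem_span
      (c • (1 : Module.End ℂ (MvPowerSeries (Fin d) ℂ)) - (lieDeriv M).toLinearMap)
      (fun k => pderiv ℂ k P) M.transpose (fun l => by
        change c • pderiv ℂ l P - lieDeriv M (pderiv ℂ l P) = _
        rw [lieDeriv_pderiv, hc, Derivation.map_smul, sub_sub_cancel]
        rfl) (exists_pderiv_ne_zero hP h0)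
    rw [Matrix.charpoly_transpose, hev] at hb
    obtain ⟨l, -, rfl⟩ := Multiset.mem_map.1 hb
    have hP'n : P' ∈ homogeneous d n := (Submodule.span_le.2 (by
      rintro _ ⟨k, rfl⟩
      exact pderiv_mem_homogeneous hP k)) hP'
    have hbP' : c • P' - lieDeriv M P' = ev l • P' := hbP
    obtain ⟨m, hm, hcm⟩ := ih P' (c - ev l) hP'n hP'0 (by
      rw [sub_smul, ← hbP', sub_sub_cancel])
    refine ⟨m + Pi.single l 1, by simp [Finset.sum_add_distrib, hm], ?_⟩
    have : ∑ k, ((Pi.single l 1 : Fin d → ℕ) k : ℂ) * ev k = ev l := by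
      simp [Pi.single_apply]
    simp only [Pi.add_apply, Nat.cast_add, add_mul, Finset.sum_add_distrib, this, ← hcm]
    ring

/-- The eigenvalues of a matrix can be listed with multiplicity. -/
lemma exists_charpoly_roots_eq (M : Matrix (Fin d) (Fin d) ℂ) :
    ∃ ev : Fin d → ℂ, M.charpoly.roots = Finset.univ.val.map ev := by
  have hcard : M.charpoly.roots.toList.length = d := by
    rw [Multiset.length_toList,
      (Polynomial.splits_iff_card_roots).1 (IsAlgClosed.splits M.charpoly),
      Matrix.charpoly_natDegree_eq_dim, Fintype.card_fin]
  refine ⟨fun i => M.charpoly.roots.toList.get (i.cast hcard.symm), ?_⟩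
  conv_lhs => rw [← Multiset.coe_toList M.charpoly.roots]
  simp only [Fin.univ_val_map]
  congr 1
  refine List.ext_get (by simp [hcard]) fun k h1 h2 => ?_
  simp

/-- The linear part `H ↦ dH · (M w) - M H` of the conjugation of vector fields by `w + H`. -/
def adjoint (M : Matrix (Fin d) (Fin d) ℂ) : FormalMap d →ₗ[ℂ] FormalMap d where
  toFun H := fun i => lieDeriv M (H i) - ∑ k, M i k • H k
  map_add' G H := by
    ext1 i
    simp only [Pi.add_apply, map_add, smul_add, Finset.sum_add_distrib]
    abel
  map_smul' c H := by
    ext1 i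
    simp only [Pi.smul_apply, Derivation.map_smul, RingHom.id_apply, smul_sub, Finset.smul_sum,
      smul_comm c]

lemma adjoint_apply (M : Matrix (Fin d) (Fin d) ℂ) (H : FormalMap d) (i : Fin d) :
    adjoint M H i = lieDeriv M (H i) - ∑ k, M i k • H k := rfl

/-- Nonlinear nonresonance excludes nonpositive integers from the spectrum of `adjoint M` on
homogeneous tuples of degree at least two. -/
theorem eq_zero_of_smul_add_adjoint {M : Matrix (Fin d) (Fin d) ℂ} (hM : NonlinearlyNonresonant M)
    {n : ℕ} (hn : 2 ≤ n) {H : FormalMap d} (hH : ∀ i, H i ∈ homogeneous d n) (k : ℕ)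
    (h : (k : ℂ) • H + adjoint M H = 0) : H = 0 := by
  by_contra h0
  obtain ⟨ev, hev⟩ := exists_charpoly_roots_eq M
  obtain ⟨c, hc, P, hP, hP0, hcP⟩ := exists_eigenvector_mem_span
    ((k : ℂ) • (1 : Module.End ℂ (MvPowerSeries (Fin d) ℂ)) + (lieDeriv M).toLinearMap) H M
    (fun i => by
      change (k : ℂ) • H i + lieDeriv M (H i) = _
      have := congrFun h i
      simp only [Pi.add_apply, Pi.smul_apply, adjoint_apply, Pi.zero_apply] at this
      rw [← add_sub_assoc, sub_eq_zero] at this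
      exact this) h0
  rw [hev] at hc
  obtain ⟨i, -, rfl⟩ := Multiset.mem_map.1 hc
  have hPn : P ∈ homogeneous d n := (Submodule.span_le.2 (by
    rintro _ ⟨k, rfl⟩
    exact hH k)) hP
  have hcP' : (k : ℂ) • P + lieDeriv M P = ev i • P := hcP
  obtain ⟨m, hm, hcm⟩ := exists_eq_sum_of_lieDeriv_eq hev n P (ev i - k) hPn hP0 (by
    rw [sub_smul, ← hcP', add_sub_cancel_left])
  refine hM ev hev k m i (hm ▸ hn) ?_
  rw [← hcm]
  ring

end Eigenvalues

/-! ### Orders of vanishing of formal series -/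

section FormalSeries

variable {σ : Type*} {d : ℕ}

/-- All terms of `P` have degree at least `n`. -/
def VanishesBelow (n : ℕ) (P : MvPowerSeries σ ℂ) : Prop := ∀ m, m.degree < n → coeff m P = 0

namespace VanishesBelow

variable {n k : ℕ} {P R : MvPowerSeries σ ℂ}

lemma mono (h : VanishesBelow n P) (hkn : k ≤ n) : VanishesBelow k P :=
  fun m hm => h m (hm.trans_le hkn)

lemma add (hP : VanishesBelow n P) (hR : VanishesBelow n R) : VanishesBelow n (P + R) :=
  fun m hm => by rw [map_add, hP m hm, hR m hm, add_zero]

lemma sub (hP : VanishesBelow n P) (hR : VanishesBelow n R) : VanishesBelow n (P - R) :=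
  fun m hm => by rw [map_sub, hP m hm, hR m hm, sub_zero]

lemma sum {α : Type*} {s : Finset α} {P : α → MvPowerSeries σ ℂ}
    (h : ∀ a ∈ s, VanishesBelow n (P a)) : VanishesBelow n (∑ a ∈ s, P a) := fun m hm => by
  rw [map_sum]
  exact Finset.sum_eq_zero fun a ha => h a ha m hm

lemma mul (hP : VanishesBelow n P) (hR : VanishesBelow k R) : VanishesBelow (n + k) (P * R) := by
  classical
  intro m hm
  rw [coeff_mul]
  refine Finset.sum_eq_zero fun q hq => ?_
  have hdeg : q.1.degree + q.2.degree = m.degree := by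
    rw [← Finset.HasAntidiagonal.mem_antidiagonal.1 hq, map_add]
  by_cases h : q.1.degree < n
  · rw [hP _ h, zero_mul]
  · rw [hR _ (by omega), mul_zero]

lemma pderiv (h : VanishesBelow (n + 1) P) (i : σ) :
    VanishesBelow n (MvPowerSeries.pderiv ℂ i P) := by
  intro m hm
  rw [coeff_pderiv, h, zero_mul]
  simpa using hm

end VanishesBelow

lemma vanishesBelow_zero (P : MvPowerSeries σ ℂ) : VanishesBelow 0 P :=
  fun _ h => absurd h (Nat.not_lt_zero _)

lemma vanishesBelow_X (i : σ) : VanishesBelow 1 (X i : MvPowerSeries σ ℂ) := by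
  intro m hm
  rw [(Finsupp.degree_eq_zero_iff m).1 (Nat.lt_one_iff.1 hm)]
  simp

/-- The monomial `∏ a_s ^ e_s` in the series `a`. -/
abbrev seriesMonomial (a : FormalMap d) (e : Fin d →₀ ℕ) : MvPowerSeries (Fin d) ℂ :=
  e.prod fun s k => a s ^ k

lemma seriesMonomial_add_single (a : FormalMap d) (e : Fin d →₀ ℕ) (k : Fin d) :
    seriesMonomial a (e + Finsupp.single k 1) = seriesMonomial a e * a k := by
  rw [seriesMonomial, Finsupp.prod_add_index' (by simp) (by intros; rw [pow_add])]
  simp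

lemma exists_eq_add_single {e : Fin d →₀ ℕ} (he : e ≠ 0) :
    ∃ e' k, e = e' + Finsupp.single k 1 := by
  obtain ⟨k, hk⟩ := Finsupp.ne_iff.1 he
  exact ⟨e - Finsupp.single k 1, k, (tsub_add_cancel_of_le
    (Finsupp.single_le_iff.2 (Nat.one_le_iff_ne_zero.2 hk))).symm⟩

/-- Induction on exponents, raising one of them by one at a time. -/
lemma monomial_induction {motive : (Fin d →₀ ℕ) → Prop} (e : Fin d →₀ ℕ) (zero : motive 0)
    (add_single : ∀ e k, motive e → motive (e + Finsupp.single k 1)) : motive e := by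
  obtain ⟨n, hn⟩ : ∃ n, e.degree = n := ⟨_, rfl⟩
  induction n generalizing e with
  | zero => rwa [(Finsupp.degree_eq_zero_iff e).1 hn]
  | succ n ih =>
    have he : e ≠ 0 := by
      rintro rfl
      simp at hn
    obtain ⟨e, k, rfl⟩ := exists_eq_add_single he
    refine add_single _ _ (ih _ ?_)
    rw [map_add, Finsupp.degree_single] at hn
    exact Nat.succ_injective hn

lemma vanishesBelow_seriesMonomial {a : FormalMap d} (ha : ∀ i, VanishesBelow 1 (a i))
    (e : Fin d →₀ ℕ) : VanishesBelow e.degree (seriesMonomial a e) := by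
  induction e using monomial_induction with
  | zero => exact vanishesBelow_zero _
  | add_single e k ih =>
    rw [seriesMonomial_add_single, map_add, Finsupp.degree_single]
    exact ih.mul (ha k)

/-- A perturbation of order `n + 1` of the series `a` changes their monomials of degree `r` only in
order `n + r`. -/
lemma vanishesBelow_seriesMonomial_sub {a b : FormalMap d} (ha : ∀ i, VanishesBelow 1 (a i))
    (hb : ∀ i, VanishesBelow 1 (b i)) {n : ℕ} (hab : ∀ i, VanishesBelow (n + 1) (a i - b i))
    (e : Fin d →₀ ℕ) : VanishesBelow (n + e.degree) (seriesMonomial a e - seriesMonomial b e) := by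
  induction e using monomial_induction with
  | zero => intro m _; simp
  | add_single e k ih =>
    have : seriesMonomial a (e + Finsupp.single k 1) - seriesMonomial b (e + Finsupp.single k 1) =
        (seriesMonomial a e - seriesMonomial b e) * a k +
          seriesMonomial b e * (a k - b k) := by
      rw [seriesMonomial_add_single, seriesMonomial_add_single]
      ring
    rw [this, map_add, Finsupp.degree_single]
    exact (ih.mul (ha k)).add
      (((vanishesBelow_seriesMonomial hb e).mul (hab k)).mono (by omega))

lemma hasSubst_of_vanishesBelow {a : FormalMap d} (ha : ∀ i, VanishesBelow 1 (a i)) :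
    HasSubst a :=
  hasSubst_of_constantCoeff_zero fun i => ha i 0 (by simp)

/-- Exponents of degree at most `n`. -/
def exponentsLE (d n : ℕ) : Finset (Fin d →₀ ℕ) :=
  (Finset.range (n + 1)).biUnion fun k => Finset.univ.finsuppAntidiag k

lemma mem_finsuppAntidiag_univ {m : Fin d →₀ ℕ} {n : ℕ} :
    m ∈ (Finset.univ : Finset (Fin d)).finsuppAntidiag n ↔ m.degree = n := by
  simp [Finset.mem_finsuppAntidiag, Finsupp.degree_eq_sum]

lemma mem_exponentsLE {m : Fin d →₀ ℕ} {n : ℕ} : m ∈ exponentsLE d n ↔ m.degree ≤ n := by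
  simp [exponentsLE, Finsupp.degree_eq_sum]

/-- Each coefficient of a composition is a finite sum, polynomial in the coefficients. -/
lemma coeff_subst_eq_sum {a : FormalMap d} (ha : ∀ i, VanishesBelow 1 (a i))
    (T : MvPowerSeries (Fin d) ℂ) (m : Fin d →₀ ℕ) :
    coeff m (subst a T) =
      ∑ e ∈ exponentsLE d m.degree, coeff e T * coeff m (seriesMonomial a e) := by
  rw [coeff_subst (hasSubst_of_vanishesBelow ha)]
  refine finsum_eq_sum_of_support_subset _ fun e he => ?_
  rw [Finset.mem_coe, mem_exponentsLE]
  by_contra h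
  refine he ?_
  simp only
  rw [vanishesBelow_seriesMonomial ha e m (not_le.1 h), smul_zero]

/-- The nonlinear terms of the conjugacy equation for the change of variables `w + H`, the nonlinear
part `ψ` of the transformed equation and the nonlinear part `T` of the given one. In each degree
it involves only terms of `H` and `ψ` of lower degree. -/
def nonlinearTerms (H ψ T : FormalMap d) (i : Fin d) : MvPowerSeries (Fin d) ℂ :=
  subst (fun k => X k + H k) (T i) - ∑ k, pderiv ℂ k (H i) * ψ k

lemma vanishesBelow_X_add {H : FormalMap d} (hH : ∀ i, VanishesBelow 2 (H i)) (i : Fin d) :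
    VanishesBelow 1 (X i + H i) :=
  (vanishesBelow_X i).add ((hH i).mono one_le_two)

lemma vanishesBelow_nonlinearTerms {H ψ T : FormalMap d} (hH : ∀ i, VanishesBelow 2 (H i))
    (hψ : ∀ i, VanishesBelow 2 (ψ i)) (hT : ∀ i, VanishesBelow 2 (T i)) (i : Fin d) :
    VanishesBelow 2 (nonlinearTerms H ψ T i) := by
  refine VanishesBelow.sub (fun m hm => ?_) (.sum fun k _ =>
    ((VanishesBelow.pderiv (hH i) k).mul (hψ k)).mono (by omega))
  rw [coeff_subst_eq_sum (vanishesBelow_X_add hH)]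
  refine Finset.sum_eq_zero fun e he => ?_
  rw [hT i e ((mem_exponentsLE.1 he).trans_lt hm), zero_mul]

/-- Changing `H` and `ψ` in degrees above `n` affects `nonlinearTerms` only in degrees above
`n + 1`, because `T`, `H` and `ψ` have no terms of degree less than two. -/
lemma vanishesBelow_nonlinearTerms_sub {H ψ H' ψ' T : FormalMap d} {n : ℕ}
    (hH : ∀ i, VanishesBelow 2 (H i)) (hH' : ∀ i, VanishesBelow 2 (H' i))
    (hψ : ∀ i, VanishesBelow 2 (ψ i)) (hT : ∀ i, VanishesBelow 2 (T i))
    (hHH' : ∀ i, VanishesBelow (n + 1) (H i - H' i))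
    (hψψ' : ∀ i, VanishesBelow (n + 1) (ψ i - ψ' i)) (i : Fin d) :
    VanishesBelow (n + 2) (nonlinearTerms H ψ T i - nonlinearTerms H' ψ' T i) := by
  have e : nonlinearTerms H ψ T i - nonlinearTerms H' ψ' T i =
      (subst (fun k => X k + H k) (T i) - subst (fun k => X k + H' k) (T i)) -
        ∑ k, (pderiv ℂ k (H i - H' i) * ψ k + pderiv ℂ k (H' i) * (ψ k - ψ' k)) := by
    simp only [nonlinearTerms, map_sub, sub_mul, mul_sub, Finset.sum_add_distrib,
      Finset.sum_sub_distrib]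
    ring
  rw [e]
  refine VanishesBelow.sub (fun m hm => ?_) (.sum fun k _ => VanishesBelow.add ?_ ?_)
  · rw [map_sub, coeff_subst_eq_sum (vanishesBelow_X_add hH),
      coeff_subst_eq_sum (vanishesBelow_X_add hH'), ← Finset.sum_sub_distrib]
    refine Finset.sum_eq_zero fun e he => ?_
    by_cases h2 : e.degree < 2
    · rw [hT i e h2, zero_mul, zero_mul, sub_zero]
    · rw [← mul_sub, ← map_sub, vanishesBelow_seriesMonomial_sub (n := n) (vanishesBelow_X_add hH)
        (vanishesBelow_X_add hH') (fun k => ?_) e m (by omega), mul_zero]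
      rw [add_sub_add_left_eq_sub]
      exact hHH' k
  · exact ((VanishesBelow.pderiv (hHH' i) k).mul (hψ k))
  · exact ((VanishesBelow.pderiv (hH' i) k).mul (hψψ' k)).mono (by omega)

end FormalSeries

/-! ### The linearized conjugation degree by degree -/

section DegreewiseLinearPart

variable {d : ℕ}

/-- The indices of the coefficients of degree `n` of a tuple of formal series. -/
abbrev CoeffIndex (d n : ℕ) : Type :=
  {m : Fin d →₀ ℕ // m ∈ (Finset.univ : Finset (Fin d)).finsuppAntidiag n} × Fin d

/-- The matrix of `adjoint M` on the coefficients of degree `n`. -/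
def adjointMatrix (n : ℕ) (M : Matrix (Fin d) (Fin d) ℂ) :
    Matrix (CoeffIndex d n) (CoeffIndex d n) ℂ :=
  fun a b => coeff a.1.1 (adjoint M (Pi.single b.2 (monomial b.1.1 1)) a.2)

/-- `adjoint M` preserves the degree. -/
lemma coeff_adjoint_eq_zero (M : Matrix (Fin d) (Fin d) ℂ) {H : FormalMap d} {n : ℕ}
    (hH : ∀ m, m.degree = n → ∀ i, coeff m (H i) = 0) {m : Fin d →₀ ℕ} (hm : m.degree = n)
    (i : Fin d) : coeff m (adjoint M H i) = 0 := by
  classical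
  rw [adjoint_apply, map_sub, lieDeriv_apply, map_sum, map_sum]
  have h1 : ∀ k l, coeff m (pderiv ℂ k (H i) * X l) = 0 := by
    intro k l
    rw [coeff_mul]
    refine Finset.sum_eq_zero fun q hq => ?_
    rw [coeff_X]
    split_ifs with h
    · rw [coeff_pderiv, hH _ ?_ i, zero_mul, zero_mul]
      rw [← hm, ← Finset.HasAntidiagonal.mem_antidiagonal.1 hq, h]
      simp
    · rw [mul_zero]
  rw [Finset.sum_eq_zero, Finset.sum_eq_zero, sub_zero]
  · intro k _
    rw [map_smul, hH m hm, smul_zero]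
  · intro k _
    rw [linearSeries, Finset.mul_sum, map_sum]
    refine Finset.sum_eq_zero fun l _ => ?_
    rw [mul_smul_comm, map_smul, h1, smul_zero]

/-- `adjoint M` acts on the coefficients of degree `n` by `adjointMatrix n M`. -/
lemma coeff_adjoint (M : Matrix (Fin d) (Fin d) ℂ) (H : FormalMap d) {n : ℕ}
    (a : CoeffIndex d n) : coeff a.1.1 (adjoint M H a.2) =
      ∑ b, adjointMatrix n M a b * coeff b.1.1 (H b.2) := by
  classical
  let H' : FormalMap d := ∑ b : CoeffIndex d n,
    coeff b.1.1 (H b.2) • (Pi.single b.2 (monomial b.1.1 1) : FormalMap d)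
  have h1 : ∀ m, m.degree = n → ∀ i, coeff m ((H - H') i) = 0 := by
    intro m hm i
    have h0 : H' i = ∑ b : CoeffIndex d n,
        coeff b.1.1 (H b.2) • (Pi.single b.2 (monomial b.1.1 1) : FormalMap d) i := by
      simp only [H', Finset.sum_apply, Pi.smul_apply]
    rw [Pi.sub_apply, map_sub, sub_eq_zero, h0, map_sum,
      Finset.sum_eq_single (⟨m, mem_finsuppAntidiag_univ.2 hm⟩, i)]
    · simp
    · rintro ⟨⟨m', hm'⟩, i'⟩ - hne
      by_cases hi : i' = i
      · subst hi
        have : m ≠ m' := by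
          rintro rfl
          exact hne rfl
        simp [coeff_monomial, this]
      · simp [Ne.symm hi]
    · simp
  have h2 := coeff_adjoint_eq_zero M h1 (mem_finsuppAntidiag_univ.1 a.1.2) a.2
  rw [map_sub, Pi.sub_apply, map_sub, sub_eq_zero] at h2
  rw [h2]
  simp only [H', map_sum, map_smul, Finset.sum_apply, Pi.smul_apply, smul_eq_mul, adjointMatrix,
    mul_comm]

lemma adjoint_sum_smul {n : ℕ} (c : Fin n → ℂ) (A : Fin n → Matrix (Fin d) (Fin d) ℂ)
    (H : FormalMap d) (i : Fin d) :
    adjoint (∑ j, c j • A j) H i = ∑ j, c j • adjoint (A j) H i := by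
  have h : ∀ k, linearSeries (∑ j, c j • A j) k = ∑ j, c j • linearSeries (A j) k := by
    intro k
    simp only [linearSeries, Matrix.sum_apply, Matrix.smul_apply, Finset.sum_smul, Finset.smul_sum,
      smul_assoc]
    exact Finset.sum_comm
  simp only [adjoint_apply, lieDeriv_apply, h, Matrix.sum_apply, Matrix.smul_apply, Finset.sum_smul,
    smul_sub, Finset.smul_sum, Finset.mul_sum, Finset.sum_sub_distrib, mul_smul_comm, smul_assoc]
  congr 1 <;> exact Finset.sum_comm

lemma adjointMatrix_sum_smul {k n : ℕ} (c : Fin k → ℂ) (A : Fin k → Matrix (Fin d) (Fin d) ℂ) :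
    adjointMatrix n (∑ j, c j • A j) = ∑ j, c j • adjointMatrix n (A j) := by
  ext a b
  simp [adjointMatrix, adjoint_sum_smul, Matrix.sum_apply]

lemma eq_zero_of_smul_add_adjointMatrix {M : Matrix (Fin d) (Fin d) ℂ}
    (hM : NonlinearlyNonresonant M) {n : ℕ} (hn : 2 ≤ n) (k : ℕ) (v : CoeffIndex d n → ℂ)
    (hv : (k : ℂ) • v + (adjointMatrix n M).mulVec v = 0) : v = 0 := by
  let H : FormalMap d := fun i m =>
    if h : m ∈ (Finset.univ : Finset (Fin d)).finsuppAntidiag n then v (⟨m, h⟩, i) else 0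
  have hHv : ∀ b : CoeffIndex d n, coeff b.1.1 (H b.2) = v b := by
    rintro ⟨⟨m, hm⟩, i⟩
    exact dif_pos hm
  have hHn : ∀ i, H i ∈ homogeneous d n := fun i m hm =>
    dif_neg fun h => hm (mem_finsuppAntidiag_univ.1 h)
  have hH : H = 0 := by
    refine eq_zero_of_smul_add_adjoint hM hn hHn k (funext fun i => MvPowerSeries.ext fun m => ?_)
    rw [Pi.add_apply, Pi.smul_apply, map_add, map_smul, Pi.zero_apply, map_zero]
    by_cases hm : m.degree = n
    · have h1 := coeff_adjoint M H (n := n) (⟨m, mem_finsuppAntidiag_univ.2 hm⟩, i)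
      have h2 := hHv (⟨m, mem_finsuppAntidiag_univ.2 hm⟩, i)
      have h3 := congrFun hv (⟨m, mem_finsuppAntidiag_univ.2 hm⟩, i)
      simp only at h1 h2
      rw [h1, h2]
      simpa [hHv, Matrix.mulVec, dotProduct] using h3
    · rw [hHn i m hm, coeff_adjoint_eq_zero M (n := m.degree) ?_ rfl]
      · simp
      · intro m' hm' i'
        exact hHn i' m' (hm' ▸ hm)
  funext b
  rw [← hHv, hH]
  simp

end DegreewiseLinearPart

/-! ### Analytic dependence of coefficients -/

section Taylor

variable {d : ℕ}

/-- Partial derivatives in `u` are jointly analytic, being values of the full derivative. -/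
lemma analyticAt_partialDeriv {G : ℂ → (Fin d → ℂ) → Fin d → ℂ} {q : ℂ × (Fin d → ℂ)}
    (hG : AnalyticAt ℂ (fun q : ℂ × (Fin d → ℂ) => G q.1 q.2) q) (i : Fin d) :
    AnalyticAt ℂ (fun q : ℂ × (Fin d → ℂ) => partialDeriv i (G q.1) q.2) q := by
  have h1 : AnalyticAt ℂ (fun r : ℂ × (Fin d → ℂ) =>
      fderiv ℂ (fun q : ℂ × (Fin d → ℂ) => G q.1 q.2) r (0, Pi.single i 1)) q :=
    ((ContinuousLinearMap.apply ℂ (Fin d → ℂ)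
      ((0, Pi.single i 1) : ℂ × (Fin d → ℂ))).analyticAt _).comp hG.fderiv
  refine h1.congr ?_
  filter_upwards [hG.eventually_analyticAt] with r hr
  have h2 := hr.differentiableAt.hasFDerivAt
  have h3 : HasFDerivAt (fun u : Fin d → ℂ => (r.1, u)) (ContinuousLinearMap.inr ℂ ℂ (Fin d → ℂ))
      r.2 := hasFDerivAt_prodMk_right r.1 r.2
  have h4 : HasFDerivAt (G r.1) _ r.2 :=
    HasFDerivAt.comp (f := fun u : Fin d → ℂ => (r.1, u)) r.2 h2 h3
  rw [partialDeriv, h4.fderiv]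
  simp

lemma analyticAt_multiDeriv {f : ℂ → (Fin d → ℂ) → Fin d → ℂ} {q : ℂ × (Fin d → ℂ)}
    (hf : AnalyticAt ℂ (fun q : ℂ × (Fin d → ℂ) => f q.1 q.2) q) (m : Fin d →₀ ℕ) :
    AnalyticAt ℂ (fun q : ℂ × (Fin d → ℂ) => multiDeriv m (f q.1) q.2) q := by
  unfold multiDeriv
  induction List.finRange d with
  | nil => exact hf
  | cons i l ih =>
    simp only [List.foldr_cons]
    induction m i with
    | zero => exact ih
    | succ n ihn =>
      simp only [Function.iterate_succ_apply']
      exact analyticAt_partialDeriv (G := fun x =>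
        (partialDeriv i)^[n] (l.foldr (fun i G => (partialDeriv i)^[m i] G) (f x))) ihn i

/-- The Taylor coefficients in `u` depend analytically on `x`. -/
lemma differentiableOn_coeff_taylorSeries {D : Set ℂ} {f : ℂ → (Fin d → ℂ) → Fin d → ℂ}
    (hf : AnalyticOnNhd ℂ (fun q : ℂ × (Fin d → ℂ) => f q.1 q.2) (D ×ˢ {0})) (i : Fin d)
    (m : Fin d →₀ ℕ) : DifferentiableOn ℂ (fun x => coeff m (taylorSeries (f x) i)) D := by
  intro x hx
  have h1 : AnalyticAt ℂ (fun x : ℂ => multiDeriv m (f x) 0) x :=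
    AnalyticAt.comp (g := fun q : ℂ × (Fin d → ℂ) => multiDeriv m (f q.1) q.2)
      (f := fun x : ℂ => (x, (0 : Fin d → ℂ))) (analyticAt_multiDeriv (hf (x, 0) ⟨hx, rfl⟩) m)
      (analyticAt_id.prod analyticAt_const)
  exact ((differentiableAt_pi.1 h1.differentiableAt i).const_mul _).differentiableWithinAt

lemma multiDeriv_zero (g : (Fin d → ℂ) → Fin d → ℂ) : multiDeriv 0 g = g := by
  simp [multiDeriv]

lemma multiDeriv_single (k : Fin d) (g : (Fin d → ℂ) → Fin d → ℂ) :
    multiDeriv (Finsupp.single k 1) g = partialDeriv k g := by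
  have h : ∀ l : List (Fin d), l.Nodup →
      l.foldr (fun i G => (partialDeriv i)^[Finsupp.single k 1 i] G) g =
        if k ∈ l then partialDeriv k g else g := by
    intro l hl
    induction l with
    | nil => simp
    | cons i l ih =>
      rw [List.foldr_cons, ih (List.nodup_cons.1 hl).2]
      by_cases hik : k = i
      · subst hik
        simp [(List.nodup_cons.1 hl).1]
      · simp [hik, Ne.symm hik]
  rw [multiDeriv, h _ (List.nodup_finRange d), if_pos (List.mem_finRange k)]

lemma vanishesBelow_taylorSeries {g : (Fin d → ℂ) → Fin d → ℂ} (h0 : g 0 = 0)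
    (h1 : fderiv ℂ g 0 = 0) (i : Fin d) : VanishesBelow 2 (taylorSeries g i) := by
  intro m hm
  change _ * multiDeriv m g 0 i = 0
  obtain h | h : m.degree = 0 ∨ m.degree = 1 := by omega
  · rw [(Finsupp.degree_eq_zero_iff m).1 h, multiDeriv_zero, h0, Pi.zero_apply, mul_zero]
  · obtain ⟨e, k, rfl⟩ := exists_eq_add_single (e := m) (by rintro rfl; simp at h)
    rw [map_add, Finsupp.degree_single, Nat.add_eq_right, Finsupp.degree_eq_zero_iff] at h
    rw [h, zero_add, multiDeriv_single, partialDeriv, h1]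
    simp

end Taylor

section AnalyticDependence

variable {d : ℕ} {D : Set ℂ}

/-- A family of formal series whose coefficients are holomorphic on `D`. -/
def CoeffDifferentiableOn (D : Set ℂ) (P : ℂ → MvPowerSeries (Fin d) ℂ) : Prop :=
  ∀ m, DifferentiableOn ℂ (fun x => coeff m (P x)) D

namespace CoeffDifferentiableOn

variable {P R : ℂ → MvPowerSeries (Fin d) ℂ}

lemma const (P : MvPowerSeries (Fin d) ℂ) : CoeffDifferentiableOn D fun _ => P :=
  fun _ => differentiableOn_const _

lemma add (hP : CoeffDifferentiableOn D P) (hR : CoeffDifferentiableOn D R) :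
    CoeffDifferentiableOn D fun x => P x + R x := fun m => by
  simp only [map_add]
  exact (hP m).add (hR m)

lemma sub (hP : CoeffDifferentiableOn D P) (hR : CoeffDifferentiableOn D R) :
    CoeffDifferentiableOn D fun x => P x - R x := fun m => by
  simp only [map_sub]
  exact (hP m).sub (hR m)

lemma sum {α : Type*} {s : Finset α} {P : α → ℂ → MvPowerSeries (Fin d) ℂ}
    (h : ∀ a ∈ s, CoeffDifferentiableOn D (P a)) :
    CoeffDifferentiableOn D fun x => ∑ a ∈ s, P a x := fun m => by
  simp only [map_sum]
  exact DifferentiableOn.fun_sum fun a ha => h a ha m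

lemma mul (hP : CoeffDifferentiableOn D P) (hR : CoeffDifferentiableOn D R) :
    CoeffDifferentiableOn D fun x => P x * R x := fun m => by
  classical
  simp only [coeff_mul]
  exact DifferentiableOn.fun_sum fun q _ => (hP q.1).mul (hR q.2)

lemma pderiv (hP : CoeffDifferentiableOn D P) (i : Fin d) :
    CoeffDifferentiableOn D fun x => MvPowerSeries.pderiv ℂ i (P x) := fun m => by
  simp only [coeff_pderiv]
  exact (hP _).mul_const _

lemma seriesMonomial {a : ℂ → FormalMap d} (ha : ∀ i, CoeffDifferentiableOn D fun x => a x i)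
    (e : Fin d →₀ ℕ) :
    CoeffDifferentiableOn D fun x => FuchsianNormalForm.seriesMonomial (a x) e := by
  induction e using monomial_induction with
  | zero => simpa using const 1
  | add_single e k ih =>
    simp only [seriesMonomial_add_single]
    exact ih.mul (ha k)

lemma subst {a : ℂ → FormalMap d} (ha : ∀ i, CoeffDifferentiableOn D fun x => a x i)
    (ha1 : ∀ x i, VanishesBelow 1 (a x i)) (hP : CoeffDifferentiableOn D P) :
    CoeffDifferentiableOn D fun x => MvPowerSeries.subst (a x) (P x) := fun m => by
  simp only [coeff_subst_eq_sum (ha1 _)]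
  exact DifferentiableOn.fun_sum fun e _ => (hP e).mul (seriesMonomial ha e m)

end CoeffDifferentiableOn

lemma coeffDifferentiableOn_nonlinearTerms {H ψ T : ℂ → FormalMap d}
    (hH : ∀ i, CoeffDifferentiableOn D fun x => H x i) (hH2 : ∀ x i, VanishesBelow 2 (H x i))
    (hψ : ∀ i, CoeffDifferentiableOn D fun x => ψ x i)
    (hT : ∀ i, CoeffDifferentiableOn D fun x => T x i) (i : Fin d) :
    CoeffDifferentiableOn D fun x => nonlinearTerms (H x) (ψ x) (T x) i := by
  unfold nonlinearTerms
  refine .sub (.subst (fun k => .add (.const _) (hH k)) (fun x => vanishesBelow_X_add (hH2 x))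
    (hT i)) (.sum fun k _ => .mul (.pderiv (hH i) k) (hψ k))

end AnalyticDependence

/-! ### Conjugacy to the normal form -/

section Conjugacy

open Set

variable {S d : ℕ} {p : Fin (S + 2) → ℂ} {A : Fin (S + 2) → Matrix (Fin d) (Fin d) ℂ}
  {D : Set ℂ} {f : ℂ → (Fin d → ℂ) → Fin d → ℂ}
  {h h' : (Fin d →₀ ℕ) → ℂ → Fin d → ℂ} {psi psi' : Fin d → MvPowerSeries (Fin d) (Polynomial ℂ)}

lemma coeff_higherSeries (h : (Fin d →₀ ℕ) → ℂ → Fin d → ℂ) (x : ℂ) (i : Fin d) (m : Fin d →₀ ℕ) :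
    coeff m (higherSeries h x i) = if 2 ≤ m.degree then h m x i else 0 := rfl

lemma coeff_evalSeries (psi : Fin d → MvPowerSeries (Fin d) (Polynomial ℂ)) (x : ℂ) (i : Fin d)
    (m : Fin d →₀ ℕ) : coeff m (evalSeries psi x i) = (coeff m (psi i)).eval x := by
  simp [evalSeries]

lemma vanishesBelow_higherSeries (h : (Fin d →₀ ℕ) → ℂ → Fin d → ℂ) (x : ℂ) (i : Fin d) :
    VanishesBelow 2 (higherSeries h x i) := fun m hm => by
  rw [coeff_higherSeries, if_neg (not_le.2 hm)]

lemma vanishesBelow_evalSeries (hpsi : ∀ i m, m.degree < 2 → coeff m (psi i) = 0) (x : ℂ)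
    (i : Fin d) : VanishesBelow 2 (evalSeries psi x i) := fun m hm => by
  rw [coeff_evalSeries, hpsi i m hm, Polynomial.eval_zero]

/-- The coefficient at `w ^ m` of the conjugacy equation, with the terms in which `h` and `psi` have
lower degree collected on the right-hand side. -/
def ConjugacyEquation (p : Fin (S + 2) → ℂ) (A : Fin (S + 2) → Matrix (Fin d) (Fin d) ℂ)
    (f : ℂ → (Fin d → ℂ) → Fin d → ℂ) (D : Set ℂ) (h : (Fin d →₀ ℕ) → ℂ → Fin d → ℂ)
    (psi : Fin d → MvPowerSeries (Fin d) (Polynomial ℂ)) (m : Fin d →₀ ℕ) : Prop :=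
  ∀ x ∈ D \ range p, ∀ i,
    deriv (fun t => coeff m (higherSeries h t i)) x +
        coeff m (adjoint (fuchsianMatrix p A x) (higherSeries h x) i) +
        (Q p x)⁻¹ * coeff m (evalSeries psi x i) =
      (Q p x)⁻¹ * coeff m
        (nonlinearTerms (higherSeries h x) (evalSeries psi x) (taylorSeries (f x)) i)

lemma sum_pderiv_X_add_mul (M : Matrix (Fin d) (Fin d) ℂ) (H ψ : FormalMap d) (q : ℂ) (i : Fin d) :
    ∑ k, pderiv ℂ k (X i + H i) * (linearSeries M k + q • ψ k) =
      linearSeries M i + q • ψ i + lieDeriv M (H i) + q • ∑ k, pderiv ℂ k (H i) * ψ k := by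
  simp only [map_add, add_mul, mul_add, Finset.sum_add_distrib, pderiv_X, Pi.single_apply,
    ite_mul, one_mul, zero_mul, Finset.sum_ite_eq, Finset.mem_univ, if_true,
    lieDeriv_apply, mul_smul_comm, Finset.smul_sum, smul_add, smul_ite, smul_zero]
  ring

lemma subst_linearSeries_add {H : FormalMap d} (hH : ∀ i, VanishesBelow 2 (H i))
    (M : Matrix (Fin d) (Fin d) ℂ) (T : FormalMap d) (q : ℂ) (i : Fin d) :
    subst (fun k => X k + H k) (linearSeries M i + q • T i) =
      linearSeries M i + ∑ k, M i k • H k + q • subst (fun k => X k + H k) (T i) := by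
  have ha := hasSubst_of_vanishesBelow (vanishesBelow_X_add hH)
  rw [subst_add ha, subst_smul ha]
  congr 1
  rw [linearSeries, ← coe_substAlgHom ha, map_sum]
  simp only [map_smul, coe_substAlgHom ha, subst_X ha, smul_add, Finset.sum_add_distrib]

/-- The system is transformed into the normal form iff the conjugacy equation holds in all
coefficients. The terms linear in `h` combine to `adjoint (A x)`. -/
lemma transformsOn_iff : TransformsOn (D \ range p) (changeOfVariables h)
      (nonlinearSystem p A f) (normalForm p A psi) ↔ ∀ m, ConjugacyEquation p A f D h psi m := by
  have key : ∀ x i m, coeff m (xDeriv (changeOfVariables h) x i +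
      ∑ k, pderiv ℂ k (changeOfVariables h x i) * normalForm p A psi x k) -
      coeff m (subst (changeOfVariables h x) (nonlinearSystem p A f x i)) =
      (deriv (fun t => coeff m (higherSeries h t i)) x +
        coeff m (adjoint (fuchsianMatrix p A x) (higherSeries h x) i) +
        (Q p x)⁻¹ * coeff m (evalSeries psi x i)) -
      (Q p x)⁻¹ * coeff m
        (nonlinearTerms (higherSeries h x) (evalSeries psi x) (taylorSeries (f x)) i) := by
    intro x i m
    have e1 : coeff m (xDeriv (changeOfVariables h) x i) =
        deriv (fun t => coeff m (higherSeries h t i)) x := by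
      change deriv (fun t => coeff m (X i + higherSeries h t i)) x = _
      simp only [map_add, deriv_const_add]
    have e2 := sum_pderiv_X_add_mul (fuchsianMatrix p A x) (higherSeries h x) (evalSeries psi x)
      (Q p x)⁻¹ i
    have e3 := subst_linearSeries_add (vanishesBelow_higherSeries h x) (fuchsianMatrix p A x)
      (taylorSeries (f x)) (Q p x)⁻¹ i
    have e4 : ∑ k, pderiv ℂ k (changeOfVariables h x i) * normalForm p A psi x k = _ := e2
    have e5 : subst (changeOfVariables h x) (nonlinearSystem p A f x i) = _ := e3
    rw [map_add, e1, e4, e5]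
    simp only [nonlinearTerms, adjoint_apply, map_add, map_sub, map_smul, smul_eq_mul]
    ring
  constructor
  · intro hT m x hx i
    rw [← sub_eq_zero, ← key, hT x hx i, sub_self]
  · intro hm x hx i
    refine MvPowerSeries.ext fun m => ?_
    rw [← sub_eq_zero, key, hm m x hx i, sub_self]

lemma conjugacyEquation_of_degree_lt_two (hpsi : ∀ i m, m.degree < 2 → coeff m (psi i) = 0)
    (hT : ∀ x ∈ D, ∀ i, VanishesBelow 2 (taylorSeries (f x) i)) {m : Fin d →₀ ℕ}
    (hm : m.degree < 2) : ConjugacyEquation p A f D h psi m := by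
  intro x hx i
  have hH := vanishesBelow_higherSeries h
  have hψ := vanishesBelow_evalSeries hpsi
  have e1 : (fun t => coeff m (higherSeries h t i)) = fun _ => 0 := funext fun t => hH t i m hm
  rw [vanishesBelow_nonlinearTerms (hH x) (hψ x) (hT x hx.1) i m hm, hψ x i m hm, e1,
    coeff_adjoint_eq_zero _ (n := m.degree) ?_ rfl]
  · simp
  · intro m' hm' i'
    exact hH x i' m' (hm' ▸ hm)

/-- The right-hand side of the conjugacy equation depends only on lower degrees. -/
lemma coeff_nonlinearTerms_congr (hpsi : ∀ i m, m.degree < 2 → coeff m (psi i) = 0) {x : ℂ}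
    {T : FormalMap d} (hT : ∀ i, VanishesBelow 2 (T i)) {m : Fin d →₀ ℕ} (hm : 2 ≤ m.degree)
    (hh : ∀ k, 2 ≤ k.degree → k.degree < m.degree → h k x = h' k x)
    (hψ : ∀ k, k.degree < m.degree → ∀ i, coeff k (psi i) = coeff k (psi' i)) (i : Fin d) :
    coeff m (nonlinearTerms (higherSeries h x) (evalSeries psi x) T i) =
      coeff m (nonlinearTerms (higherSeries h' x) (evalSeries psi' x) T i) := by
  obtain ⟨n, hn⟩ := Nat.exists_eq_add_of_le' hm
  rw [← sub_eq_zero, ← map_sub]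
  refine vanishesBelow_nonlinearTerms_sub (n := n + 1) (vanishesBelow_higherSeries h x)
    (vanishesBelow_higherSeries h' x) (vanishesBelow_evalSeries hpsi x) hT (fun j k hk => ?_)
    (fun j k hk => ?_) i m (by omega)
  · rw [map_sub, coeff_higherSeries, coeff_higherSeries]
    split_ifs with h2
    · rw [hh k h2 (by omega), sub_self]
    · rw [sub_zero]
  · rw [map_sub, coeff_evalSeries, coeff_evalSeries, hψ k (by omega), sub_self]

lemma sum_inv_mul_adjointMatrix {n : ℕ} (x : ℂ) (a b : CoeffIndex d n) :
    ∑ j, (x - p j)⁻¹ * adjointMatrix n (A j) a b = adjointMatrix n (fuchsianMatrix p A x) a b := by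
  rw [fuchsianMatrix, adjointMatrix_sum_smul, Matrix.sum_apply]
  simp

lemma adjointMatrix_nonresonant (hA : NonlinearlyNonresonant (∑ j, A j)) {n : ℕ} (hn : 2 ≤ n)
    (k : ℕ) (v : CoeffIndex d n → ℂ)
    (hv : (k : ℂ) • v + (∑ j, adjointMatrix n (A j)).mulVec v = 0) : v = 0 := by
  refine eq_zero_of_smul_add_adjointMatrix hA hn k v ?_
  have := adjointMatrix_sum_smul (n := n) (fun _ => 1) A
  simp only [one_smul] at this
  rwa [this]

/-- The conjugacy equation in degree `n`, with the terms of lower degree given, is a linear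
inhomogeneous Fuchsian system for the coefficients of `h` of degree `n`. -/
lemma exists_conjugacyEquation_of_degree_eq (hp : Function.Injective p) (hDo : IsOpen D)
    (hD : IsSimplyConnected D) (hpD : ∀ j, p j ∈ D)
    (hf : AnalyticOnNhd ℂ (fun q : ℂ × (Fin d → ℂ) => f q.1 q.2) (D ×ˢ {0}))
    (hT : ∀ x ∈ D, ∀ i, VanishesBelow 2 (taylorSeries (f x) i))
    (hA : NonlinearlyNonresonant (∑ j, A j))
    (hpsi : ∀ i m, m.degree < 2 → coeff m (psi i) = 0)
    (hdeg : ∀ i m, (coeff m (psi i)).natDegree ≤ S)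
    (hh : ∀ m i, DifferentiableOn ℂ (fun x => h m x i) D) (n : ℕ) :
    ∃ (h' : (Fin d →₀ ℕ) → ℂ → Fin d → ℂ) (psi' : Fin d → MvPowerSeries (Fin d) (Polynomial ℂ)),
      (∀ i m, m.degree < 2 → coeff m (psi' i) = 0) ∧
      (∀ i m, (coeff m (psi' i)).natDegree ≤ S) ∧
      (∀ m i, DifferentiableOn ℂ (fun x => h' m x i) D) ∧
      (∀ m, m.degree < n → h' m = h m ∧ ∀ i, coeff m (psi' i) = coeff m (psi i)) ∧
      ∀ m, m.degree = n → ConjugacyEquation p A f D h' psi' m := by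
  by_cases hn : n < 2
  · exact ⟨h, psi, hpsi, hdeg, hh, fun m _ => ⟨rfl, fun _ => rfl⟩,
      fun m hm => conjugacyEquation_of_degree_lt_two hpsi hT (hm ▸ hn)⟩
  rw [not_lt] at hn
  have hR : ∀ a : CoeffIndex d n, DifferentiableOn ℂ (fun x => coeff a.1.1
      (nonlinearTerms (higherSeries h x) (evalSeries psi x) (taylorSeries (f x)) a.2)) D := by
    intro a
    refine coeffDifferentiableOn_nonlinearTerms (fun i m => ?_) (vanishesBelow_higherSeries h)
      (fun i m => ?_) (fun i m => differentiableOn_coeff_taylorSeries hf i m) a.2 a.1.1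
    · simp only [coeff_higherSeries]
      split_ifs
      · exact hh m i
      · exact differentiableOn_const _
    · simp only [coeff_evalSeries]
      exact (coeff m (psi i)).differentiable.differentiableOn
  obtain ⟨y, ψ, hy, hψ, heq⟩ := exists_solution (B := fun j => adjointMatrix n (A j)) hDo hD hp hpD
    (adjointMatrix_nonresonant hA hn) hR
  let h' : (Fin d →₀ ℕ) → ℂ → Fin d → ℂ := fun m x i =>
    if hm : m ∈ (Finset.univ : Finset (Fin d)).finsuppAntidiag n then y (⟨m, hm⟩, i) x else h m x i
  let psi' : Fin d → MvPowerSeries (Fin d) (Polynomial ℂ) := fun i m =>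
    if hm : m ∈ (Finset.univ : Finset (Fin d)).finsuppAntidiag n then ψ (⟨m, hm⟩, i)
    else coeff m (psi i)
  have hh' : ∀ a : CoeffIndex d n, ∀ x, h' a.1.1 x a.2 = y a x := fun a x => dif_pos a.1.2
  have hpsi' : ∀ a : CoeffIndex d n, coeff a.1.1 (psi' a.2) = ψ a := fun a => dif_pos a.1.2
  have hh0 : ∀ m, m.degree ≠ n → h' m = h m := fun m hm => by
    funext x i
    exact dif_neg fun hm' => hm (mem_finsuppAntidiag_univ.1 hm')
  have hpsi0 : ∀ m, m.degree ≠ n → ∀ i, coeff m (psi' i) = coeff m (psi i) := fun m hm i =>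
    dif_neg fun hm' => hm (mem_finsuppAntidiag_univ.1 hm')
  refine ⟨h', psi', fun i m hm => ?_, fun i m => ?_, fun m i => ?_, fun m hm =>
    ⟨hh0 m hm.ne, hpsi0 m hm.ne⟩, fun m hm x hx i => ?_⟩
  · rw [hpsi0 m (by omega), hpsi i m hm]
  · by_cases hm : m.degree = n
    · have := hpsi' (⟨m, mem_finsuppAntidiag_univ.2 hm⟩, i)
      simp only at this
      rw [this]
      exact hψ _
    · rw [hpsi0 m hm]
      exact hdeg i m
  · by_cases hm : m.degree = n
    · have := hh' (⟨m, mem_finsuppAntidiag_univ.2 hm⟩, i)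
      simp only at this
      simp only [this]
      exact hy _
    · simp only [hh0 m hm]
      exact hh m i
  · let a : CoeffIndex d n := (⟨m, mem_finsuppAntidiag_univ.2 hm⟩, i)
    have hH : ∀ (b : CoeffIndex d n) t, coeff b.1.1 (higherSeries h' t b.2) = y b t := fun b t => by
      rw [coeff_higherSeries, if_pos, hh']
      rw [mem_finsuppAntidiag_univ.1 b.1.2]
      exact hn
    have e1 : (fun t => coeff m (higherSeries h' t i)) = y a := funext fun t => hH a t
    have e2 := coeff_adjoint (fuchsianMatrix p A x) (higherSeries h' x) a
    have e3 : coeff m (evalSeries psi' x i) = (ψ a).eval x := by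
      rw [coeff_evalSeries, ← hpsi' a]
    have e4 := coeff_nonlinearTerms_congr (h := h) (h' := h') (psi := psi) (psi' := psi') (x := x)
      hpsi (hT x hx.1) (m := m) (hm ▸ hn) (fun k _ hk => by rw [hh0 k (by omega)])
      (fun k hk i => (hpsi0 k (by omega) i).symm) i
    have e5 := heq x hx a
    simp only [sum_inv_mul_adjointMatrix, ← hH] at e5
    rw [e1, e3, ← e4]
    rw [← e2] at e5
    exact e5

/-- A formal change of variables to a polynomial normal form exists, by recursion on the degree. -/
theorem exists_conjugacyEquation (hp : Function.Injective p) (hDo : IsOpen D)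
    (hD : IsSimplyConnected D) (hpD : ∀ j, p j ∈ D)
    (hf : AnalyticOnNhd ℂ (fun q : ℂ × (Fin d → ℂ) => f q.1 q.2) (D ×ˢ {0}))
    (hT : ∀ x ∈ D, ∀ i, VanishesBelow 2 (taylorSeries (f x) i))
    (hA : NonlinearlyNonresonant (∑ j, A j)) :
    ∃ (h : (Fin d →₀ ℕ) → ℂ → Fin d → ℂ) (psi : Fin d → MvPowerSeries (Fin d) (Polynomial ℂ)),
      (∀ i m, m.degree < 2 → coeff m (psi i) = 0) ∧
      (∀ i m, (coeff m (psi i)).natDegree ≤ S) ∧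
      (∀ m i, DifferentiableOn ℂ (fun x => h m x i) D) ∧
      ∀ m, ConjugacyEquation p A f D h psi m := by
  -- the state at stage `n` solves the equation in degrees below `n`, and degrees below `n` do not
  -- change any more at later stages
  let State := {s : ((Fin d →₀ ℕ) → ℂ → Fin d → ℂ) ×
      (Fin d → MvPowerSeries (Fin d) (Polynomial ℂ)) //
    (∀ i m, m.degree < 2 → coeff m (s.2 i) = 0) ∧ (∀ i m, (coeff m (s.2 i)).natDegree ≤ S) ∧
      ∀ m i, DifferentiableOn ℂ (fun x => s.1 m x i) D}
  have step : ∀ (n : ℕ) (s : State), ∃ s' : State, (∀ m, m.degree < n → s'.1.1 m = s.1.1 m ∧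
      ∀ i, coeff m (s'.1.2 i) = coeff m (s.1.2 i)) ∧
      ∀ m, m.degree = n → ConjugacyEquation p A f D s'.1.1 s'.1.2 m := by
    rintro n ⟨⟨h, psi⟩, h1, h2, h3⟩
    obtain ⟨h', psi', h1', h2', h3', h4, h5⟩ :=
      exists_conjugacyEquation_of_degree_eq hp hDo hD hpD hf hT hA h1 h2 h3 n
    exact ⟨⟨⟨h', psi'⟩, h1', h2', h3'⟩, h4, h5⟩
  choose next hnext heq using step
  let s : ℕ → State := fun n => Nat.rec ⟨⟨0, 0⟩, by simp, by simp, by simp⟩ next n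
  have hagree : ∀ (m : Fin d →₀ ℕ) n, m.degree < n →
      (s n).1.1 m = (s (m.degree + 1)).1.1 m ∧
        ∀ i, coeff m ((s n).1.2 i) = coeff m ((s (m.degree + 1)).1.2 i) := by
    intro m n hn
    induction n, hn using Nat.le_induction with
    | base => exact ⟨rfl, fun _ => rfl⟩
    | succ n hn ih =>
      obtain ⟨e1, e2⟩ := hnext n (s n) m hn
      exact ⟨e1.trans ih.1, fun i => (e2 i).trans (ih.2 i)⟩
  let h : (Fin d →₀ ℕ) → ℂ → Fin d → ℂ := fun m => (s (m.degree + 1)).1.1 m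
  let psi : Fin d → MvPowerSeries (Fin d) (Polynomial ℂ) :=
    fun i m => coeff m ((s (m.degree + 1)).1.2 i)
  have hpsi0 : ∀ i m, m.degree < 2 → coeff m (psi i) = 0 :=
    fun i m hm => (s (m.degree + 1)).2.1 i m hm
  refine ⟨h, psi, hpsi0, fun i m => (s (m.degree + 1)).2.2.1 i m,
    fun m i => (s (m.degree + 1)).2.2.2 m i, fun m => ?_⟩
  by_cases hm : m.degree < 2
  · exact conjugacyEquation_of_degree_lt_two hpsi0 hT hm
  rw [not_lt] at hm
  have hsh : ∀ k, k.degree ≤ m.degree → (s (m.degree + 1)).1.1 k = h k := fun k hk =>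
    (hagree k _ (Nat.lt_succ_of_le hk)).1
  have hspsi : ∀ k, k.degree ≤ m.degree → ∀ i, coeff k ((s (m.degree + 1)).1.2 i) =
      coeff k (psi i) := fun k hk => (hagree k _ (Nat.lt_succ_of_le hk)).2
  have hcoeff : ∀ t k i, k.degree = m.degree →
      coeff k (higherSeries (s (m.degree + 1)).1.1 t i) = coeff k (higherSeries h t i) := by
    intro t k i hk
    rw [coeff_higherSeries, coeff_higherSeries, hsh k hk.le]
  intro x hx i
  have e := heq m.degree (s m.degree) m rfl x hx i
  change deriv (fun t => coeff m (higherSeries (s (m.degree + 1)).1.1 t i)) x +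
    coeff m (adjoint _ (higherSeries (s (m.degree + 1)).1.1 x) i) +
    _ * coeff m (evalSeries (s (m.degree + 1)).1.2 x i) = _ * coeff m
      (nonlinearTerms (higherSeries (s (m.degree + 1)).1.1 x)
        (evalSeries (s (m.degree + 1)).1.2 x) _ i) at e
  have e1 : coeff m (adjoint (fuchsianMatrix p A x) (higherSeries (s (m.degree + 1)).1.1 x) i) =
      coeff m (adjoint (fuchsianMatrix p A x) (higherSeries h x) i) := by
    rw [← sub_eq_zero, ← map_sub, ← Pi.sub_apply, ← map_sub]
    refine coeff_adjoint_eq_zero _ (fun k hk j => ?_) rfl i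
    rw [Pi.sub_apply, map_sub, hcoeff x k j hk, sub_self]
  rw [e1, coeff_evalSeries, hspsi m le_rfl, ← coeff_evalSeries,
    coeff_nonlinearTerms_congr (h' := h) (psi' := psi) (s (m.degree + 1)).2.1 (hT x hx.1) hm
      (fun k _ hk => congrFun (hsh k hk.le) x) (fun k hk => hspsi k hk.le)] at e
  simp only [hcoeff _ m i rfl] at e
  exact e

/-- The polynomial normal form is unique: by induction on the degree, the difference of two
solutions satisfies a homogeneous linear equation. -/
theorem eq_of_conjugacyEquation (hp : Function.Injective p) (hDo : IsOpen D)
    (hD : IsSimplyConnected D) (hpD : ∀ j, p j ∈ D)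
    (hT : ∀ x ∈ D, ∀ i, VanishesBelow 2 (taylorSeries (f x) i))
    (hA : NonlinearlyNonresonant (∑ j, A j))
    (hpsi : ∀ i m, m.degree < 2 → coeff m (psi i) = 0)
    (hdeg : ∀ i m, (coeff m (psi i)).natDegree ≤ S)
    (hh : ∀ m, 2 ≤ m.degree → ∀ i, DifferentiableOn ℂ (fun x => h m x i) D)
    (heq : ∀ m, ConjugacyEquation p A f D h psi m)
    (hpsi' : ∀ i m, m.degree < 2 → coeff m (psi' i) = 0)
    (hdeg' : ∀ i m, (coeff m (psi' i)).natDegree ≤ S)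
    (hh' : ∀ m, 2 ≤ m.degree → ∀ i, DifferentiableOn ℂ (fun x => h' m x i) D)
    (heq' : ∀ m, ConjugacyEquation p A f D h' psi' m) : psi = psi' := by
  have main : ∀ n, ∀ m : Fin d →₀ ℕ, m.degree = n → (2 ≤ m.degree → ∀ x ∈ D, h m x = h' m x) ∧
      ∀ i, coeff m (psi i) = coeff m (psi' i) := by
    intro n
    induction n using Nat.strong_induction_on with
    | _ n ih =>
    by_cases hn : n < 2
    · exact fun m hm => ⟨fun h2 => absurd h2 (by omega),
        fun i => by rw [hpsi i m (hm ▸ hn), hpsi' i m (hm ▸ hn)]⟩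
    rw [not_lt] at hn
    have h2 : ∀ a : CoeffIndex d n, 2 ≤ a.1.1.degree := fun a => by
      rw [mem_finsuppAntidiag_univ.1 a.1.2]
      exact hn
    obtain ⟨hy0, hψ0⟩ := eq_zero_of_homogeneous (B := fun j => adjointMatrix n (A j)) hDo hD hp hpD
      (adjointMatrix_nonresonant hA hn)
      (y := fun a x => h a.1.1 x a.2 - h' a.1.1 x a.2)
      (ψ := fun a => coeff a.1.1 (psi a.2) - coeff a.1.1 (psi' a.2))
      (fun a => (hh _ (h2 a) a.2).sub (hh' _ (h2 a) a.2))
      (fun a => (Polynomial.natDegree_sub_le _ _).trans (max_le (hdeg _ _) (hdeg' _ _)))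
      (by
        intro x hx a
        have e := heq a.1.1 x hx a.2
        have e' := heq' a.1.1 x hx a.2
        rw [coeff_nonlinearTerms_congr (h' := h') (psi' := psi') hpsi (hT x hx.1) (h2 a)
          (fun k hk2 hk => (ih k.degree (by
            rwa [mem_finsuppAntidiag_univ.1 a.1.2] at hk) k rfl).1 hk2 x hx.1)
          (fun k hk => (ih k.degree (by
            rwa [mem_finsuppAntidiag_univ.1 a.1.2] at hk) k rfl).2), ← e', coeff_adjoint,
          coeff_adjoint] at e
        simp only [coeff_higherSeries, h2, if_true, coeff_evalSeries] at e
        have hd := ((hh _ (h2 a) a.2).differentiableAt (hDo.mem_nhds hx.1))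
        have hd' := ((hh' _ (h2 a) a.2).differentiableAt (hDo.mem_nhds hx.1))
        rw [deriv_fun_sub hd hd']
        simp only [sum_inv_mul_adjointMatrix, mul_sub, Finset.sum_sub_distrib,
          Polynomial.eval_sub]
        linear_combination e)
    intro m hm
    refine ⟨fun _ x hx => funext fun i => ?_, fun i => ?_⟩
    · exact sub_eq_zero.1 (hy0 x hx (⟨m, mem_finsuppAntidiag_univ.2 hm⟩, i))
    · exact sub_eq_zero.1 (congrFun hψ0 (⟨m, mem_finsuppAntidiag_univ.2 hm⟩, i))
  funext i
  exact MvPowerSeries.ext fun m => (main m.degree m rfl).2 i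

end Conjugacy

end FuchsianNormalForm

end

open FuchsianNormalForm in
theorem theorem2 (S d : ℕ) (p : Fin (S + 2) → ℂ) (hp : Function.Injective p)
    (A : Fin (S + 2) → Matrix (Fin d) (Fin d) ℂ)
    (D : Set ℂ) (hDopen : IsOpen D) (hDsc : IsSimplyConnected D) (hpD : ∀ j, p j ∈ D)
    (f : ℂ → (Fin d → ℂ) → Fin d → ℂ)
    (hf : AnalyticOnNhd ℂ (fun q : ℂ × (Fin d → ℂ) => f q.1 q.2) (D ×ˢ {0}))
    (hf0 : ∀ x ∈ D, f x 0 = 0) (hf1 : ∀ x ∈ D, fderiv ℂ (f x) 0 = 0)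
    (hA : ∀ j, NonlinearlyNonresonant (A j)) (hAinf : NonlinearlyNonresonant (∑ j, A j)) :
    ∃! psi : Fin d → MvPowerSeries (Fin d) (Polynomial ℂ),
      (∀ i m, m.degree < 2 → MvPowerSeries.coeff m (psi i) = 0) ∧
      (∀ i m, (MvPowerSeries.coeff m (psi i)).natDegree ≤ S) ∧
      ∃ h : (Fin d →₀ ℕ) → ℂ → Fin d → ℂ,
        (∀ m, 2 ≤ m.degree → AnalyticOnNhd ℂ (h m) D) ∧
        TransformsOn (D \ Set.range p) (changeOfVariables h)
          (nonlinearSystem p A f) (normalForm p A psi) := by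
  have hT : ∀ x ∈ D, ∀ i, VanishesBelow 2 (taylorSeries (f x) i) := fun x hx =>
    vanishesBelow_taylorSeries (hf0 x hx) (hf1 x hx)
  refine existsUnique_of_exists_of_unique ?_ ?_
  · obtain ⟨h, psi, hpsi, hdeg, hh, heq⟩ :=
      exists_conjugacyEquation hp hDopen hDsc hpD hf hT hAinf
    exact ⟨psi, hpsi, hdeg, h,
      fun m _ => (differentiableOn_pi.2 (hh m)).analyticOnNhd hDopen, transformsOn_iff.2 heq⟩
  · rintro psi psi' ⟨hpsi, hdeg, h, hh, heq⟩ ⟨hpsi', hdeg', h', hh', heq'⟩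
    exact eq_of_conjugacyEquation hp hDopen hDsc hpD hT hAinf hpsi hdeg
      (fun m hm => differentiableOn_pi.1 (hh m hm).differentiableOn) (transformsOn_iff.1 heq)
      hpsi' hdeg' (fun m hm => differentiableOn_pi.1 (hh' m hm).differentiableOn)
      (transformsOn_iff.1 heq')
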